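/- Let $T>0$ and $3/2<p<\infty$. Let $u_0\in L^2(\mathbb R^2;\mathbb R^2)$ with $\operatorname{div}u_0=0$ in the sense of distributions and $\tau_0\in L^2(\mathbb R^2;\mathbb R^{2\times2})$. Consider the 2-D co-rotation inviscid Oldroyd-B model with $a=\mu=1$, $$\partial_tu+u\cdot\nabla u+\nabla P=\operatorname{div}\tau,\qquad \operatorname{div}u=0,\qquad \partial_t\tau+u\cdot\nabla\tau+\tau+Q(\Omega,\tau)=\Delta\tau,\qquad (u,\tau)|_{t=0}=(u_0,\tau_0),$$ where $(\nabla u)_{ij}=\partial_ju_i$, $\Omega=\frac12(\nabla u-(\nabla u)^{T})$, $Q(\Omega,\tau)=\tau\Omega-\Omega\tau$ and $(\operatorname{div}\tau)_i=\sum_j\partial_j\tau_{ij}$. Let $(u,\tau)$ be a weak solution on $[0,T)$, that is: (1) $u\in C([0,T];L^2)$ and $\operatorname{div}u(t)=0$ for every $t\in[0,T]$, $\nabla u\in L^\infty(0,T;L^p)$; $\tau$ is weakly continuous from $[0,T]$ to $L^2$, $\tau\in L^\infty(0,T;L^2)$ and $\nabla\tau\in L^2(0,T;L^2)$; (2) for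 all vector fields $\psi$ and matrix fields $\phi$ in $\mathscr D([0,T)\times\mathbb R^2)$ with $\operatorname{div}\psi=0$, $$\int_0^T\!\!\int_{\mathbb R^2}\big(u\cdot\psi_t+(u\otimes u):\nabla\psi-\tau:\nabla\psi\big)\,dx\,dt=-\int_{\mathbb R^2}u_0\cdot\psi(0,x)\,dx,$$ $$\int_0^T\!\!\int_{\mathbb R^2}\big(\tau:\phi_t+(u\otimes\tau):\nabla\phi-\tau:\phi-Q(\Omega,\tau):\phi-\nabla\tau:\nabla\phi\big)\,dx\,dt=-\int_{\mathbb R^2}\tau_0:\phi(0,x)\,dx .$$ Then for every $t\in[0,T)$ the functions $s\mapsto\int_{\mathbb R^2}u\cdot\operatorname{div}\tau\,dx$ and $s\mapsto e^{2s}\|\nabla\tau(s)\|_{L^2}^2$ are integrable on $(0,t)$, and $$\|u(t)\|_{L^2}^2=\|u_0\|_{L^2}^2+2\int_0^t\!\!\int_{\mathbb R^2}u\cdot\operatorname{div}\tau\,dx\,ds,$$ $$e^{2t}\|\tau(t)\|_{L^2}^2+2\int_0^te^{2s}\|\nabla\tau(s)\|_{L^2}^2\,ds=\|\tau_0\|_{L^2}^2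 .$$ (Matrices carry the Frobenius norm.) -/

import Mathlib

open MeasureTheory Set Filter Topology
open scoped NNReal ContDiff

namespace OldroydB

/-- The plane, with the Euclidean norm and Lebesgue measure. -/
abbrev Plane := EuclideanSpace ℝ (Fin 2)

/-- Real 2 × 2 matrices with the Frobenius norm; the entry in row `i`, column `j` of `A` is
`A (i, j)`. -/
abbrev Mat := EuclideanSpace ℝ (Fin 2 × Fin 2)

/-- The Hilbert space `L²(ℝ²; ℝ²)`. -/
noncomputable abbrev VecL2 := Lp Plane 2 (volume : Measure Plane)

/-- The Hilbert space `L²(ℝ²; ℝ^{2×2})`. -/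
noncomputable abbrev MatL2 := Lp Mat 2 (volume : Measure Plane)

noncomputable section

/-- The matrix with the entries of `A`. -/
def Mat.toMatrix (A : Mat) : Matrix (Fin 2) (Fin 2) ℝ := Matrix.of fun i j => A (i, j)

/-- The classical partial derivative `∂_j f (x)` of a function on the plane. -/
def partialDeriv (j : Fin 2) (f : Plane → ℝ) (x : Plane) : ℝ :=
  fderiv ℝ f x (EuclideanSpace.single j 1)

/-- `g` is the weak partial derivative `∂_j f` on the plane. -/
def IsWeakPartial (j : Fin 2) (f g : Plane → ℝ) : Prop :=
  LocallyIntegrable f ∧ LocallyIntegrable g ∧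
    ∀ χ : Plane → ℝ, ContDiff ℝ ∞ χ → HasCompactSupport χ →
      ∫ x, f x * partialDeriv j χ x = - ∫ x, g x * χ x

/-- Weak partial derivatives are unique up to null sets. -/
theorem IsWeakPartial.ae_eq {j : Fin 2} {f g h : Plane → ℝ}
    (hg : IsWeakPartial j f g) (hh : IsWeakPartial j f h) : g =ᵐ[volume] h := by
  refine ae_eq_of_integral_contDiff_smul_eq hg.2.1 hh.2.1 fun χ hχ hc => ?_
  have h1 := hg.2.2 χ hχ hc
  have h2 := hh.2.2 χ hχ hc
  have h3 : ∫ x, g x * χ x = ∫ x, h x * χ x := by linarith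
  simpa [smul_eq_mul, mul_comm] using h3

open Classical in
/-- The weak partial derivative `∂_j f` (unique up to null sets), and `0` if there is none. -/
def weakPartial (j : Fin 2) (f : Plane → ℝ) : Plane → ℝ :=
  if h : ∃ g, IsWeakPartial j f g then h.choose else 0

/-- `f` has the weak partial derivative `∂_j f` in `L^1_loc`. -/
def HasWeakPartial (j : Fin 2) (f : Plane → ℝ) : Prop := ∃ g, IsWeakPartial j f g

theorem HasWeakPartial.isWeakPartial {j : Fin 2} {f : Plane → ℝ} (h : HasWeakPartial j f) :
    IsWeakPartial j f (weakPartial j f) := by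
  have h' : ∃ g, IsWeakPartial j f g := h
  rw [weakPartial, dif_pos h']
  exact h'.choose_spec

/-- `div v = 0` in the sense of distributions. -/
def IsDivFree (v : Plane → Plane) : Prop :=
  ∀ χ : Plane → ℝ, ContDiff ℝ ∞ χ → HasCompactSupport χ →
    ∫ x, ∑ i, v x i * partialDeriv i χ x = 0

/-- The velocity gradient, `(∇v)_{ij} = ∂_j v_i`. -/
def gradU (v : Plane → Plane) (x : Plane) : Matrix (Fin 2) (Fin 2) ℝ :=
  Matrix.of fun i j => weakPartial j (fun y => v y i) x

/-- The vorticity tensor `Ω = (∇v - (∇v)ᵀ) / 2`. -/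
def vorticity (v : Plane → Plane) (x : Plane) : Matrix (Fin 2) (Fin 2) ℝ :=
  (1 / 2 : ℝ) • (gradU v x - (gradU v x).transpose)

/-- The bilinear form `Q(Ω, τ) = τ Ω - Ω τ`. -/
def corotQ (Ω τ : Matrix (Fin 2) (Fin 2) ℝ) : Matrix (Fin 2) (Fin 2) ℝ := τ * Ω - Ω * τ

/-- The divergence of a matrix field, `(div σ)_i = ∑_j ∂_j σ_{ij}`. -/
def divMat (σ : Plane → Mat) (x : Plane) (i : Fin 2) : ℝ :=
  ∑ j, weakPartial j (fun y => σ y (i, j)) x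

/-- `‖∇σ‖²_{L²}` for a matrix field `σ`. -/
def gradNormSq (σ : Plane → Mat) : ℝ :=
  ∑ i, ∑ j, ∑ k, ∫ x, weakPartial k (fun y => σ y (i, j)) x ^ 2

/-- `f ∈ 𝒟([0,T) × ℝ²)`: on `[0,T) × ℝ²` the function `f` is the restriction of a smooth function
of space-time whose compact support lies in `{t < T}`. -/
def IsTestFun {F : Type*} [NormedAddCommGroup F] [NormedSpace ℝ F] (T : ℝ)
    (f : ℝ → Plane → F) : Prop :=
  ContDiff ℝ ∞ (fun z : ℝ × Plane => f z.1 z.2) ∧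
    HasCompactSupport (fun z : ℝ × Plane => f z.1 z.2) ∧
    tsupport (fun z : ℝ × Plane => f z.1 z.2) ⊆ Iio T ×ˢ univ

/-- Weak solutions on `[0,T)`, with data `(u₀, τ₀)`, of the co-rotation inviscid Oldroyd-B model
`∂ₜu + u·∇u + ∇P = div τ`, `div u = 0`, `∂ₜτ + u·∇τ + aτ + Q(Ω, τ) = μΔτ` in the plane, in the
class `u ∈ C_T(L²) ∩ L^∞_T(Ẇ^{1,p})`, `τ ∈ C_T(L²_w) ∩ L^∞_T(L²) ∩ L²_T(Ḣ¹)`. -/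
structure IsWeakSolution (T a μ p : ℝ) (u₀ : VecL2) (τ₀ : MatL2)
    (u : ℝ → VecL2) (τ : ℝ → MatL2) : Prop where
  /-- `u ∈ C([0,T]; L²)` -/
  u_cont : ContinuousOn u (Icc 0 T)
  /-- `∇u ∈ L^∞(0,T; L^p)` -/
  u_grad : ∃ C : ℝ≥0, ∀ᵐ t ∂(volume.restrict (Ioo 0 T)), ∀ i j : Fin 2,
    HasWeakPartial j (fun x => u t x i) ∧
      eLpNorm (weakPartial j (fun x => u t x i)) (ENNReal.ofReal p) volume ≤ C
  /-- `div u = 0` -/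
  u_div : ∀ t ∈ Icc 0 T, IsDivFree (u t)
  /-- `τ` is weakly continuous on `[0,T]` with values in `L²` -/
  τ_cont : ∀ σ : MatL2, ContinuousOn (fun t => inner ℝ (τ t) σ) (Icc 0 T)
  /-- `τ ∈ L^∞(0,T; L²)` -/
  τ_bdd : ∃ C : ℝ, ∀ᵐ t ∂(volume.restrict (Ioo 0 T)), ‖τ t‖ ≤ C
  /-- `∇τ(t)` exists for almost every `t` -/
  τ_grad : ∀ᵐ t ∂(volume.restrict (Ioo 0 T)), ∀ i j k : Fin 2,
    HasWeakPartial k (fun x => τ t x (i, j))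
  /-- `∇τ ∈ L²(0,T; L²)` -/
  τ_grad_sq : ∫⁻ t in Ioo 0 T, ∑ i : Fin 2, ∑ j : Fin 2, ∑ k : Fin 2,
    eLpNorm (weakPartial k (fun x => τ t x (i, j))) 2 volume ^ 2 < ⊤
  /-- the momentum equation, tested with divergence-free `ψ` -/
  momentum : ∀ ψ : ℝ → Plane → Plane, IsTestFun T ψ →
    (∀ t ∈ Ico 0 T, ∀ x, ∑ i, partialDeriv i (fun y => ψ t y i) x = 0) →
    ∫ t in (0 : ℝ)..T, ∫ x,
        ((∑ i, u t x i * deriv (fun s => ψ s x i) t)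
          + (∑ i, ∑ j, u t x i * u t x j * partialDeriv j (fun y => ψ t y i) x)
          - ∑ i, ∑ j, τ t x (i, j) * partialDeriv j (fun y => ψ t y i) x)
      = - ∫ x, ∑ i, u₀ x i * ψ 0 x i
  /-- the stress equation -/
  stress : ∀ φ : ℝ → Plane → Mat, IsTestFun T φ →
    ∫ t in (0 : ℝ)..T, ∫ x,
        ((∑ i, ∑ j, τ t x (i, j) * deriv (fun s => φ s x (i, j)) t)
          + (∑ i, ∑ j, ∑ k,
              u t x k * τ t x (i, j) * partialDeriv k (fun y => φ t y (i, j)) x)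
          - a * (∑ i, ∑ j, τ t x (i, j) * φ t x (i, j))
          - (∑ i, ∑ j, corotQ (vorticity (u t) x) (τ t x).toMatrix i j * φ t x (i, j))
          - μ * ∑ i, ∑ j, ∑ k, weakPartial k (fun y => τ t y (i, j)) x
              * partialDeriv k (fun y => φ t y (i, j)) x)
      = - ∫ x, ∑ i, ∑ j, τ₀ x (i, j) * φ 0 x (i, j)

end

end OldroydB

/-! Formally one tests the momentum equation with `u` and the stress equation with `τ`. The
transport terms vanish because `div u = 0`. The co-rotation term vanishes pointwise: `(τΩ - Ωτ) : τ`
is the trace of `(τᵀτ - ττᵀ)Ω`, a symmetric matrix times a skew one. The damping and the Laplacian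
leave `-‖τ‖² - ‖∇τ‖²`, and the factor `e^{2t}` absorbs the damping.

The work lies in justifying these tests. The cubic term `u ⊗ u : ∇u` is integrable once `u` is in
`L^{2p'}`, with `p'` conjugate to `p`. By Sobolev, `L² ∩ Ẇ^{1,p}` embeds in this space when `p >
3/2` (`exists_eLpNorm_le_of_W1p`). The same condition gives `2p' < 6`, so that `H¹ ⊂ L⁶` puts `τ` in
`L^{2p'}` and `Q(Ω,τ) : τ` is integrable in space. In time the stress terms grow at most
quadratically in `‖∇τ‖`, which is square integrable.

At fixed mollification parameter the equations become evolutions in a separable Hilbert space with a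
bounded functional as right side, for which `energy_identity` holds: every Hilbert coefficient is
absolutely continuous, and the squares are summed. Mollifiers are self-adjoint, so the energy of the
mollified unknown is the equation tested with the double mollification. Letting the parameter tend
to infinity by dominated convergence (`limit_integral_identity`) gives the unmollified balance,
where `integral_mul_grad_eq_zero` and `GoodSlice.sum_stress_pair` remove the terms that should
vanish.

The momentum equation is known only for divergence-free tests, so no pressure appears. Its tests are
rotated gradients, and these span a dense subspace of the divergence-free `L²` fields
(`mem_closure_span_of_divFree`): a field orthogonal to them is both divergence free and curl free,
hence zero by Liouville. Weak continuity in time turns the distributional equations into integrated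
ones valid at every time (`eq_add_integral_of_weak`), so the balances hold for every `t` and not
only almost every `t`. -/

namespace OldroydB

open scoped ENNReal

noncomputable section

/-! ### Convolution and Young's inequality -/

/-- Convolution of real functions on the plane. -/
def conv (k f : Plane → ℝ) : Plane → ℝ :=
  convolution k f (ContinuousLinearMap.lsmul ℝ ℝ) volume

theorem conv_apply (k f : Plane → ℝ) (x : Plane) : conv k f x = ∫ y, k y * f (x - y) := rfl

theorem conv_congr {k f g : Plane → ℝ} (h : f =ᵐ[volume] g) : conv k f = conv k g :=
  convolution_congr _ (ae_eq_refl k) h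

theorem conv_apply_swap (k f : Plane → ℝ) (x : Plane) :
    conv k f x = ∫ y, k (x - y) * f y := by
  rw [conv, convolution_eq_swap]; rfl

theorem continuous_conv {k f : Plane → ℝ} (hk : Continuous k) (hc : HasCompactSupport k)
    (hf : LocallyIntegrable f) : Continuous (conv k f) :=
  hc.continuous_convolution_left _ hk hf

theorem enorm_conv_le (k f : Plane → ℝ) (x : Plane) :
    ‖conv k f x‖ₑ ≤ ∫⁻ y, ‖k y‖ₑ * ‖f (x - y)‖ₑ := by
  rw [conv_apply]
  refine (enorm_integral_le_lintegral_enorm _).trans_eq ?_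
  simp [enorm_mul]

/-- Jensen's inequality for averages with a finite weight. -/
theorem lintegral_mul_rpow_le {α : Type*} [MeasurableSpace α] {μ : Measure α} {w g : α → ℝ≥0∞}
    (hw : Measurable w) (hg : Measurable g) {p : ℝ} (hp : 1 ≤ p) :
    (∫⁻ y, w y * g y ∂μ) ≤ (∫⁻ y, w y * g y ^ p ∂μ) ^ (1 / p) * (∫⁻ y, w y ∂μ) ^ (1 - 1 / p) := by
  have h0 : (0 : ℝ) < p := by linarith
  -- For the measure with density `w` the claim compares the `L¹` norm of `g` with its `L^p` norm,
  -- at the price of a power of the total mass.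
  have h := eLpNorm_le_eLpNorm_mul_rpow_measure_univ (μ := μ.withDensity w) (p := 1)
    (q := ENNReal.ofReal p) (f := g) (by simpa using hp) hg.aestronglyMeasurable
  rw [eLpNorm_one_eq_lintegral_enorm, eLpNorm_eq_lintegral_rpow_enorm_toReal
    (by simpa using h0) ENNReal.ofReal_ne_top, ENNReal.toReal_ofReal h0.le] at h
  simp only [enorm_eq_self, withDensity_apply _ MeasurableSet.univ, Measure.restrict_univ] at h
  rw [lintegral_withDensity_eq_lintegral_mul _ hw hg,
    lintegral_withDensity_eq_lintegral_mul _ hw (hg.pow_const p)] at h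
  simpa using h

theorem eLpNorm_conv_le_lintegral {k f : Plane → ℝ} (hk : Continuous k)
    (hc : HasCompactSupport k) {p : ℝ} (hp : 1 ≤ p) (hf : AEStronglyMeasurable f volume) :
    eLpNorm (fun x => ∫⁻ y, ‖k y‖ₑ * ‖f (x - y)‖ₑ) (ENNReal.ofReal p) volume
      ≤ (∫⁻ y, ‖k y‖ₑ) * eLpNorm f (ENNReal.ofReal p) volume := by
  have h0 : (0 : ℝ) < p := by linarith
  have hkt : (∫⁻ y, ‖k y‖ₑ) ≠ ⊤ := (hk.integrable_of_hasCompactSupport hc).2.ne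
  obtain ⟨g, hg, hfg⟩ := hf
  -- A reflection followed by a translation preserves null sets, so `f` may be replaced by a
  -- measurable representative before Tonelli is used.
  have e1 : (fun x => ∫⁻ y, ‖k y‖ₑ * ‖f (x - y)‖ₑ) = fun x => ∫⁻ y, ‖k y‖ₑ * ‖g (x - y)‖ₑ := by
    funext x
    refine lintegral_congr_ae ?_
    have := (quasiMeasurePreserving_sub_left_of_right_invariant volume x).ae_eq hfg
    filter_upwards [this] with y hy
    simp only [Function.comp] at hy
    rw [hy]
  rw [e1, eLpNorm_congr_ae hfg]
  have hgm : Measurable g := hg.measurable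
  have hkm : Measurable fun y => ‖k y‖ₑ := hk.measurable.enorm
  rw [eLpNorm_eq_lintegral_rpow_enorm_toReal (by simpa using h0) ENNReal.ofReal_ne_top,
    eLpNorm_eq_lintegral_rpow_enorm_toReal (by simpa using h0) ENNReal.ofReal_ne_top,
    ENNReal.toReal_ofReal h0.le]
  set K := ∫⁻ y, ‖k y‖ₑ with hK
  have hm : Measurable fun z : Plane × Plane => ‖k z.2‖ₑ * ‖g (z.1 - z.2)‖ₑ ^ p :=
    (hkm.comp measurable_snd).mul
      ((hgm.comp (measurable_fst.sub measurable_snd)).enorm.pow_const p)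
  -- Jensen with weight `|k|` contributes `K^(p-1)`; Tonelli and translation invariance contribute
  -- the last factor `K`.
  have h1 : ∫⁻ x, (∫⁻ y, ‖k y‖ₑ * ‖g (x - y)‖ₑ) ^ p ≤ K ^ (p - 1) * (K * ∫⁻ x, ‖g x‖ₑ ^ p) := by
    calc ∫⁻ x, (∫⁻ y, ‖k y‖ₑ * ‖g (x - y)‖ₑ) ^ p
        ≤ ∫⁻ x, K ^ (p - 1) * ∫⁻ y, ‖k y‖ₑ * ‖g (x - y)‖ₑ ^ p := by
          refine lintegral_mono fun x => ?_
          have := lintegral_mul_rpow_le (μ := volume) hkm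
            (hgm.comp (measurable_const.sub measurable_id : Measurable fun y => x - y)).enorm hp
          calc _ ≤ ((∫⁻ y, ‖k y‖ₑ * ‖g (x - y)‖ₑ ^ p) ^ (1 / p) * K ^ (1 - 1 / p)) ^ p :=
                ENNReal.rpow_le_rpow this h0.le
            _ = _ := by
              rw [ENNReal.mul_rpow_of_nonneg _ _ h0.le, ← ENNReal.rpow_mul, ← ENNReal.rpow_mul,
                one_div_mul_cancel h0.ne', ENNReal.rpow_one, mul_comm]
              congr 2
              field_simp
      _ = K ^ (p - 1) * ∫⁻ y, ∫⁻ x, ‖k y‖ₑ * ‖g (x - y)‖ₑ ^ p := by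
          rw [lintegral_const_mul _ hm.lintegral_prod_right', lintegral_lintegral_swap]
          exact hm.aemeasurable
      _ = K ^ (p - 1) * (K * ∫⁻ x, ‖g x‖ₑ ^ p) := by
          congr 1
          rw [hK, ← lintegral_mul_const _ hkm]
          refine lintegral_congr fun y => ?_
          rw [lintegral_const_mul _ (show Measurable fun x => ‖g (x - y)‖ₑ ^ p from
            (hgm.comp (measurable_id.sub measurable_const)).enorm.pow_const p)]
          congr 1
          exact lintegral_sub_right_eq_self (fun x => ‖g x‖ₑ ^ p) y
  simp only [enorm_eq_self]
  calc _ ≤ (K ^ (p - 1) * (K * ∫⁻ x, ‖g x‖ₑ ^ p)) ^ (1 / p) :=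
        ENNReal.rpow_le_rpow h1 (by positivity)
    _ = _ := by
      rw [← mul_assoc]
      have : K ^ (p - 1) * K = K ^ p := by
        conv_lhs => rw [← ENNReal.rpow_one K, ← ENNReal.rpow_mul]
        rw [← ENNReal.rpow_add_of_nonneg _ _ (by linarith) (by norm_num)]
        congr 1; ring
      rw [this, ENNReal.mul_rpow_of_nonneg _ _ (by positivity), ← ENNReal.rpow_mul,
        mul_one_div_cancel h0.ne', ENNReal.rpow_one]

/-- Young's inequality `L¹ * L^p ⊆ L^p`. -/
theorem eLpNorm_conv_le {k f : Plane → ℝ} (hk : Continuous k) (hc : HasCompactSupport k)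
    {p : ℝ} (hp : 1 ≤ p) (hf : AEStronglyMeasurable f volume) :
    eLpNorm (conv k f) (ENNReal.ofReal p) volume
      ≤ (∫⁻ y, ‖k y‖ₑ) * eLpNorm f (ENNReal.ofReal p) volume :=
  (eLpNorm_mono_enorm fun x => by simpa using enorm_conv_le k f x).trans
    (eLpNorm_conv_le_lintegral hk hc hp hf)

theorem memLp_conv {k f : Plane → ℝ} (hk : Continuous k) (hc : HasCompactSupport k)
    {p : ℝ} (hp : 1 ≤ p) (hf : MemLp f (ENNReal.ofReal p) volume) :
    MemLp (conv k f) (ENNReal.ofReal p) volume := by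
  refine ⟨(continuous_conv hk hc (hf.locallyIntegrable (by simpa using hp))).aestronglyMeasurable,
    (eLpNorm_conv_le hk hc hp hf.1).trans_lt ?_⟩
  exact ENNReal.mul_lt_top (hk.integrable_of_hasCompactSupport hc).2 hf.2

theorem convolutionExists {k f : Plane → ℝ} (hk : Continuous k) (hc : HasCompactSupport k)
    (hf : LocallyIntegrable f) (x : Plane) : Integrable (fun y => k y * f (x - y)) :=
  hc.convolutionExists_left (ContinuousLinearMap.lsmul ℝ ℝ) hk hf x

theorem conv_add {k f g : Plane → ℝ} (hk : Continuous k) (hc : HasCompactSupport k)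
    (hf : LocallyIntegrable f) (hg : LocallyIntegrable g) :
    conv k (f + g) = conv k f + conv k g := by
  funext x
  simp only [conv_apply, Pi.add_apply, mul_add]
  exact integral_add (convolutionExists hk hc hf x) (convolutionExists hk hc hg x)

theorem conv_sub {k f g : Plane → ℝ} (hk : Continuous k) (hc : HasCompactSupport k)
    (hf : LocallyIntegrable f) (hg : LocallyIntegrable g) :
    conv k (f - g) = conv k f - conv k g := by
  funext x
  simp only [conv_apply, Pi.sub_apply, mul_sub]
  exact integral_sub (convolutionExists hk hc hf x) (convolutionExists hk hc hg x)

theorem conv_const_smul (k f : Plane → ℝ) (c : ℝ) : conv k (c • f) = c • conv k f := by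
  funext x
  simp only [conv_apply, Pi.smul_apply, smul_eq_mul, ← integral_const_mul]
  congr 1; funext y; ring

/-! ### Mollifiers and their convergence in `L^p` -/

/-- A sequence of smooth even mollifiers shrinking to the origin. -/
def bump (n : ℕ) : ContDiffBump (0 : Plane) where
  rIn := 1 / ((n : ℝ) + 1)
  rOut := 2 / ((n : ℝ) + 1)
  rIn_pos := by positivity
  rIn_lt_rOut := by gcongr; norm_num

/-- The standard mollifiers, normalised to have integral `1`. -/
def rho (n : ℕ) : Plane → ℝ := (bump n).normed volume

theorem rho_contDiff (n : ℕ) : ContDiff ℝ ∞ (rho n) := (bump n).contDiff_normed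

theorem rho_continuous (n : ℕ) : Continuous (rho n) := (rho_contDiff n).continuous

theorem rho_compact (n : ℕ) : HasCompactSupport (rho n) := (bump n).hasCompactSupport_normed

theorem rho_neg (n : ℕ) (x : Plane) : rho n (-x) = rho n x := (bump n).normed_neg x

theorem lintegral_rho (n : ℕ) : ∫⁻ y, ‖rho n y‖ₑ = 1 := by
  have h := ofReal_integral_eq_lintegral_ofReal
    ((rho_continuous n).integrable_of_hasCompactSupport (rho_compact n) (μ := volume))
    (Eventually.of_forall fun x => (bump n).nonneg_normed x)
  have h1 : ∫ y, rho n y = 1 := (bump n).integral_normed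
  rw [h1] at h
  rw [← ENNReal.ofReal_one, h]
  refine lintegral_congr fun y => ?_
  exact Real.enorm_eq_ofReal ((bump n).nonneg_normed y)

/-- Mollification. -/
def mol (n : ℕ) (f : Plane → ℝ) : Plane → ℝ := conv (rho n) f

theorem eLpNorm_mol_le (n : ℕ) {f : Plane → ℝ} {p : ℝ} (hp : 1 ≤ p)
    (hf : AEStronglyMeasurable f volume) :
    eLpNorm (mol n f) (ENNReal.ofReal p) volume ≤ eLpNorm f (ENNReal.ofReal p) volume := by
  simpa [lintegral_rho, mol] using eLpNorm_conv_le (rho_continuous n) (rho_compact n) hp hf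

theorem memLp_mol (n : ℕ) {f : Plane → ℝ} {p : ℝ} (hp : 1 ≤ p)
    (hf : MemLp f (ENNReal.ofReal p) volume) : MemLp (mol n f) (ENNReal.ofReal p) volume :=
  memLp_conv (rho_continuous n) (rho_compact n) hp hf

theorem mol_sub (n : ℕ) {f g : Plane → ℝ} (hf : LocallyIntegrable f)
    (hg : LocallyIntegrable g) : mol n (f - g) = mol n f - mol n g :=
  conv_sub (rho_continuous n) (rho_compact n) hf hg

theorem continuous_mol (n : ℕ) {f : Plane → ℝ} (hf : LocallyIntegrable f) :
    Continuous (mol n f) := continuous_conv (rho_continuous n) (rho_compact n) hf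

theorem contDiff_mol (n : ℕ) {f : Plane → ℝ} (hf : LocallyIntegrable f) :
    ContDiff ℝ ∞ (mol n f) :=
  (rho_compact n).contDiff_convolution_left (n := ⊤) _ (rho_contDiff n) hf

theorem tendsto_bump_rOut : Tendsto (fun n => (bump n).rOut) atTop (𝓝 0) := by
  have h := (tendsto_one_div_add_atTop_nhds_zero_nat (𝕜 := ℝ)).const_mul 2
  simp only [mul_zero] at h
  refine h.congr fun n => ?_
  simp [bump, div_eq_mul_inv]

/-- Lebesgue differentiation applies because the ratio of outer to inner radius of the bumps stays
equal to `2` while they shrink. -/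
theorem mol_tendsto_ae {f : Plane → ℝ} (hf : LocallyIntegrable f) :
    ∀ᵐ x, Tendsto (fun n => mol n f x) atTop (𝓝 (f x)) :=
  ContDiffBump.ae_convolution_tendsto_right_of_locallyIntegrable (K := 2) tendsto_bump_rOut
    (Eventually.of_forall fun n => by simp [bump, div_eq_mul_inv]) hf

/-- Uniform continuity gives convergence in the supremum norm, and all the differences live in one
compact set: no outer radius exceeds `2`, so the `2`-thickening of the support contains them. -/
theorem eLpNorm_mol_sub_tendsto_of_compact {g : Plane → ℝ} (hg : Continuous g)
    (hc : HasCompactSupport g) {p : ℝ} (hp : 1 ≤ p) :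
    Tendsto (fun n => eLpNorm (mol n g - g) (ENNReal.ofReal p) volume) atTop (𝓝 0) := by
  have h0 : (0 : ℝ) < p := by linarith
  set K : Set Plane := Metric.cthickening 2 (tsupport g) with hK
  have hKc : IsCompact K := hc.isCompact.cthickening
  have hKv : volume K ≠ ⊤ := hKc.measure_lt_top.ne
  have huc := hc.uniformContinuous_of_continuous hg
  have hsupp : ∀ n, Function.support (mol n g - g) ⊆ K := by
    intro n x hx
    by_contra hxK
    have hx0 : ∀ y, dist x y ≤ 2 → g y = 0 := by
      intro y hy
      by_contra hy0
      exact hxK (Metric.mem_cthickening_of_dist_le x y 2 _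
        (subset_tsupport _ hy0) hy)
    refine hx ?_
    have h1 : mol n g x = 0 := by
      rw [mol, conv_apply]
      refine integral_eq_zero_of_ae (Eventually.of_forall fun y => ?_)
      by_cases hy : dist x (x - y) ≤ 2
      · simp [hx0 _ hy]
      · have : rho n y = 0 := by
          have : y ∉ Function.support (rho n) := by
            rw [rho, (bump n).support_normed_eq]
            simp only [dist_self_sub_right, not_le] at hy
            simp only [Metric.mem_ball, dist_zero_right, not_lt, bump]
            refine le_trans ?_ hy.le
            rw [div_le_iff₀ (by positivity)]
            nlinarith [(Nat.cast_nonneg n : (0 : ℝ) ≤ n)]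
          simpa using this
        simp [this]
    simp [h1, hx0 x (by simp)]
  have hb : ∀ ε > 0, ∀ᶠ n in atTop, eLpNorm (mol n g - g) (ENNReal.ofReal p) volume
      ≤ volume K ^ (ENNReal.ofReal p).toReal⁻¹ * ENNReal.ofReal ε := by
    intro ε hε
    obtain ⟨δ, hδ, H⟩ := Metric.uniformContinuous_iff.1 huc ε hε
    filter_upwards [tendsto_bump_rOut.eventually (gt_mem_nhds hδ)] with n hn
    have e : eLpNorm (mol n g - g) (ENNReal.ofReal p) volume
        = eLpNorm (mol n g - g) (ENNReal.ofReal p) (volume.restrict K) := by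
      rw [← eLpNorm_indicator_eq_eLpNorm_restrict hKc.measurableSet,
        Set.indicator_eq_self.2 (hsupp n)]
    rw [e]
    refine (eLpNorm_le_of_ae_bound (C := ε) (Eventually.of_forall fun x => ?_)).trans_eq ?_
    · rw [Pi.sub_apply, ← dist_eq_norm]
      refine (bump n).dist_normed_convolution_le hg.aestronglyMeasurable fun y hy => ?_
      exact (H (lt_trans hy hn)).le
    · simp
  set A := volume K ^ (ENNReal.ofReal p).toReal⁻¹ with hA
  have hAt : A ≠ ⊤ := by
    simp only [hA]
    exact ENNReal.rpow_ne_top_of_nonneg (by positivity) hKv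
  rw [ENNReal.tendsto_nhds_zero]
  intro η hη
  rcases eq_or_ne η ⊤ with rfl | hηt
  · simp
  -- The `+ 1` in the denominator covers the case where `A`, a power of the measure of `K`, is zero.
  have hpos : 0 < η.toReal / (A.toReal + 1) :=
    div_pos (ENNReal.toReal_pos hη.ne' hηt) (by positivity)
  filter_upwards [hb _ hpos] with n hn
  refine hn.trans ?_
  rw [← ENNReal.ofReal_toReal hAt, ← ENNReal.ofReal_mul ENNReal.toReal_nonneg]
  refine ENNReal.ofReal_le_of_le_toReal ?_
  rw [ENNReal.toReal_ofReal ENNReal.toReal_nonneg, mul_div_assoc',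
    div_le_iff₀ (by positivity)]
  nlinarith [ENNReal.toReal_nonneg (a := η), ENNReal.toReal_nonneg (a := A)]

/-- Mollifications converge in `L^p` for finite `p`. -/
theorem eLpNorm_mol_sub_tendsto {f : Plane → ℝ} {p : ℝ} (hp : 1 ≤ p)
    (hf : MemLp f (ENNReal.ofReal p) volume) :
    Tendsto (fun n => eLpNorm (mol n f - f) (ENNReal.ofReal p) volume) atTop (𝓝 0) := by
  have h1p : (1 : ℝ≥0∞) ≤ ENNReal.ofReal p := by simpa using hp
  rw [ENNReal.tendsto_nhds_zero]
  intro η hη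
  obtain ⟨g, hgc, hgη, hg, hgm⟩ := hf.exists_hasCompactSupport_eLpNorm_sub_le
    ENNReal.ofReal_ne_top (ε := η / 3) (ENNReal.div_pos hη.ne' (by norm_num)).ne'
  have hlf := hf.locallyIntegrable h1p
  have hlg := hgm.locallyIntegrable h1p
  filter_upwards [(ENNReal.tendsto_nhds_zero.1 (eLpNorm_mol_sub_tendsto_of_compact hg hgc hp))
    (η / 3) (ENNReal.div_pos hη.ne' (by norm_num))] with n hn
  -- Here `g` is continuous with compact support and close to `f`. Mollification contracts `L^p`, so
  -- the first term is no larger than the last, and the middle one tends to zero by uniform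
  -- continuity.
  have e : mol n f - f = mol n (f - g) + (mol n g - g) - (f - g) := by
    rw [mol_sub n hlf hlg]; abel
  rw [e]
  have m1 := memLp_mol n hp (hf.sub hgm)
  have m2 := (memLp_mol n hp hgm).sub hgm
  calc _ ≤ eLpNorm (mol n (f - g) + (mol n g - g)) (ENNReal.ofReal p) volume
          + eLpNorm (f - g) (ENNReal.ofReal p) volume :=
        eLpNorm_sub_le (m1.add m2).1 (hf.sub hgm).1 h1p
    _ ≤ (eLpNorm (mol n (f - g)) (ENNReal.ofReal p) volume
          + eLpNorm (mol n g - g) (ENNReal.ofReal p) volume) + η / 3 := by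
        gcongr
        exact eLpNorm_add_le m1.1 m2.1 h1p
    _ ≤ (η / 3 + η / 3) + η / 3 := by
        gcongr
        exact (eLpNorm_mol_le n hp (hf.sub hgm).1).trans hgη
    _ = η := ENNReal.add_thirds η

/-- The energy of a mollified function is the equation tested with the double mollification, so it
is this sequence whose convergence matters. Contractivity reduces it to the single mollification. -/
theorem eLpNorm_mol_mol_sub_tendsto {f : Plane → ℝ} {p : ℝ} (hp : 1 ≤ p)
    (hf : MemLp f (ENNReal.ofReal p) volume) :
    Tendsto (fun n => eLpNorm (mol n (mol n f) - f) (ENNReal.ofReal p) volume) atTop (𝓝 0) := by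
  have h1p : (1 : ℝ≥0∞) ≤ ENNReal.ofReal p := by simpa using hp
  have h := eLpNorm_mol_sub_tendsto hp hf
  refine tendsto_of_tendsto_of_tendsto_of_le_of_le tendsto_const_nhds
    (by simpa using h.add h) (fun _ => zero_le) fun n => ?_
  have hm := memLp_mol n hp hf
  have e : mol n (mol n f) - f = mol n (mol n f - f) + (mol n f - f) := by
    rw [mol_sub n (hm.locallyIntegrable h1p) (hf.locallyIntegrable h1p)]
    abel
  simp only [e]
  refine (eLpNorm_add_le (memLp_mol n hp (hm.sub hf)).1 (hm.sub hf).1 h1p).trans ?_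
  gcongr
  exact eLpNorm_mol_le n hp (hm.sub hf).1

/-! ### Derivatives of mollifications and weak derivatives -/

theorem continuous_partialDeriv {k : Plane → ℝ} (hk : ContDiff ℝ 1 k) (j : Fin 2) :
    Continuous (partialDeriv j k) :=
  (hk.continuous_fderiv one_ne_zero).clm_apply continuous_const

theorem contDiff_partialDeriv {k : Plane → ℝ} (hk : ContDiff ℝ ∞ k) (j : Fin 2) :
    ContDiff ℝ ∞ (partialDeriv j k) :=
  (hk.fderiv_right (m := ∞) (by simp)).clm_apply contDiff_const

theorem hasCompactSupport_partialDeriv {k : Plane → ℝ} (hc : HasCompactSupport k) (j : Fin 2) :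
    HasCompactSupport (partialDeriv j k) :=
  hc.fderiv_apply (𝕜 := ℝ) _

theorem fderiv_convolution_lsmul_apply {G : Type*} [NormedAddCommGroup G] [NormedSpace ℝ G]
    [MeasurableSpace G] [BorelSpace G] {μ : Measure G} [SFinite μ] [μ.IsAddLeftInvariant]
    [μ.IsNegInvariant] {k f : G → ℝ} (hk : ContDiff ℝ 1 k) (hc : HasCompactSupport k)
    (hf : LocallyIntegrable f μ) (x v : G) :
    fderiv ℝ (convolution k f (ContinuousLinearMap.lsmul ℝ ℝ) μ) x v
      = ∫ y, fderiv ℝ k y v * f (x - y) ∂μ := by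
  have h := (hc.hasFDerivAt_convolution_left (ContinuousLinearMap.lsmul ℝ ℝ) hk hf x).fderiv
  have hi := (hc.fderiv ℝ).convolutionExists_left
      ((ContinuousLinearMap.lsmul ℝ ℝ : ℝ →L[ℝ] ℝ →L[ℝ] ℝ).precompL G)
      (hk.continuous_fderiv one_ne_zero) hf x
  rw [h]
  have h2 := ContinuousLinearMap.integral_apply hi.integrable v
  simp only [ContinuousLinearMap.precompL_apply, ContinuousLinearMap.lsmul_apply, smul_eq_mul] at h2
  exact h2

theorem partialDeriv_conv {k f : Plane → ℝ} (hk : ContDiff ℝ 1 k) (hc : HasCompactSupport k)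
    (hf : LocallyIntegrable f) (j : Fin 2) :
    partialDeriv j (conv k f) = conv (partialDeriv j k) f :=
  funext fun x => fderiv_convolution_lsmul_apply hk hc hf x _

theorem partialDeriv_comp_const_sub {k : Plane → ℝ} (hk : ContDiff ℝ 1 k) (j : Fin 2)
    (x y : Plane) : partialDeriv j (fun z => k (x - z)) y = - partialDeriv j k (x - y) := by
  have h1 : HasFDerivAt k (fderiv ℝ k (x - y)) (x - y) :=
    (hk.differentiable one_ne_zero _).hasFDerivAt
  have h2 : HasFDerivAt (fun z : Plane => x - z) (-ContinuousLinearMap.id ℝ Plane) y :=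
    (hasFDerivAt_id y).const_sub x
  have h3 : HasFDerivAt (fun z => k (x - z)) _ y := HasFDerivAt.comp (f := fun z => x - z) y h1 h2
  rw [partialDeriv, h3.fderiv]
  simp [partialDeriv]

/-- The weak derivative is tested with `z ↦ k (x - z)`; the sign of the chain rule cancels the sign
of the integration by parts. -/
theorem IsWeakPartial.conv_partialDeriv {j : Fin 2} {f g k : Plane → ℝ}
    (h : IsWeakPartial j f g) (hk : ContDiff ℝ ∞ k) (hc : HasCompactSupport k) :
    conv (partialDeriv j k) f = conv k g := by
  funext x
  have hcx : HasCompactSupport (fun z => k (x - z)) :=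
    hc.comp_homeomorph (Homeomorph.subLeft x)
  have h1 := h.2.2 (fun z => k (x - z)) (hk.comp (contDiff_const.sub contDiff_id)) hcx
  rw [conv_apply_swap, conv_apply_swap]
  simp only [partialDeriv_comp_const_sub (hk.of_le (by simp))] at h1
  simp only [mul_neg, integral_neg, neg_inj] at h1
  simpa only [mul_comm] using h1

theorem IsWeakPartial.partialDeriv_mol {j : Fin 2} {f g : Plane → ℝ}
    (h : IsWeakPartial j f g) (n : ℕ) : partialDeriv j (mol n f) = mol n g := by
  rw [mol, partialDeriv_conv ((rho_contDiff n).of_le (by simp)) (rho_compact n) h.1,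
    h.conv_partialDeriv (rho_contDiff n) (rho_compact n), mol]

theorem partialDeriv_mul {f g : Plane → ℝ} {x : Plane} (hf : DifferentiableAt ℝ f x)
    (hg : DifferentiableAt ℝ g x) (j : Fin 2) :
    partialDeriv j (fun y => f y * g y) x
      = f x * partialDeriv j g x + g x * partialDeriv j f x := by
  simp [partialDeriv, fderiv_fun_mul hf hg]

/-- Integration by parts against the constant function `1`. -/
theorem integral_partialDeriv_eq_zero {f : Plane → ℝ} (hf : ContDiff ℝ 1 f)
    (hc : HasCompactSupport f) (j : Fin 2) : ∫ x, partialDeriv j f x = 0 := by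
  have h := integral_mul_fderiv_eq_neg_fderiv_mul_of_integrable (𝕜 := ℝ)
    (μ := (volume : Measure Plane))
    (f := fun _ => (1 : ℝ)) (g := f) (v := EuclideanSpace.single j 1) (by simp)
    (by
      simp only [one_mul]
      exact (continuous_partialDeriv hf j).integrable_of_hasCompactSupport
        (hasCompactSupport_partialDeriv hc j))
    (by simpa using hf.continuous.integrable_of_hasCompactSupport hc)
    (fun _ _ => differentiableAt_const _) (fun _ _ => hf.differentiable one_ne_zero _)
  simpa [partialDeriv] using h

theorem isWeakPartial_of_contDiff {f : Plane → ℝ} (hf : ContDiff ℝ 1 f) (j : Fin 2) :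
    IsWeakPartial j f (partialDeriv j f) := by
  refine ⟨hf.continuous.locallyIntegrable, (continuous_partialDeriv hf j).locallyIntegrable,
    fun χ hχ hc => ?_⟩
  have h1 : ContDiff ℝ 1 χ := hχ.of_le (by simp)
  have h := integral_partialDeriv_eq_zero (hf.mul h1) hc.mul_left j
  simp only [partialDeriv_mul (hf.differentiable one_ne_zero _)
    (h1.differentiable one_ne_zero _)] at h
  rw [integral_add] at h
  · have : ∫ x, partialDeriv j f x * χ x = ∫ x, χ x * partialDeriv j f x := by
      simp only [mul_comm]
    linarith
  · exact (hf.continuous.mul (continuous_partialDeriv h1 j)).integrable_of_hasCompactSupport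
      (hasCompactSupport_partialDeriv hc j).mul_left
  · exact (h1.continuous.mul (continuous_partialDeriv hf j)).integrable_of_hasCompactSupport
      hc.mul_right

theorem isWeakPartial_mol {j : Fin 2} {f g : Plane → ℝ}
    (h : IsWeakPartial j f g) (n : ℕ) : IsWeakPartial j (mol n f) (mol n g) := by
  rw [← h.partialDeriv_mol n]
  exact isWeakPartial_of_contDiff ((contDiff_mol n h.1).of_le (by simp)) j

theorem ofReal_two : ENNReal.ofReal 2 = 2 := by simp

theorem locallyIntegrable_of_memLp_two {f : Plane → ℝ} (hf : MemLp f 2 volume) :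
    LocallyIntegrable f := hf.locallyIntegrable (by norm_num)

theorem memLp_conv_two {k f : Plane → ℝ} (hk : Continuous k) (hc : HasCompactSupport k)
    (hf : MemLp f 2 volume) : MemLp (conv k f) 2 volume := by
  simpa using memLp_conv hk hc (p := 2) (by norm_num) (by simpa using hf)

/-- Fubini, with evenness of the kernel exchanging the roles of the two variables. -/
theorem integral_conv_mul {k f g : Plane → ℝ} (hk : Continuous k) (hc : HasCompactSupport k)
    (hke : ∀ x, k (-x) = k x) (hf : MemLp f 2 volume) (hg : MemLp g 2 volume) :
    ∫ x, conv k f x * g x = ∫ x, f x * conv k g x := by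
  have hf' : AEStronglyMeasurable (fun z : Plane × Plane => f z.2) (volume.prod volume) :=
    hf.1.comp_quasiMeasurePreserving Measure.quasiMeasurePreserving_snd
  have hg' : AEStronglyMeasurable (fun z : Plane × Plane => g z.1) (volume.prod volume) :=
    hg.1.comp_quasiMeasurePreserving Measure.quasiMeasurePreserving_fst
  have hk' : AEStronglyMeasurable (fun z : Plane × Plane => k (z.1 - z.2))
      (volume.prod volume) := (hk.comp (continuous_fst.sub continuous_snd)).aestronglyMeasurable
  have hint : Integrable (fun z : Plane × Plane => k (z.1 - z.2) * f z.2 * g z.1)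
      (volume.prod volume) := by
    have hm := (hk'.mul hf').mul hg'
    refine ⟨hm, ?_⟩
    have hp := lintegral_prod _ hm.enorm
    simp only [Pi.mul_apply] at hp
    rw [HasFiniteIntegral, hp]
    -- The inner integral of the absolute value is the convolution of `|k|` with `|f|`, again square
    -- integrable, so its product with `g` is integrable and Fubini is justified.
    have e : ∀ x, ∫⁻ y, ‖k (x - y) * f y * g x‖ₑ
        = ‖conv (fun y => |k y|) (fun y => |f y|) x‖ₑ * ‖g x‖ₑ := by
      intro x
      have hi := convolutionExists hk.abs (hc.comp_left (g := fun t : ℝ => |t|) abs_zero)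
        (locallyIntegrable_of_memLp_two hf.abs) x
      have hi2 : Integrable fun y => |k (x - y)| * |f y| := by
        have := hi.comp_sub_left x
        simpa using this
      simp only [enorm_mul]
      rw [lintegral_mul_const' _ _ enorm_ne_top, conv_apply_swap]
      congr 1
      rw [Real.enorm_eq_ofReal (integral_nonneg fun y => by positivity),
        ofReal_integral_eq_lintegral_ofReal hi2 (Eventually.of_forall fun y => by positivity)]
      refine lintegral_congr fun y => ?_
      rw [← abs_mul, ← Real.enorm_eq_ofReal_abs, enorm_mul]
    simp only [e]
    have m := (memLp_conv_two hk.abs (hc.comp_left (g := fun t : ℝ => |t|) abs_zero) hf.abs)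
    have := (m.integrable_mul hg).2
    simp only [HasFiniteIntegral, Pi.mul_apply, enorm_mul] at this
    exact this
  have h1 : ∫ x, conv k f x * g x = ∫ x, ∫ y, k (x - y) * f y * g x := by
    simp only [conv_apply_swap, integral_mul_const]
  rw [h1, integral_integral_swap hint]
  refine integral_congr_ae (Eventually.of_forall fun y => ?_)
  simp only [conv_apply_swap, ← integral_const_mul]
  refine integral_congr_ae (Eventually.of_forall fun x => ?_)
  simp only
  rw [← hke (x - y), neg_sub]; ring

/-! ### Mollification and multiplication as operators on `L²` -/

/-- The Hilbert space `L²(ℝ²)`. -/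
abbrev ScalL2 := Lp ℝ 2 (volume : Measure Plane)

theorem inner_scalL2 (f g : ScalL2) : inner ℝ f g = ∫ x, f x * g x := by
  rw [L2.inner_def]
  simp [mul_comm]

/-- Convolution with a continuous compactly supported kernel, on `L²`. -/
def convL2 (k : Plane → ℝ) (hk : Continuous k) (hc : HasCompactSupport k) :
    ScalL2 →L[ℝ] ScalL2 :=
  LinearMap.mkContinuous
    { toFun := fun f => (memLp_conv_two hk hc (Lp.memLp f)).toLp (conv k f)
      map_add' := fun f g => by
        rw [← MemLp.toLp_add]
        refine MemLp.toLp_congr _ _ (ae_of_all _ fun x => ?_)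
        rw [conv_congr (Lp.coeFn_add f g), conv_add hk hc
          (locallyIntegrable_of_memLp_two (Lp.memLp f))
          (locallyIntegrable_of_memLp_two (Lp.memLp g))]
      map_smul' := fun c f => by
        rw [RingHom.id_apply, ← MemLp.toLp_const_smul]
        refine MemLp.toLp_congr _ _ (ae_of_all _ fun x => ?_)
        rw [conv_congr (Lp.coeFn_smul c f), conv_const_smul] }
    (∫⁻ y, ‖k y‖ₑ).toReal fun f => by
      simp only [LinearMap.coe_mk, AddHom.coe_mk]
      rw [Lp.norm_toLp, Lp.norm_def, ← ENNReal.toReal_mul]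
      have hK : (∫⁻ y, ‖k y‖ₑ) ≠ ⊤ := (hk.integrable_of_hasCompactSupport hc).2.ne
      refine ENNReal.toReal_mono (ENNReal.mul_ne_top hK (Lp.eLpNorm_ne_top f)) ?_
      have := eLpNorm_conv_le hk hc (p := 2) (by norm_num) (Lp.aestronglyMeasurable f)
      simpa using this

theorem convL2_coe {k : Plane → ℝ} (hk : Continuous k) (hc : HasCompactSupport k) (f : ScalL2) :
    convL2 k hk hc f =ᵐ[volume] conv k f :=
  MemLp.coeFn_toLp (memLp_conv_two hk hc (Lp.memLp f))

/-- Mollification on `L²`. -/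
def molL2 (n : ℕ) : ScalL2 →L[ℝ] ScalL2 := convL2 (rho n) (rho_continuous n) (rho_compact n)

theorem molL2_coe (n : ℕ) (f : ScalL2) : molL2 n f =ᵐ[volume] mol n f :=
  convL2_coe (rho_continuous n) (rho_compact n) f

theorem inner_molL2 (n : ℕ) (f g : ScalL2) : inner ℝ (molL2 n f) g = inner ℝ f (molL2 n g) := by
  rw [inner_scalL2, inner_scalL2]
  have h := integral_conv_mul (rho_continuous n) (rho_compact n) (rho_neg n) (Lp.memLp f)
    (Lp.memLp g)
  have e1 : ∫ x, molL2 n f x * g x = ∫ x, conv (rho n) f x * g x := by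
    refine integral_congr_ae ?_
    filter_upwards [molL2_coe n f] with x hx
    rw [hx, mol]
  have e2 : ∫ x, f x * molL2 n g x = ∫ x, f x * conv (rho n) g x := by
    refine integral_congr_ae ?_
    filter_upwards [molL2_coe n g] with x hx
    rw [hx, mol]
  rw [e1, e2, h]

theorem molL2_tendsto (f : ScalL2) : Tendsto (fun n => molL2 n f) atTop (𝓝 f) := by
  rw [Lp.tendsto_Lp_iff_tendsto_eLpNorm']
  have h := eLpNorm_mol_sub_tendsto (p := 2) (by norm_num) (f := f)
    (by simpa using Lp.memLp f)
  rw [ofReal_two] at h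
  refine h.congr fun n => eLpNorm_congr_ae ?_
  filter_upwards [molL2_coe n f] with x hx
  simp [hx]

/-- Multiplication by a bounded continuous function, on `L²`. -/
theorem exists_mulL2 {φ : Plane → ℝ} (hφ : Continuous φ) {C : ℝ} (hC : ∀ x, ‖φ x‖ ≤ C) :
    ∃ M : ScalL2 →L[ℝ] ScalL2, ∀ f : ScalL2, M f =ᵐ[volume] fun x => φ x * f x := by
  have hm : ∀ f : ScalL2, MemLp (fun x => φ x * f x) 2 volume := fun f =>
    (Lp.memLp f).of_le_mul (c := C) (hφ.aestronglyMeasurable.mul (Lp.aestronglyMeasurable f))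
      (Eventually.of_forall fun x => by
        rw [norm_mul]; exact mul_le_mul_of_nonneg_right (hC x) (norm_nonneg _))
  refine ⟨LinearMap.mkContinuous
    { toFun := fun f => (hm f).toLp _
      map_add' := fun f g => by
        rw [← MemLp.toLp_add]
        refine MemLp.toLp_congr _ _ ?_
        filter_upwards [Lp.coeFn_add f g] with x hx
        rw [hx]; simp [mul_add]
      map_smul' := fun c f => by
        rw [RingHom.id_apply, ← MemLp.toLp_const_smul]
        refine MemLp.toLp_congr _ _ ?_
        filter_upwards [Lp.coeFn_smul c f] with x hx
        simp [hx, mul_left_comm] } C fun f => ?_, fun f => (hm f).coeFn_toLp⟩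
  refine Lp.norm_le_mul_norm_of_ae_le_mul ?_
  filter_upwards [(hm f).coeFn_toLp] with x hx
  simp only [LinearMap.coe_mk, AddHom.coe_mk]
  rw [hx, norm_mul]
  exact mul_le_mul_of_nonneg_right (hC x) (norm_nonneg _)

/-! ### Interpolation and Sobolev embeddings in the plane -/

theorem lintegral_rpow_enorm_eq {f : Plane → ℝ} {q : ℝ} (hq : 0 < q) :
    ∫⁻ x, ‖f x‖ₑ ^ q = eLpNorm f (ENNReal.ofReal q) volume ^ q := by
  rw [eLpNorm_eq_lintegral_rpow_enorm_toReal (by simpa using hq) ENNReal.ofReal_ne_top,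
    ENNReal.toReal_ofReal hq.le, ← ENNReal.rpow_mul, one_div_mul_cancel hq.ne', ENNReal.rpow_one]

/-- Interpolation between `L²` and `L^r`. -/
theorem eLpNorm_interpolation {f : Plane → ℝ} (hf : AEStronglyMeasurable f volume) {q r : ℝ}
    (h2q : 2 ≤ q) (hqr : q ≤ r) :
    eLpNorm f (ENNReal.ofReal q) volume
      ≤ 2 * (eLpNorm f 2 volume + eLpNorm f (ENNReal.ofReal r) volume) := by
  have hq0 : 0 < q := by linarith
  set a := eLpNorm f 2 volume with ha
  set b := eLpNorm f (ENNReal.ofReal r) volume with hb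
  set N := a + b with hN
  rcases eq_or_ne N ⊤ with hNt | hNt
  · simp [hNt]
  rcases eq_or_ne N 0 with hN0 | hN0
  · have : a = 0 := by simpa using (add_eq_zero.1 hN0).1
    have h0 : f =ᵐ[volume] 0 := (eLpNorm_eq_zero_iff hf (by norm_num)).1 this
    simp [eLpNorm_congr_ae h0]
  -- The values of `f` are split at the height `N`, the sum of the two norms. Below it `|f|^(q-2) ≤
  -- N^(q-2)`; above it `|f|^(q-r) ≤ N^(q-r)`, as the exponent is not positive. Each half then
  -- integrates to at most `N^q`.
  have hpt : ∀ x, ‖f x‖ₑ ^ q ≤ N ^ (q - 2) * ‖f x‖ₑ ^ (2 : ℝ) + N ^ (q - r) * ‖f x‖ₑ ^ r := by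
    intro x
    rcases le_total ‖f x‖ₑ N with h | h
    · refine le_trans ?_ le_self_add
      calc ‖f x‖ₑ ^ q = ‖f x‖ₑ ^ (q - 2) * ‖f x‖ₑ ^ (2 : ℝ) := by
            rw [← ENNReal.rpow_add_of_nonneg _ _ (by linarith) (by norm_num)]; congr 1; ring
        _ ≤ _ := by gcongr
    · refine le_trans ?_ le_add_self
      have hx0 : ‖f x‖ₑ ≠ 0 := fun h0 => hN0 (by simpa [h0] using h)
      calc ‖f x‖ₑ ^ q = ‖f x‖ₑ ^ (q - r) * ‖f x‖ₑ ^ r := by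
            rw [← ENNReal.rpow_add _ _ hx0 enorm_ne_top]; congr 1; ring
        _ ≤ _ := by
            refine mul_le_mul_left ?_ _
            rw [← neg_sub r q, ENNReal.rpow_neg, ENNReal.rpow_neg, ENNReal.inv_le_inv]
            exact ENNReal.rpow_le_rpow h (by linarith)
  have hint : eLpNorm f (ENNReal.ofReal q) volume ^ q ≤ 2 * N ^ q := by
    rw [← lintegral_rpow_enorm_eq hq0]
    calc _ ≤ ∫⁻ x, (N ^ (q - 2) * ‖f x‖ₑ ^ (2 : ℝ) + N ^ (q - r) * ‖f x‖ₑ ^ r) :=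
          lintegral_mono hpt
      _ = N ^ (q - 2) * a ^ (2 : ℝ) + N ^ (q - r) * b ^ r := by
          rw [lintegral_add_left' ((hf.enorm.pow_const _).const_mul _),
            lintegral_const_mul'' _ (hf.enorm.pow_const _),
            lintegral_const_mul'' _ (hf.enorm.pow_const _),
            lintegral_rpow_enorm_eq (by norm_num), lintegral_rpow_enorm_eq (by linarith),
            ofReal_two]
      _ ≤ N ^ (q - 2) * N ^ (2 : ℝ) + N ^ (q - r) * N ^ r := by
          gcongr
          · exact le_self_add
          · linarith
          · exact le_add_self
      _ = 2 * N ^ q := by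
          rw [← ENNReal.rpow_add _ _ hN0 hNt, ← ENNReal.rpow_add _ _ hN0 hNt, two_mul]
          congr 2 <;> ring
  have := ENNReal.rpow_le_rpow hint (z := 1 / q) (by positivity)
  rw [← ENNReal.rpow_mul, mul_one_div_cancel hq0.ne', ENNReal.rpow_one,
    ENNReal.mul_rpow_of_nonneg _ _ (by positivity), ← ENNReal.rpow_mul,
    mul_one_div_cancel hq0.ne', ENNReal.rpow_one] at this
  refine this.trans ?_
  gcongr
  conv_rhs => rw [← ENNReal.rpow_one 2]
  refine ENNReal.rpow_le_rpow_of_exponent_le (by norm_num) ?_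
  rw [div_le_one hq0]; linarith

/-- Only finiteness is wanted. It holds for mollified functions, which are bounded, and makes it
legitimate to cancel an `L^r` norm that appears on both sides of an inequality. -/
theorem eLpNorm_lt_top_of_bounded {f : Plane → ℝ} (hf : MemLp f 2 volume) {M : ℝ}
    (hM : ∀ x, |f x| ≤ M) {r : ℝ} (hr : 2 ≤ r) :
    eLpNorm f (ENNReal.ofReal r) volume < ⊤ := by
  have hr0 : 0 < r := by linarith
  have h1 : ∫⁻ x, ‖f x‖ₑ ^ r ≤ ENNReal.ofReal M ^ (r - 2) * eLpNorm f 2 volume ^ (2 : ℝ) := by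
    have h2 := lintegral_rpow_enorm_eq (f := f) (q := 2) (by norm_num)
    rw [ofReal_two] at h2
    rw [← h2, ← lintegral_const_mul'' _ (hf.1.enorm.pow_const _)]
    refine lintegral_mono fun x => ?_
    calc ‖f x‖ₑ ^ r = ‖f x‖ₑ ^ (r - 2) * ‖f x‖ₑ ^ (2 : ℝ) := by
          rw [← ENNReal.rpow_add_of_nonneg _ _ (by linarith) (by norm_num)]; congr 1; ring
      _ ≤ _ := by
          gcongr
          rw [Real.enorm_eq_ofReal_abs]; exact ENNReal.ofReal_le_ofReal (hM x)
  rw [eLpNorm_eq_lintegral_rpow_enorm_toReal (by simpa using hr0) ENNReal.ofReal_ne_top,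
    ENNReal.toReal_ofReal hr0.le]
  refine ENNReal.rpow_lt_top_of_nonneg (by positivity) (h1.trans_lt ?_).ne
  exact ENNReal.mul_lt_top (ENNReal.rpow_lt_top_of_nonneg (by linarith) ENNReal.ofReal_ne_top)
    (ENNReal.rpow_lt_top_of_nonneg (by norm_num) hf.2.ne)

/-- A smooth cutoff: `1` on the unit ball, `0` outside the ball of radius `2`. -/
def cutBump : ContDiffBump (0 : Plane) where
  rIn := 1
  rOut := 2
  rIn_pos := one_pos
  rIn_lt_rOut := one_lt_two

/-- Smooth compactly supported cutoffs converging to `1`. -/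
def cut (n : ℕ) (x : Plane) : ℝ := cutBump (((n : ℝ) + 1)⁻¹ • x)

theorem cut_contDiff (n : ℕ) : ContDiff ℝ ∞ (cut n) :=
  cutBump.contDiff.comp (contDiff_const_smul _)

theorem cut_compact (n : ℕ) : HasCompactSupport (cut n) :=
  cutBump.hasCompactSupport.comp_homeomorph
    (Homeomorph.smulOfNeZero (((n : ℝ) + 1)⁻¹) (by positivity))

theorem cut_nonneg (n : ℕ) (x : Plane) : 0 ≤ cut n x := cutBump.nonneg

theorem cut_le_one (n : ℕ) (x : Plane) : cut n x ≤ 1 := cutBump.le_one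

theorem cut_tendsto (x : Plane) : Tendsto (fun n => cut n x) atTop (𝓝 1) := by
  refine tendsto_const_nhds.congr' ?_
  filter_upwards [eventually_ge_atTop ⌈‖x‖⌉₊] with n hn
  refine (cutBump.one_of_mem_closedBall ?_).symm
  simp only [mem_closedBall_iff_norm, sub_zero, norm_smul, cutBump]
  rw [norm_inv, Real.norm_of_nonneg (by positivity), inv_mul_le_iff₀ (by positivity)]
  have := (Nat.le_ceil ‖x‖).trans (Nat.cast_le.2 hn)
  linarith

/-- The cutoffs are dilations of one compactly supported profile, so their derivatives scale by the
inverse dilation factor. -/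
theorem exists_cut_fderiv_bound :
    ∃ D : ℝ, 0 ≤ D ∧ ∀ n x, ‖fderiv ℝ (cut n) x‖ ≤ D * ((n : ℝ) + 1)⁻¹ := by
  have hcd : ContDiff ℝ 1 (cutBump : Plane → ℝ) := cutBump.contDiff
  obtain ⟨D, hD⟩ := (hcd.continuous_fderiv one_ne_zero).bounded_above_of_compact_support
    (cutBump.hasCompactSupport.fderiv ℝ)
  refine ⟨D, (norm_nonneg _).trans (hD 0), fun n x => ?_⟩
  have h : HasFDerivAt (cut n) _ x := HasFDerivAt.comp (f := fun x : Plane => ((n : ℝ) + 1)⁻¹ • x)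
    x (hcd.differentiable one_ne_zero _).hasFDerivAt
      ((hasFDerivAt_id x).const_smul (((n : ℝ) + 1)⁻¹))
  rw [h.fderiv]
  refine (ContinuousLinearMap.opNorm_comp_le _ _).trans ?_
  gcongr
  · exact (norm_nonneg _).trans (hD 0)
  · exact hD _
  · rw [norm_smul, norm_inv, Real.norm_of_nonneg (by positivity)]
    exact mul_le_of_le_one_right (by positivity) ContinuousLinearMap.norm_id_le

theorem tendsto_const_mul_inv (D : ℝ) :
    Tendsto (fun n : ℕ => D * ((n : ℝ) + 1)⁻¹) atTop (𝓝 0) := by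
  simpa using (tendsto_one_div_add_atTop_nhds_zero_nat (𝕜 := ℝ)).const_mul D

theorem norm_fderiv_le_sum (f : Plane → ℝ) (x : Plane) :
    ‖fderiv ℝ f x‖ ≤ ∑ j, |partialDeriv j f x| := by
  refine ContinuousLinearMap.opNorm_le_bound _ (Finset.sum_nonneg fun _ _ => abs_nonneg _)
    fun v => ?_
  have hv : v = ∑ j, v j • EuclideanSpace.single j (1 : ℝ) := by
    ext i; fin_cases i <;> simp
  conv_lhs => rw [hv]
  rw [map_sum, Finset.sum_mul]
  refine (norm_sum_le _ _).trans (Finset.sum_le_sum fun j _ => ?_)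
  rw [map_smul, norm_smul, mul_comm]
  exact mul_le_mul_of_nonneg_left (PiLp.norm_apply_le v j) (abs_nonneg _)

/-- The Sobolev inequality `‖g‖_2 ≤ C ‖∇g‖_1` for integrable `g` without compact support. -/
theorem eLpNorm_two_le_fderiv {g : Plane → ℝ} (hg : ContDiff ℝ 1 g) (hi : Integrable g) :
    eLpNorm g 2 volume
      ≤ eLpNormLESNormFDerivOneConst (volume : Measure Plane) 2
        * eLpNorm (fderiv ℝ g) 1 volume := by
  obtain ⟨D, hD0, hD⟩ := exists_cut_fderiv_bound
  set C := eLpNormLESNormFDerivOneConst (volume : Measure Plane) 2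
  -- The inequality for compact support is applied to `cut n * g`. The derivative that falls on the
  -- cutoff costs at most `D / (n + 1)` times `‖g‖_1`, which vanishes in the limit, and Fatou
  -- carries the bound over to `g`.
  have hn : ∀ n, eLpNorm (fun x => cut n x * g x) 2 volume
      ≤ C * (eLpNorm (fderiv ℝ g) 1 volume
        + ENNReal.ofReal (D * ((n : ℝ) + 1)⁻¹) * eLpNorm g 1 volume) := by
    intro n
    have hc1 : ContDiff ℝ 1 (cut n) := (cut_contDiff n).of_le (by simp)
    have h1 := eLpNorm_le_eLpNorm_fderiv_one (volume : Measure Plane) (p := 2)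
      (hc1.mul hg) (cut_compact n).mul_right (by
        rw [finrank_euclideanSpace_fin]; exact_mod_cast NNReal.HolderConjugate.two_two)
    simp only [NNReal.coe_ofNat, ENNReal.coe_ofNat] at h1
    refine h1.trans (mul_le_mul_right ?_ _)
    have hfd : ∀ x, fderiv ℝ (fun x => cut n x * g x) x
        = cut n x • fderiv ℝ g x + g x • fderiv ℝ (cut n) x := fun x =>
      fderiv_fun_mul (hc1.differentiable one_ne_zero x) (hg.differentiable one_ne_zero x)
    have hm1 : AEStronglyMeasurable (fderiv ℝ g) volume :=
      (hg.continuous_fderiv one_ne_zero).aestronglyMeasurable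
    calc eLpNorm (fderiv ℝ (fun x => cut n x * g x)) 1 volume
        ≤ ∫⁻ x, (‖fderiv ℝ g x‖ₑ + ENNReal.ofReal (D * ((n : ℝ) + 1)⁻¹) * ‖g x‖ₑ) := by
          rw [eLpNorm_one_eq_lintegral_enorm]
          refine lintegral_mono fun x => ?_
          rw [hfd]
          refine (enorm_add_le (cut n x • fderiv ℝ g x) (g x • fderiv ℝ (cut n) x)).trans ?_
          rw [enorm_smul, enorm_smul, mul_comm ‖g x‖ₑ]
          gcongr
          · refine mul_le_of_le_one_left (zero_le) ?_
            rw [Real.enorm_eq_ofReal (cut_nonneg n x)]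
            simpa using cut_le_one n x
          · rw [← ofReal_norm]
            exact ENNReal.ofReal_le_ofReal (hD n x)
      _ = eLpNorm (fderiv ℝ g) 1 volume
            + ENNReal.ofReal (D * ((n : ℝ) + 1)⁻¹) * eLpNorm g 1 volume := by
          rw [lintegral_add_left' hm1.enorm, lintegral_const_mul'' _ hi.1.enorm,
            eLpNorm_one_eq_lintegral_enorm, eLpNorm_one_eq_lintegral_enorm]
  have hfat := Lp.eLpNorm_lim_le_liminf_eLpNorm (μ := (volume : Measure Plane)) (p := 2)
    (f := fun n x => cut n x * g x)
    (fun n => ((cut_contDiff n).continuous.mul hg.continuous).aestronglyMeasurable) g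
    (Eventually.of_forall fun x => by simpa using (cut_tendsto x).mul_const (g x))
  refine hfat.trans ((liminf_le_liminf (Eventually.of_forall hn)).trans_eq ?_)
  refine Tendsto.liminf_eq ?_
  have ht : Tendsto (fun n : ℕ => ENNReal.ofReal (D * ((n : ℝ) + 1)⁻¹) * eLpNorm g 1 volume) atTop
      (𝓝 0) := by
    have := (ENNReal.tendsto_ofReal (tendsto_const_mul_inv D))
    rw [ENNReal.ofReal_zero] at this
    have h2 := ENNReal.Tendsto.mul_const (b := eLpNorm g 1 volume) this
      (Or.inr (memLp_one_iff_integrable.2 hi).2.ne)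
    simpa using h2
  have := ENNReal.Tendsto.const_mul (a := (C : ℝ≥0∞)) (ht.const_add (eLpNorm (fderiv ℝ g) 1 volume))
    (Or.inr ENNReal.coe_ne_top)
  simpa using this

/-- `‖f‖_{2k}^k ≤ C k ‖f‖_{(k-1)p'}^{k-1} ‖∇f‖_p` for bounded smooth square integrable `f`. -/
theorem eLpNorm_rpow_le_of_contDiff {f : Plane → ℝ} (hf : ContDiff ℝ 1 f)
    (hf2 : MemLp f 2 volume) {M : ℝ} (hM : ∀ x, |f x| ≤ M) {k p p' : ℝ} (hk : 2 ≤ k)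
    (hpp : p'.HolderConjugate p) :
    eLpNorm f (ENNReal.ofReal (2 * k)) volume ^ k
      ≤ eLpNormLESNormFDerivOneConst (volume : Measure Plane) 2 * (ENNReal.ofReal k
        * (eLpNorm f (ENNReal.ofReal ((k - 1) * p')) volume ^ (k - 1)
          * ∑ j, eLpNorm (partialDeriv j f) (ENNReal.ofReal p) volume)) := by
  have hk0 : 0 < k := by linarith
  have hk1 : 1 < k := by linarith
  -- The `L¹` Sobolev inequality is applied to `|f|^k`, which is `C¹` because `k > 1`. Its gradient
  -- is at most `k |f|^(k-1) |∇f|`, which Hölder splits with the exponents `p'` and `p`.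
  have hg : ContDiff ℝ 1 (fun x => ‖f x‖ ^ k) := hf.norm_rpow hk1
  have hgi : Integrable (fun x => ‖f x‖ ^ k) := by
    have := (eLpNorm_lt_top_of_bounded hf2 hM hk)
    have h := MemLp.integrable_norm_rpow (p := ENNReal.ofReal k) ⟨hf2.1, this⟩
      (by simpa using hk0) ENNReal.ofReal_ne_top
    simpa [ENNReal.toReal_ofReal hk0.le] using h
  have h1 := eLpNorm_two_le_fderiv hg hgi
  have e1 : eLpNorm (fun x => ‖f x‖ ^ k) 2 volume
      = eLpNorm f (ENNReal.ofReal (2 * k)) volume ^ k := by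
    rw [eLpNorm_norm_rpow f hk0, ENNReal.ofReal_mul (by norm_num), ofReal_two]
  rw [e1] at h1
  refine h1.trans ?_
  gcongr
  rw [eLpNorm_one_eq_lintegral_enorm]
  have hmj : ∀ j, Measurable fun x => ‖partialDeriv j f x‖ₑ := fun j =>
    (continuous_partialDeriv hf j).measurable.enorm
  have hmk : Measurable fun x => ‖f x‖ₑ ^ (k - 1) := hf.continuous.measurable.enorm.pow_const _
  calc ∫⁻ x, ‖fderiv ℝ (fun x => ‖f x‖ ^ k) x‖ₑ
      ≤ ∫⁻ x, ENNReal.ofReal k * ∑ j, ‖f x‖ₑ ^ (k - 1) * ‖partialDeriv j f x‖ₑ := by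
        refine lintegral_mono fun x => ?_
        have h2 := norm_fderiv_norm_rpow_le (hf.differentiable one_ne_zero) (x := x) hk1
        have h3 : ‖fderiv ℝ (fun x => ‖f x‖ ^ k) x‖
            ≤ k * ∑ j, ‖f x‖ ^ (k - 1) * |partialDeriv j f x| := by
          refine h2.trans ?_
          rw [← Finset.mul_sum, ← mul_assoc]
          exact mul_le_mul_of_nonneg_left (norm_fderiv_le_sum f x) (by positivity)
        rw [← ofReal_norm]
        refine (ENNReal.ofReal_le_ofReal h3).trans_eq ?_
        rw [ENNReal.ofReal_mul hk0.le, ENNReal.ofReal_sum_of_nonneg (fun _ _ => by positivity)]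
        congr 1
        refine Finset.sum_congr rfl fun j _ => ?_
        rw [ENNReal.ofReal_mul (by positivity), ← Real.enorm_eq_ofReal_abs,
          ← ENNReal.ofReal_rpow_of_nonneg (norm_nonneg _) (by linarith), ofReal_norm]
    _ = ENNReal.ofReal k * ∑ j, ∫⁻ x, ‖f x‖ₑ ^ (k - 1) * ‖partialDeriv j f x‖ₑ := by
        rw [lintegral_const_mul, lintegral_finsetSum]
        · exact fun j _ => hmk.mul (hmj j)
        · exact Finset.measurable_sum _ fun j _ => hmk.mul (hmj j)
    _ ≤ _ := by
        refine mul_le_mul_right ?_ _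
        rw [Finset.mul_sum]
        refine Finset.sum_le_sum fun j _ => ?_
        have h4 := ENNReal.lintegral_mul_le_Lp_mul_Lq volume hpp
          (f := fun x => ‖f x‖ₑ ^ (k - 1)) (g := fun x => ‖partialDeriv j f x‖ₑ)
          hmk.aemeasurable (hmj j).aemeasurable
        simp only [Pi.mul_apply] at h4
        refine h4.trans_eq ?_
        have hp0 : 0 < p := hpp.symm.pos
        have hp'0 : 0 < p' := hpp.pos
        have hkp : 0 < (k - 1) * p' := by have : 0 < k - 1 := by linarith
                                          positivity
        congr 1
        · simp only [← ENNReal.rpow_mul]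
          rw [lintegral_rpow_enorm_eq hkp, ← ENNReal.rpow_mul]
          congr 1
          field_simp
        · rw [lintegral_rpow_enorm_eq hp0, ← ENNReal.rpow_mul, mul_one_div_cancel hp0.ne',
            ENNReal.rpow_one]

/-- A crude additive form of Cauchy–Schwarz; all that counts is a bound uniform in `x`. -/
theorem conv_bounded {k f : Plane → ℝ} (hk : Continuous k) (hc : HasCompactSupport k)
    (hf : MemLp f 2 volume) (x : Plane) :
    |conv k f x| ≤ (∫ y, k y ^ 2) + ∫ y, f y ^ 2 := by
  have hk2 : Integrable fun y => k y ^ 2 := by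
    simp only [sq]
    exact (hk.mul hk).integrable_of_hasCompactSupport hc.mul_left
  have hf2 : Integrable fun y => f (x - y) ^ 2 := hf.integrable_sq.comp_sub_left x
  have e : ∫ y, f y ^ 2 = ∫ y, f (x - y) ^ 2 :=
    (integral_sub_left_eq_self (fun y => f y ^ 2) volume x).symm
  rw [e, ← integral_add hk2 hf2, conv_apply, ← Real.norm_eq_abs]
  refine norm_integral_le_of_norm_le (hk2.add hf2) (Eventually.of_forall fun y => ?_)
  rw [Real.norm_eq_abs, abs_le]
  constructor <;> nlinarith [sq_nonneg (k y + f (x - y)), sq_nonneg (k y - f (x - y))]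

theorem memLp_mol_two (n : ℕ) {f : Plane → ℝ} (hf : MemLp f 2 volume) :
    MemLp (mol n f) 2 volume := memLp_conv_two (rho_continuous n) (rho_compact n) hf

theorem eLpNorm_mol_le_two (n : ℕ) {f : Plane → ℝ} (hf : MemLp f 2 volume) :
    eLpNorm (mol n f) 2 volume ≤ eLpNorm f 2 volume := by
  simpa using eLpNorm_mol_le n (p := 2) (by norm_num) hf.1

/-- The gradient of the mollification is the mollification of the weak gradient, hence controlled by
it. The power on the right keeps `mol n f`, since the corresponding norm of `f` is not yet known to
be finite. -/
theorem eLpNorm_mol_rpow_le {f : Plane → ℝ} {g : Fin 2 → Plane → ℝ} (hf2 : MemLp f 2 volume)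
    (hg : ∀ j, IsWeakPartial j f (g j)) (n : ℕ) {k p p' : ℝ} (hk : 2 ≤ k)
    (hpp : p'.HolderConjugate p) :
    eLpNorm (mol n f) (ENNReal.ofReal (2 * k)) volume ^ k
      ≤ eLpNormLESNormFDerivOneConst (volume : Measure Plane) 2 * (ENNReal.ofReal k
        * (eLpNorm (mol n f) (ENNReal.ofReal ((k - 1) * p')) volume ^ (k - 1)
          * ∑ j, eLpNorm (g j) (ENNReal.ofReal p) volume)) := by
  have hc : ContDiff ℝ 1 (mol n f) :=
    (contDiff_mol n (locallyIntegrable_of_memLp_two hf2)).of_le (by simp)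
  have hb : ∀ x, |mol n f x| ≤ _ := conv_bounded (rho_continuous n) (rho_compact n) hf2
  refine (eLpNorm_rpow_le_of_contDiff hc (memLp_mol_two n hf2) hb hk hpp).trans ?_
  gcongr with j
  rw [(hg j).partialDeriv_mol n]
  exact eLpNorm_mol_le n hpp.symm.lt.le (hg j).2.1.aestronglyMeasurable

/-- Fatou along the almost everywhere convergence of mollifications; it transfers embeddings from
smooth functions. -/
theorem eLpNorm_le_of_mol_le {f : Plane → ℝ} (hf : LocallyIntegrable f) {q : ℝ≥0∞} {C : ℝ≥0∞}
    (h : ∀ n, eLpNorm (mol n f) q volume ≤ C) : eLpNorm f q volume ≤ C := by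
  have hfat := Lp.eLpNorm_lim_le_liminf_eLpNorm (μ := (volume : Measure Plane)) (p := q)
    (f := fun n => mol n f) (fun n => (continuous_mol n hf).aestronglyMeasurable) f
    (mol_tendsto_ae hf)
  refine hfat.trans ((liminf_le_liminf (Eventually.of_forall h)).trans_eq ?_)
  exact tendsto_const_nhds.liminf_eq

/-- The common power is divided out, which is allowed only because `X` is finite. -/
theorem le_of_rpow_le_mul {X C : ℝ≥0∞} {k : ℝ} (hk : 1 < k) (hX : X ≠ ⊤)
    (h : X ^ k ≤ C * X ^ (k - 1)) : X ≤ C := by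
  rcases eq_or_ne X 0 with h0 | h0
  · simp [h0]
  have e : X ^ k = X * X ^ (k - 1) := by
    conv_rhs => rw [← ENNReal.rpow_one X, ← ENNReal.rpow_mul]
    rw [← ENNReal.rpow_add _ _ h0 hX]; congr 1; ring
  rw [e] at h
  exact (ENNReal.mul_le_mul_iff_left (by simp [h0, hX])
    (ENNReal.rpow_ne_top_of_nonneg (by linarith) hX)).1 h

/-- The embedding `H¹ ⊂ L⁶` in the plane. -/
theorem exists_eLpNorm_six_le : ∃ C : ℝ≥0, ∀ (f : Plane → ℝ) (g : Fin 2 → Plane → ℝ),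
    MemLp f 2 volume → (∀ j, IsWeakPartial j f (g j)) →
      eLpNorm f 6 volume ≤ C * (eLpNorm f 2 volume + ∑ j, eLpNorm (g j) 2 volume) := by
  set A := eLpNormLESNormFDerivOneConst (volume : Measure Plane) 2
  refine ⟨(A * 3 * (A * 2)) ^ (1 / 3 : ℝ), fun f g hf hg => ?_⟩
  refine eLpNorm_le_of_mol_le (locallyIntegrable_of_memLp_two hf) fun n => ?_
  have h22 : (2 : ℝ).HolderConjugate 2 := Real.HolderConjugate.two_two
  -- The case `k = 2` bounds `‖f‖_4²` by `‖f‖_2 ‖∇f‖_2`, and `k = 3` bounds `‖f‖_6³` by `‖f‖_4²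
  -- ‖∇f‖_2`; chaining the two reaches `L⁶`.
  have h1 := eLpNorm_mol_rpow_le hf hg n (k := 2) (by norm_num) h22
  have h2 := eLpNorm_mol_rpow_le hf hg n (k := 3) (by norm_num) h22
  norm_num at h1 h2
  set G := ∑ j, eLpNorm (g j) 2 volume with hG
  have hG' : eLpNorm (g 0) 2 volume + eLpNorm (g 1) 2 volume = G := by simp [hG]
  rw [hG'] at h1 h2
  set N := eLpNorm f 2 volume + G with hN
  have h0 : eLpNorm (mol n f) 2 volume ≤ N := (eLpNorm_mol_le_two n hf).trans le_self_add
  have h3 : eLpNorm (mol n f) 6 volume ^ (3 : ℝ) ≤ (A * 3 * (A * 2)) * N ^ (3 : ℝ) := by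
    have : eLpNorm (mol n f) 6 volume ^ (3 : ℕ) ≤ A * (3 * (A * (2 * (N * N)) * N)) := by
      refine h2.trans ?_
      gcongr
      · refine h1.trans ?_
        gcongr
        exact le_add_self
      · exact le_add_self
    rw [← ENNReal.rpow_natCast] at this
    refine le_trans (by exact_mod_cast this) (le_of_eq ?_)
    rw [show (3 : ℝ) = ((3 : ℕ) : ℝ) by norm_num, ENNReal.rpow_natCast]
    ring
  have h4 := ENNReal.rpow_le_rpow h3 (z := 1 / 3) (by norm_num)
  rw [← ENNReal.rpow_mul, ENNReal.mul_rpow_of_nonneg _ _ (by norm_num), ← ENNReal.rpow_mul] at h4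
  norm_num at h4
  refine h4.trans (le_of_eq ?_)
  rw [ENNReal.coe_rpow_of_nonneg _ (by norm_num)]
  push_cast
  norm_num

/-- The embedding `H¹ ⊂ L^q`, `2 ≤ q ≤ 6`, in the plane. -/
theorem exists_eLpNorm_le_of_H1 {q : ℝ} (h2q : 2 ≤ q) (hq6 : q ≤ 6) :
    ∃ C : ℝ≥0, ∀ (f : Plane → ℝ) (g : Fin 2 → Plane → ℝ),
    MemLp f 2 volume → (∀ j, IsWeakPartial j f (g j)) →
      eLpNorm f (ENNReal.ofReal q) volume
        ≤ C * (eLpNorm f 2 volume + ∑ j, eLpNorm (g j) 2 volume) := by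
  obtain ⟨C, hC⟩ := exists_eLpNorm_six_le
  refine ⟨2 * (1 + C), fun f g hf hg => ?_⟩
  refine (eLpNorm_interpolation hf.1 h2q hq6).trans ?_
  push_cast
  rw [mul_assoc]
  gcongr
  rw [add_mul, one_mul]
  have := hC f g hf hg
  norm_num at this ⊢
  gcongr
  exact le_self_add

/-- The embedding of `L² ∩ Ẇ^{1,p}`, `p > 3/2`, in `L^q` for `2 ≤ q ≤ 4` or `q = 2p'`. -/
theorem exists_eLpNorm_le_of_W1p {p p' q : ℝ} (hpp : p'.HolderConjugate p) (hp : 3 / 2 < p)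
    (h2q : 2 ≤ q) (hq : q ≤ max 4 (2 * p')) (A B : ℝ≥0) :
    ∃ C : ℝ≥0, ∀ (f : Plane → ℝ) (g : Fin 2 → Plane → ℝ),
    MemLp f 2 volume → (∀ j, IsWeakPartial j f (g j)) → eLpNorm f 2 volume ≤ A →
      (∀ j, eLpNorm (g j) (ENNReal.ofReal p) volume ≤ B) →
      eLpNorm f (ENNReal.ofReal q) volume ≤ C := by
  set K := eLpNormLESNormFDerivOneConst (volume : Measure Plane) 2
  have hp'0 := hpp.pos
  have hp0 := hpp.symm.pos
  have hsum : p' * p = p' + p := by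
    have := hpp.inv_add_inv_eq_one
    field_simp at this
    linarith
  obtain ⟨r, C, hqr, hC⟩ : ∃ (r : ℝ) (C : ℝ≥0), q ≤ r ∧
      ∀ (f : Plane → ℝ) (g : Fin 2 → Plane → ℝ),
    MemLp f 2 volume → (∀ j, IsWeakPartial j f (g j)) → eLpNorm f 2 volume ≤ A →
      (∀ j, eLpNorm (g j) (ENNReal.ofReal p) volume ≤ B) →
      eLpNorm f (ENNReal.ofReal r) volume ≤ C := by
    rcases le_or_gt 2 p with h2p | h2p
    · have hp'2 : p' ≤ 2 := by nlinarith
      -- This `k` makes `(k - 1) p' = 2`, so the power on the right is an `L²` norm. As `p' ≤ 2`,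
      -- the exponent `2k` is at least `4` and at least `2p'`.
      set k := 1 + 2 / p' with hk
      have hk2 : 2 ≤ k := by
        have : 1 ≤ 2 / p' := (one_le_div hp'0).2 hp'2
        linarith
      have hk0 : 0 < k := by linarith
      refine ⟨2 * k, (K * (k.toNNReal * (A ^ (k - 1) * (B + B)))) ^ (1 / k), ?_,
        fun f g hf hg hfA hgB => ?_⟩
      · refine hq.trans (max_le (by linarith) ?_)
        have : p' ≤ k := by linarith
        linarith
      refine eLpNorm_le_of_mol_le (locallyIntegrable_of_memLp_two hf) fun n => ?_
      have h1 := eLpNorm_mol_rpow_le hf hg n hk2 hpp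
      have e2 : (k - 1) * p' = 2 := by rw [hk]; field_simp; ring
      rw [e2, ofReal_two] at h1
      have h2 : eLpNorm (mol n f) (ENNReal.ofReal (2 * k)) volume ^ k
          ≤ ((K * (k.toNNReal * (A ^ (k - 1) * (B + B))) : ℝ≥0) : ℝ≥0∞) := by
        refine h1.trans ?_
        push_cast
        rw [ENNReal.coe_rpow_of_nonneg _ (by linarith)]
        have := hgB 0
        have := hgB 1
        rw [Fin.sum_univ_two]
        gcongr
        · exact le_rfl
        · linarith
        · exact (eLpNorm_mol_le_two n hf).trans hfA
      have h3 := ENNReal.rpow_le_rpow h2 (z := 1 / k) (by positivity)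
      rw [← ENNReal.rpow_mul, mul_one_div_cancel hk0.ne', ENNReal.rpow_one] at h3
      rwa [ENNReal.coe_rpow_of_nonneg _ (by positivity)]
    · have h2p' : 0 < 2 - p := by linarith
      -- Here `2k` is the Sobolev exponent `2p / (2 - p)` and `(k - 1) p' = 2k`, so the same norm
      -- stands on both sides and is cancelled. The hypothesis `p > 3/2` says exactly that `k > 3`;
      -- together with `p' < 3` it gives `2p' < 6 < 2k`.
      set k := p / (2 - p) with hk
      have hk3 : 3 < k := by rw [hk, lt_div_iff₀ h2p']; linarith
      have hk0 : 0 < k := by linarith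
      have hp'3 : p' < 3 := by nlinarith
      refine ⟨2 * k, K * (k.toNNReal * (B + B)), ?_, fun f g hf hg hfA hgB => ?_⟩
      · exact hq.trans (max_le (by linarith) (by linarith))
      refine eLpNorm_le_of_mol_le (locallyIntegrable_of_memLp_two hf) fun n => ?_
      have h1 := eLpNorm_mol_rpow_le hf hg n (by linarith) hpp
      have e2 : (k - 1) * p' = 2 * k := by
        rw [hk]; field_simp; nlinarith
      rw [e2] at h1
      have hfin := eLpNorm_lt_top_of_bounded (memLp_mol_two n hf)
        (conv_bounded (rho_continuous n) (rho_compact n) hf) (r := 2 * k) (by linarith)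
      refine le_of_rpow_le_mul (by linarith) hfin.ne (h1.trans ?_)
      push_cast
      rw [mul_assoc, mul_assoc, mul_comm (_ ^ (k - 1))]
      have := hgB 0
      have := hgB 1
      rw [Fin.sum_univ_two]
      gcongr
      exact le_rfl
  refine ⟨2 * (A + C), fun f g hf hg hfA hgB => ?_⟩
  refine (eLpNorm_interpolation hf.1 h2q hqr).trans ?_
  push_cast
  gcongr
  exact hC f g hf hg hfA hgB

end

end OldroydB

namespace OldroydB

open scoped ENNReal

/-! ### Absolutely continuous functions of time -/

section TimeIntegration

/-- Integration by parts for absolutely continuous functions: a primitive is differentiable almost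
everywhere, with its integrand as derivative. -/
theorem integral_primitive_mul {f g : ℝ → ℝ} {t a₀ b₀ : ℝ}
    (hf : IntervalIntegrable f volume 0 t) (hg : IntervalIntegrable g volume 0 t) :
    IntervalIntegrable (fun s => f s * (b₀ + ∫ r in (0 : ℝ)..s, g r)
        + (a₀ + ∫ r in (0 : ℝ)..s, f r) * g s) volume 0 t ∧
      ∫ s in (0 : ℝ)..t, (f s * (b₀ + ∫ r in (0 : ℝ)..s, g r)
        + (a₀ + ∫ r in (0 : ℝ)..s, f r) * g s)
      = (a₀ + ∫ r in (0 : ℝ)..t, f r) * (b₀ + ∫ r in (0 : ℝ)..t, g r) - a₀ * b₀ := by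
  have hac : ∀ {h : ℝ → ℝ} {c : ℝ}, IntervalIntegrable h volume 0 t →
      AbsolutelyContinuousOnInterval (fun s => c + ∫ r in (0 : ℝ)..s, h r) 0 t := by
    intro h c hh
    have h1 : AbsolutelyContinuousOnInterval (fun _ : ℝ => c) 0 t :=
      (LipschitzWith.const c).lipschitzOnWith.absolutelyContinuousOnInterval
    exact h1.fun_add (hh.absolutelyContinuousOnInterval_intervalIntegral (by simp))
  have hA := hac (c := a₀) hf
  have hB := hac (c := b₀) hg
  have h := hA.integral_deriv_mul_eq_sub hB
  refine ⟨(hf.mul_continuousOn hB.continuousOn).add (hg.continuousOn_mul hA.continuousOn), ?_⟩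
  have e : ∫ s in (0 : ℝ)..t, (f s * (b₀ + ∫ r in (0 : ℝ)..s, g r)
        + (a₀ + ∫ r in (0 : ℝ)..s, f r) * g s)
      = ∫ s in (0 : ℝ)..t, (deriv (fun s => a₀ + ∫ r in (0 : ℝ)..s, f r) s
          * (b₀ + ∫ r in (0 : ℝ)..s, g r)
        + (a₀ + ∫ r in (0 : ℝ)..s, f r) * deriv (fun s => b₀ + ∫ r in (0 : ℝ)..s, g r) s) := by
    refine intervalIntegral.integral_congr_ae ?_
    filter_upwards [hf.ae_hasDerivAt_integral, hg.ae_hasDerivAt_integral] with s h1 h2 hs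
    rw [((h1 (uIoc_subset_uIcc hs) 0 (by simp)).const_add a₀).deriv,
      ((h2 (uIoc_subset_uIcc hs) 0 (by simp)).const_add b₀).deriv]
  rw [e, h]
  simp

theorem integral_primitive_sq {f : ℝ → ℝ} {t a₀ : ℝ} (hf : IntervalIntegrable f volume 0 t) :
    (a₀ + ∫ r in (0 : ℝ)..t, f r) ^ 2
      = a₀ ^ 2 + 2 * ∫ s in (0 : ℝ)..t, f s * (a₀ + ∫ r in (0 : ℝ)..s, f r) := by
  have h := (integral_primitive_mul (a₀ := a₀) (b₀ := a₀) hf hf).2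
  have e : ∫ s in (0 : ℝ)..t, (f s * (a₀ + ∫ r in (0 : ℝ)..s, f r)
        + (a₀ + ∫ r in (0 : ℝ)..s, f r) * f s)
      = ∫ s in (0 : ℝ)..t, 2 * (f s * (a₀ + ∫ r in (0 : ℝ)..s, f r)) := by
    congr 1; funext s; ring
  rw [e, intervalIntegral.integral_const_mul] at h
  rw [h]; ring

/-- A compactly supported function on `(0,T)` is on `(0,T)` the derivative of a test function on
`(-∞,T)`. -/
theorem exists_primitive_test {T : ℝ} (hT : 0 < T) {η : ℝ → ℝ} (hη : ContDiff ℝ ∞ η)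
    (hc : HasCompactSupport η) (hs : tsupport η ⊆ Ioo 0 T) :
    ∃ θ : ℝ → ℝ, ContDiff ℝ ∞ θ ∧ HasCompactSupport θ ∧ tsupport θ ⊆ Iio T ∧
      ∀ s ∈ Ioo 0 T, deriv θ s = η s := by
  obtain ⟨b, hb0, hbT, hb⟩ : ∃ b, 0 < b ∧ b < T ∧ ∀ s, b ≤ s → η s = 0 := by
    rcases (tsupport η).eq_empty_or_nonempty with he | hne
    · refine ⟨T / 2, by linarith, by linarith, fun s _ => ?_⟩
      rw [tsupport_eq_empty_iff.1 he]; rfl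
    · obtain ⟨m, hm, hmax⟩ := hc.isCompact.exists_isMaxOn hne continuousOn_id
      have hmm := hs hm
      refine ⟨(m + T) / 2, by linarith [hmm.1], by linarith [hmm.2], fun s hs' => ?_⟩
      by_contra h0
      have : s ≤ m := hmax (subset_tsupport _ h0)
      linarith [hmm.2]
  -- Integrating from `T` makes the primitive vanish near `T` and beyond. For negative times it is a
  -- constant, possibly nonzero, so a smooth transition cuts it off there; the transition equals `1`
  -- on positive times and leaves the derivative on `(0, T)` unchanged.
  set E : ℝ → ℝ := fun s => ∫ r in T..s, η r with hE
  have hE' : ∀ s, HasDerivAt E (η s) s := fun s =>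
    intervalIntegral.integral_hasDerivAt_right (hη.continuous.intervalIntegrable _ _)
      (hη.continuous.stronglyMeasurableAtFilter _ _) hη.continuous.continuousAt
  have hEsm : ContDiff ℝ ∞ E := by
    rw [contDiff_infty_iff_deriv]
    refine ⟨fun s => (hE' s).differentiableAt, ?_⟩
    rw [show deriv E = η from funext fun s => (hE' s).deriv]
    exact hη
  have hEb : ∀ s, b ≤ s → E s = 0 := by
    intro s hs'
    refine intervalIntegral.integral_zero_ae (Eventually.of_forall fun r hr => hb r ?_)
    rcases le_total T s with h | h
    · rw [uIoc_of_le h] at hr; linarith [hr.1]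
    · rw [uIoc_of_ge h] at hr; linarith [hr.1]
  set χ : ℝ → ℝ := fun s => Real.smoothTransition (s + 1) with hχ
  have hχsm : ContDiff ℝ ∞ χ := Real.smoothTransition.contDiff.comp (contDiff_id.add contDiff_const)
  have hz : ∀ s, s ∉ Icc (-1) b → χ s * E s = 0 := by
    intro s hs'
    rw [mem_Icc, not_and_or, not_le, not_le] at hs'
    rcases hs' with h | h
    · simp [hχ, Real.smoothTransition.zero_of_nonpos (x := s + 1) (by linarith)]
    · simp [hEb s h.le]
  refine ⟨fun s => χ s * E s, hχsm.mul hEsm, HasCompactSupport.intro isCompact_Icc hz, ?_, ?_⟩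
  · refine (closure_minimal (fun s h => ?_) isClosed_Icc).trans
      (fun s (h : s ∈ Icc (-1) b) => lt_of_le_of_lt h.2 hbT)
    by_contra hn
    exact h (hz s hn)
  · intro s hs'
    have : (fun s => χ s * E s) =ᶠ[𝓝 s] E := by
      filter_upwards [lt_mem_nhds hs'.1] with r hr
      simp [hχ, Real.smoothTransition.one_of_one_le (x := r + 1) (by linarith)]
    rw [this.deriv_eq, (hE' s).deriv]

/-- A continuous function with integrable weak derivative `f` and initial value `a₀`. -/
theorem eq_add_integral_of_weak {T a₀ : ℝ} (hT : 0 < T) {a f : ℝ → ℝ}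
    (ha : ContinuousOn a (Icc 0 T)) (hf : IntervalIntegrable f volume 0 T)
    (h : ∀ θ : ℝ → ℝ, ContDiff ℝ ∞ θ → HasCompactSupport θ → tsupport θ ⊆ Iio T →
      ∫ t in (0 : ℝ)..T, (deriv θ t * a t + θ t * f t) = - (a₀ * θ 0)) :
    ∀ t ∈ Icc 0 T, a t = a₀ + ∫ s in (0 : ℝ)..t, f s := by
  set A : ℝ → ℝ := fun s => a₀ + ∫ r in (0 : ℝ)..s, f r with hA
  have hAc : ContinuousOn A (Icc 0 T) := by
    have := (hf.absolutelyContinuousOnInterval_intervalIntegral (c := 0) (by simp)).continuousOn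
    rw [uIcc_of_le hT.le] at this
    exact continuousOn_const.add this
  have haI : ContinuousOn a (uIcc 0 T) := by rwa [uIcc_of_le hT.le]
  have hAI : ContinuousOn A (uIcc 0 T) := by rwa [uIcc_of_le hT.le]
  -- The primitive `A` satisfies the same weak equation with the same initial value, by parts and `θ
  -- T = 0`. In the difference both the source and the boundary term disappear.
  have key : ∀ θ : ℝ → ℝ, ContDiff ℝ ∞ θ → HasCompactSupport θ → tsupport θ ⊆ Iio T →
      ∫ t in (0 : ℝ)..T, deriv θ t * (a t - A t) = 0 := by
    intro θ hθ hc hs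
    have hdc : Continuous (deriv θ) := hθ.continuous_deriv (by simp)
    have hdθ : IntervalIntegrable (deriv θ) volume 0 T := hdc.intervalIntegrable _ _
    have h1 := h θ hθ hc hs
    have h2 := (integral_primitive_mul (a₀ := θ 0) (b₀ := a₀) hdθ hf).2
    have hθs : ∀ s, θ 0 + ∫ r in (0 : ℝ)..s, deriv θ r = θ s := by
      intro s
      rw [intervalIntegral.integral_deriv_eq_sub (fun x _ => hθ.differentiable (by simp) x)
        (hdc.intervalIntegrable _ _)]
      ring
    have hθT : θ T = 0 := by
      by_contra h0
      exact lt_irrefl T (hs (subset_tsupport _ h0))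
    simp only [hθs] at h2
    rw [hθT] at h2
    have i1 : IntervalIntegrable (fun t => deriv θ t * a t) volume 0 T :=
      hdθ.mul_continuousOn haI
    have i2 : IntervalIntegrable (fun t => θ t * f t) volume 0 T :=
      hf.continuousOn_mul hθ.continuous.continuousOn
    have i3 : IntervalIntegrable (fun t => deriv θ t * A t) volume 0 T :=
      hdθ.mul_continuousOn hAI
    rw [intervalIntegral.integral_add i1 i2] at h1
    rw [intervalIntegral.integral_add i3 i2] at h2
    simp only [mul_sub]
    rw [intervalIntegral.integral_sub i1 i3]
    linarith
  have hd : ContinuousOn (fun s => a s - A s) (Icc 0 T) := ha.sub hAc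
  -- Every test function on `(0, T)` agrees there with the derivative of an admissible `θ`. So `a -
  -- A` vanishes almost everywhere, and then everywhere on the closed interval by continuity.
  have hae : ∀ᵐ s, s ∈ Ioo 0 T → a s - A s = 0 := by
    refine isOpen_Ioo.ae_eq_zero_of_integral_contDiff_smul_eq_zero
      ((hd.mono Ioo_subset_Icc_self).locallyIntegrableOn measurableSet_Ioo) fun η hη hc hs => ?_
    obtain ⟨θ, h1, h2, h3, h4⟩ := exists_primitive_test hT hη hc hs
    have h5 := key θ h1 h2 h3
    rw [intervalIntegral.integral_of_le hT.le, integral_Ioc_eq_integral_Ioo] at h5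
    have h6 : ∫ s in Ioo 0 T, η s • (a s - A s) = ∫ s, η s • (a s - A s) :=
      setIntegral_eq_integral_of_forall_compl_eq_zero fun s hs' => by
        rw [image_eq_zero_of_notMem_tsupport fun h => hs' (hs h), zero_smul]
    rw [← h6]
    refine Eq.trans ?_ h5
    refine setIntegral_congr_fun measurableSet_Ioo fun s hs' => ?_
    simp [h4 s hs']
  have heq : EqOn (fun s => a s - A s) (fun _ => 0) (Icc 0 T) := by
    refine Measure.eqOn_Icc_of_ae_eq volume hT.ne ?_ hd continuousOn_const
    have hr : volume.restrict (Ioo 0 T) = volume.restrict (Icc 0 T) :=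
      Measure.restrict_congr_set Ioo_ae_eq_Icc
    rw [EventuallyEq, ← hr]
    exact (ae_restrict_iff' measurableSet_Ioo).2 hae
  intro t ht
  have := heq ht
  simp only [hA] at this
  linarith

end TimeIntegration

/-! ### Energy identity in a separable Hilbert space -/

section AbstractEnergy

variable {H : Type*} [NormedAddCommGroup H] [InnerProductSpace ℝ H]

/-- Distinct orthonormal vectors are at distance `√2`, so the balls of radius `1/2` around them are
disjoint. -/
theorem countable_of_orthonormal [SecondCountableTopology H] {ι : Type*} {b : ι → H}
    (hb : Orthonormal ℝ b) : Countable ι := by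
  refine Pairwise.countable_of_isOpen_disjoint (s := fun i => Metric.ball (b i) (1 / 2))
    (fun i j hij => ?_) (fun _ => Metric.isOpen_ball) fun i => ⟨b i, by simp⟩
  refine Metric.ball_disjoint_ball ?_
  have h : ‖b i - b j‖ ^ 2 = 2 := by
    rw [norm_sub_sq_real, hb.1 i, hb.1 j, hb.2 hij]; norm_num
  rw [dist_eq_norm]
  nlinarith [norm_nonneg (b i - b j)]

/-- A weakly measurable function with values in a separable Hilbert space is strongly
measurable. -/
theorem aestronglyMeasurable_of_inner [CompleteSpace H] [SecondCountableTopology H]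
    {α : Type*} [MeasurableSpace α] {μ : Measure α} {w : α → H}
    (hw : ∀ e, AEStronglyMeasurable (fun s => inner ℝ (w s) e) μ) : AEStronglyMeasurable w μ := by
  obtain ⟨v, b, hb⟩ := exists_hilbertBasis ℝ H
  have := countable_of_orthonormal b.orthonormal
  refine aestronglyMeasurable_of_tendsto_ae (u := (atTop : Filter (Finset v)))
    (f := fun F s => ∑ i ∈ F, (inner ℝ (w s) (b i) : ℝ) • b i) (fun F => ?_)
    (Eventually.of_forall fun s => ?_)
  · exact Finset.aestronglyMeasurable_fun_sum _ fun i _ => (hw (b i)).smul_const _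
  · have := b.hasSum_repr (w s)
    simp only [b.repr_apply_apply, real_inner_comm] at this
    exact this

variable [CompleteSpace H] [SecondCountableTopology H]

/-- Energy identity for a weakly differentiable function with values in a Hilbert space. -/
theorem energy_identity {T : ℝ} {S : Set H} {w : ℝ → H} {w₀ : H} {B : ℝ → H →L[ℝ] ℝ} {g : ℝ → ℝ}
    (hT : 0 < T) (hg : IntervalIntegrable g volume 0 T)
    (hBg : ∀ᵐ s ∂(volume.restrict (Ioc 0 T)), ‖B s‖ ≤ g s)
    (hBm : ∀ e ∈ S, AEStronglyMeasurable (fun s => B s e) (volume.restrict (Ioc 0 T)))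
    (hw : ∀ t ∈ Ico 0 T, ∀ e ∈ S, inner ℝ (w t) e = inner ℝ w₀ e + ∫ s in (0 : ℝ)..t, B s e)
    (hwS : ∀ t ∈ Ico 0 T, w t ∈ (Submodule.span ℝ S).topologicalClosure)
    (hw₀ : w₀ ∈ (Submodule.span ℝ S).topologicalClosure) :
    ∀ t ∈ Ico 0 T, IntervalIntegrable (fun s => B s (w s)) volume 0 t ∧
      ‖w t‖ ^ 2 = ‖w₀‖ ^ 2 + 2 * ∫ s in (0 : ℝ)..t, B s (w s) := by
  set K : Submodule ℝ H := (Submodule.span ℝ S).topologicalClosure with hK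
  have hg' : IntegrableOn g (Ioc 0 T) := (intervalIntegrable_iff_integrableOn_Ioc_of_le hT.le).1 hg
  have hsub : ∀ {t}, t ∈ Ico 0 T → Ioc 0 t ⊆ Ioc 0 T := fun ht => Ioc_subset_Ioc_right ht.2.le
  have hbd : ∀ e : H, ∀ᵐ s ∂(volume.restrict (Ioc 0 T)), ‖B s e‖ ≤ g s * ‖e‖ := fun e => by
    filter_upwards [hBg] with s hs
    exact (B s).le_of_opNorm_le hs e
  have hint : ∀ e, AEStronglyMeasurable (fun s => B s e) (volume.restrict (Ioc 0 T)) →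
      IntegrableOn (fun s => B s e) (Ioc 0 T) := fun e he =>
    (hg'.mul_const ‖e‖).mono' he (hbd e)
  -- extension of the weak formulation to the closed span of `S`
  have hext : ∀ e ∈ K, AEStronglyMeasurable (fun s => B s e) (volume.restrict (Ioc 0 T)) ∧
      ∀ t ∈ Ico 0 T, inner ℝ (w t) e = inner ℝ w₀ e + ∫ s in (0 : ℝ)..t, B s e := by
    set P : Submodule ℝ H :=
      { carrier := {e | AEStronglyMeasurable (fun s => B s e) (volume.restrict (Ioc 0 T)) ∧
          ∀ t ∈ Ico 0 T, inner ℝ (w t) e = inner ℝ w₀ e + ∫ s in (0 : ℝ)..t, B s e}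
        zero_mem' := by simp [aestronglyMeasurable_const]
        add_mem' := by
          rintro a b ⟨ha, ha'⟩ ⟨hb, hb'⟩
          refine ⟨by simp only [map_add]; exact ha.add hb, fun t ht => ?_⟩
          simp only [inner_add_right, map_add]
          rw [ha' t ht, hb' t ht, intervalIntegral.integral_add]
          · ring
          · exact (intervalIntegrable_iff_integrableOn_Ioc_of_le ht.1).2
              ((hint a ha).mono_set (hsub ht))
          · exact (intervalIntegrable_iff_integrableOn_Ioc_of_le ht.1).2
              ((hint b hb).mono_set (hsub ht))
        smul_mem' := by
          rintro c a ⟨ha, ha'⟩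
          refine ⟨by simpa using ha.const_mul c, fun t ht => ?_⟩
          simp only [inner_smul_right, map_smul, smul_eq_mul]
          rw [ha' t ht, intervalIntegral.integral_const_mul]
          ring } with hP
    have hSP : Submodule.span ℝ S ≤ P := Submodule.span_le.2 fun e he =>
      ⟨hBm e he, fun t ht => hw t ht e he⟩
    have hPc : IsClosed (P : Set H) := by
      refine isClosed_of_closure_subset fun e he => ?_
      -- The vectors for which the identity holds form a closed set: along a convergent sequence the
      -- integrands are eventually dominated by `g (‖e‖ + 1)`.
      obtain ⟨x, hx, hxe⟩ := mem_closure_iff_seq_limit.1 he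
      have hm : AEStronglyMeasurable (fun s => B s e) (volume.restrict (Ioc 0 T)) :=
        aestronglyMeasurable_of_tendsto_ae atTop (fun n => (hx n).1)
          (Eventually.of_forall fun s => ((B s).continuous.tendsto e).comp hxe)
      refine ⟨hm, fun t ht => ?_⟩
      have h1 : Tendsto (fun n => (inner ℝ (w t) (x n) : ℝ)) atTop (𝓝 (inner ℝ (w t) e)) :=
        tendsto_const_nhds.inner hxe
      have h2 : Tendsto (fun n => (inner ℝ w₀ (x n) : ℝ)) atTop (𝓝 (inner ℝ w₀ e)) :=
        tendsto_const_nhds.inner hxe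
      have h3 : Tendsto (fun n => ∫ s in (0 : ℝ)..t, B s (x n)) atTop
          (𝓝 (∫ s in (0 : ℝ)..t, B s e)) := by
        simp only [intervalIntegral.integral_of_le ht.1]
        refine tendsto_integral_filter_of_dominated_convergence (fun s => g s * (‖e‖ + 1))
          (Eventually.of_forall fun n => (hx n).1.mono_measure
            (Measure.restrict_mono (hsub ht) le_rfl)) ?_
          ((hg'.mono_set (hsub ht)).mul_const _) (Eventually.of_forall fun s =>
            ((B s).continuous.tendsto e).comp hxe)
        filter_upwards [hxe.norm.eventually (gt_mem_nhds (lt_add_one ‖e‖))] with n hn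
        filter_upwards [ae_mono (Measure.restrict_mono (hsub ht) le_rfl) hBg] with s hs
        refine ((B s).le_of_opNorm_le hs _).trans ?_
        exact mul_le_mul_of_nonneg_left hn.le ((norm_nonneg _).trans hs)
      refine tendsto_nhds_unique h1 ((h2.add h3).congr fun n => ?_)
      exact ((hx n).2 t ht).symm
    intro e he
    exact Submodule.topologicalClosure_minimal _ hSP hPc he
  have hBi : ∀ e ∈ K, ∀ t ∈ Ico 0 T, IntervalIntegrable (fun s => B s e) volume 0 t :=
    fun e he t ht => (intervalIntegrable_iff_integrableOn_Ioc_of_le ht.1).2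
      ((hint e (hext e he).1).mono_set (hsub ht))
  -- a uniform bound
  set M : ℝ := ‖w₀‖ + ∫ s in (0 : ℝ)..T, g s with hM
  have hg0 : 0 ≤ᵐ[volume.restrict (Ioc 0 T)] g := by
    filter_upwards [hBg] with s hs using (norm_nonneg _).trans hs
  have hwM : ∀ t ∈ Ico 0 T, ‖w t‖ ≤ M := by
    intro t ht
    -- The test vector is `w t` itself, frozen at the final time. This gives `‖w t‖² ≤ (‖w₀‖ + ∫ g)
    -- ‖w t‖`, with no measurability of `w` required.
    have h1 := (hext _ (hwS t ht)).2 t ht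
    rw [real_inner_self_eq_norm_sq] at h1
    have h2 : ∫ s in (0 : ℝ)..t, B s (w t) ≤ (∫ s in (0 : ℝ)..T, g s) * ‖w t‖ := by
      rw [← intervalIntegral.integral_mul_const, intervalIntegral.integral_of_le ht.1,
        intervalIntegral.integral_of_le hT.le]
      calc ∫ s in Ioc 0 t, B s (w t) ≤ ∫ s in Ioc 0 t, g s * ‖w t‖ := by
            refine integral_mono_ae ((hint _ (hext _ (hwS t ht)).1).mono_set (hsub ht))
              ((hg'.mono_set (hsub ht)).mul_const _) ?_
            filter_upwards [ae_mono (Measure.restrict_mono (hsub ht) le_rfl) (hbd (w t))] with s hs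
            exact (le_abs_self _).trans hs
        _ ≤ ∫ s in Ioc 0 T, g s * ‖w t‖ := by
            refine setIntegral_mono_set (hg'.mul_const _) ?_ (hsub ht).eventuallyLE
            filter_upwards [hg0] with s hs
            exact mul_nonneg hs (norm_nonneg _)
    have h3 : inner ℝ w₀ (w t) ≤ ‖w₀‖ * ‖w t‖ := real_inner_le_norm _ _
    have hM0 : 0 ≤ M := by
      refine add_nonneg (norm_nonneg _) ?_
      rw [intervalIntegral.integral_of_le hT.le]
      exact integral_nonneg_of_ae hg0
    rcases (norm_nonneg (w t)).eq_or_lt with h0 | h0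
    · rw [← h0]; exact hM0
    · have : ‖w t‖ * ‖w t‖ ≤ M * ‖w t‖ := by rw [hM]; nlinarith
      exact le_of_mul_le_mul_right this h0
  have : CompleteSpace K := (Submodule.isClosed_topologicalClosure _).completeSpace_coe
  obtain ⟨v, b, hb⟩ := exists_hilbertBasis ℝ K
  -- Countability of the basis makes the filter of its finite subsets countably generated, as
  -- dominated convergence along that filter requires.
  have hcount := countable_of_orthonormal b.orthonormal
  have hbH : Orthonormal ℝ (fun i => (b i : H)) :=
    b.orthonormal.comp_linearIsometry K.subtypeₗᵢ
  have hbK : ∀ i, (b i : H) ∈ K := fun i => (b i).2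
  -- the finite-dimensional projections
  set Q : Finset v → H → H := fun F x => ∑ i ∈ F, (inner ℝ x (b i : H) : ℝ) • (b i : H) with hQ
  have hQlim : ∀ x ∈ K, Tendsto (fun F => Q F x) atTop (𝓝 x) := by
    intro x hx
    have h1 := (b.hasSum_repr ⟨x, hx⟩).mapL K.subtypeL
    simp only [b.repr_apply_apply, Submodule.coe_inner, map_smul, Submodule.subtypeL_apply] at h1
    simp only [real_inner_comm] at h1
    exact h1
  have hQin : ∀ F x, inner ℝ (Q F x) x = ∑ i ∈ F, (inner ℝ x (b i : H) : ℝ) ^ 2 := by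
    intro F x
    simp only [hQ, sum_inner, real_inner_smul_left]
    refine Finset.sum_congr rfl fun i _ => ?_
    rw [real_inner_comm x (b i : H)]; ring
  have hQn : ∀ F x, ‖Q F x‖ ≤ ‖x‖ := by
    intro F x
    have h1 : ‖Q F x‖ ^ 2 = inner ℝ (Q F x) x := by
      rw [hQin, ← real_inner_self_eq_norm_sq]
      simp only [hQ]
      rw [hbH.inner_sum]
      refine Finset.sum_congr rfl fun i _ => ?_
      simp [sq]
    have h2 := real_inner_le_norm (Q F x) x
    rcases (norm_nonneg (Q F x)).eq_or_lt with h0 | h0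
    · rw [← h0]; exact norm_nonneg _
    · nlinarith
  -- Each coefficient of `w` is a scalar primitive, so its square obeys the chain rule; the finite
  -- sum of these rules is the identity for the projection `Q F`.
  have hfin : ∀ t ∈ Ico 0 T, ∀ F : Finset v,
      IntervalIntegrable (fun s => B s (Q F (w s))) volume 0 t ∧
      inner ℝ (Q F (w t)) (w t)
        = inner ℝ (Q F w₀) w₀ + 2 * ∫ s in (0 : ℝ)..t, B s (Q F (w s)) := by
    intro t ht F
    have hBi' := fun i => hBi _ (hbK i) t ht
    have e1 : ∀ s ∈ Icc 0 t, ∀ i, (inner ℝ (w s) (b i : H) : ℝ)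
        = inner ℝ w₀ (b i : H) + ∫ r in (0 : ℝ)..s, B r (b i) := fun s hs i =>
      (hext _ (hbK i)).2 s ⟨hs.1, hs.2.trans_lt ht.2⟩
    have e2 : ∀ s ∈ Icc 0 t, B s (Q F (w s)) = ∑ i ∈ F,
        B s (b i) * (inner ℝ w₀ (b i : H) + ∫ r in (0 : ℝ)..s, B r (b i)) := by
      intro s hs
      simp only [hQ, map_sum, map_smul, smul_eq_mul]
      refine Finset.sum_congr rfl fun i _ => ?_
      rw [e1 s hs i, mul_comm]
    have hii : ∀ i, IntervalIntegrable (fun s => B s (b i)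
        * (inner ℝ w₀ (b i : H) + ∫ r in (0 : ℝ)..s, B r (b i))) volume 0 t := by
      intro i
      refine (hBi' i).mul_continuousOn (continuousOn_const.add ?_)
      exact ((hBi' i).absolutelyContinuousOnInterval_intervalIntegral (by simp)).continuousOn
    have e3 : ∀ s ∈ uIcc 0 t, B s (Q F (w s)) = ∑ i ∈ F,
        B s (b i) * (inner ℝ w₀ (b i : H) + ∫ r in (0 : ℝ)..s, B r (b i)) := by
      rwa [uIcc_of_le ht.1]
    refine ⟨(IntervalIntegrable.sum F fun i _ => hii i).congr fun s hs => ?_, ?_⟩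
    · simp only [Finset.sum_apply]
      exact (e3 s (uIoc_subset_uIcc hs)).symm
    rw [intervalIntegral.integral_congr e3, intervalIntegral.integral_finsetSum
      (fun i _ => hii i), hQin, hQin, Finset.mul_sum, ← Finset.sum_add_distrib]
    refine Finset.sum_congr rfl fun i _ => ?_
    rw [e1 t ⟨ht.1, le_rfl⟩ i, integral_primitive_sq (hBi' i)]
  intro t ht
  have hlim : ∀ s ∈ Ioc 0 t, Tendsto (fun F => B s (Q F (w s))) atTop (𝓝 (B s (w s))) :=
    fun s hs => ((B s).continuous.tendsto _).comp
      (hQlim _ (hwS s ⟨hs.1.le, hs.2.trans_lt ht.2⟩))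
  have hbnd : ∀ᵐ s ∂(volume.restrict (Ioc 0 t)), ∀ F, ‖B s (Q F (w s))‖ ≤ g s * M := by
    filter_upwards [ae_mono (Measure.restrict_mono (hsub ht) le_rfl) hBg,
      ae_restrict_mem measurableSet_Ioc] with s hs hst F
    refine ((B s).le_of_opNorm_le hs _).trans ?_
    exact mul_le_mul_of_nonneg_left ((hQn _ _).trans (hwM s ⟨hst.1.le, hst.2.trans_lt ht.2⟩))
      ((norm_nonneg _).trans hs)
  have hlim' : ∀ᵐ s ∂(volume.restrict (Ioc 0 t)),
      Tendsto (fun F => B s (Q F (w s))) atTop (𝓝 (B s (w s))) := by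
    filter_upwards [ae_restrict_mem measurableSet_Ioc] with s hs using hlim s hs
  have hgM : Integrable (fun s => g s * M) (volume.restrict (Ioc 0 t)) :=
    (hg'.mono_set (hsub ht)).mul_const _
  have hmF : ∀ F, AEStronglyMeasurable (fun s => B s (Q F (w s))) (volume.restrict (Ioc 0 t)) :=
    fun F => ((intervalIntegrable_iff_integrableOn_Ioc_of_le ht.1).1 (hfin t ht F).1).1
  refine ⟨(intervalIntegrable_iff_integrableOn_Ioc_of_le ht.1).2 (hgM.mono'
    (aestronglyMeasurable_of_tendsto_ae atTop hmF hlim') ?_), ?_⟩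
  · filter_upwards [hbnd, hlim'] with s h1 h2
    exact le_of_tendsto h2.norm (Eventually.of_forall h1)
  have l1 : Tendsto (fun F => (inner ℝ (Q F (w t)) (w t) : ℝ)) atTop (𝓝 (‖w t‖ ^ 2)) := by
    rw [← real_inner_self_eq_norm_sq]
    exact (hQlim _ (hwS t ht)).inner tendsto_const_nhds
  have l2 : Tendsto (fun F => (inner ℝ (Q F w₀) w₀ : ℝ)) atTop (𝓝 (‖w₀‖ ^ 2)) := by
    rw [← real_inner_self_eq_norm_sq]
    exact (hQlim _ hw₀).inner tendsto_const_nhds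
  have l3 : Tendsto (fun F => ∫ s in (0 : ℝ)..t, B s (Q F (w s))) atTop
      (𝓝 (∫ s in (0 : ℝ)..t, B s (w s))) := by
    simp only [intervalIntegral.integral_of_le ht.1]
    exact tendsto_integral_filter_of_dominated_convergence _ (Eventually.of_forall hmF)
      (Eventually.of_forall fun F => hbnd.mono fun s hs => hs F) hgM hlim'
  exact tendsto_nhds_unique l1 ((l2.add (l3.const_mul 2)).congr fun F => (hfin t ht F).2.symm)

end AbstractEnergy

open scoped ENNReal

noncomputable section

/-! ### Hölder estimates with real-valued norms -/

/-- The `L^p` norm as a real number. -/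
def nrm (p : ℝ≥0∞) (f : Plane → ℝ) : ℝ := (eLpNorm f p volume).toReal

theorem nrm_nonneg (p : ℝ≥0∞) (f : Plane → ℝ) : 0 ≤ nrm p f := ENNReal.toReal_nonneg

theorem nrm_le_of_eLpNorm_le {p : ℝ≥0∞} {f : Plane → ℝ} {C : ℝ≥0} (h : eLpNorm f p volume ≤ C) :
    nrm p f ≤ C := ENNReal.toReal_le_coe_of_le_coe h

theorem nrm_mul_le {p q r : ℝ≥0∞} [p.HolderTriple q r] {f g : Plane → ℝ} (hf : MemLp f p volume)
    (hg : MemLp g q volume) : nrm r (fun x => f x * g x) ≤ nrm p f * nrm q g := by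
  have h := eLpNorm_smul_le_mul_eLpNorm (p := p) (q := q) (r := r) hg.1 hf.1
  have e : (fun x => f x * g x) = f • g := rfl
  simp only [nrm]
  rw [e, ← ENNReal.toReal_mul]
  exact ENNReal.toReal_mono (ENNReal.mul_ne_top hf.2.ne hg.2.ne) h

theorem memLp_mul {p q r : ℝ≥0∞} [p.HolderTriple q r] {f g : Plane → ℝ} (hf : MemLp f p volume)
    (hg : MemLp g q volume) : MemLp (fun x => f x * g x) r volume :=
  MemLp.mul (p := p) (q := q) (r := r) hg hf

theorem integrable_mul {p q : ℝ≥0∞} [p.HolderConjugate q] {f g : Plane → ℝ}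
    (hf : MemLp f p volume) (hg : MemLp g q volume) : Integrable (fun x => f x * g x) :=
  hf.integrable_mul hg

theorem abs_integral_mul_le {p q : ℝ≥0∞} [p.HolderConjugate q] {f g : Plane → ℝ}
    (hf : MemLp f p volume) (hg : MemLp g q volume) :
    |∫ x, f x * g x| ≤ nrm p f * nrm q g := by
  refine le_trans ?_ (nrm_mul_le (p := p) (q := q) (r := 1) hf hg)
  rw [nrm, eLpNorm_one_eq_lintegral_enorm, ← Real.norm_eq_abs]
  refine (norm_integral_le_integral_norm _).trans_eq ?_
  rw [integral_norm_eq_lintegral_enorm (integrable_mul hf hg).1]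

theorem nrm_sub_tendsto_of_eLpNorm {p : ℝ≥0∞} {f : ℕ → Plane → ℝ} {g : Plane → ℝ}
    (h : Tendsto (fun n => eLpNorm (f n - g) p volume) atTop (𝓝 0)) :
    Tendsto (fun n => nrm p (f n - g)) atTop (𝓝 0) := by
  have h2 := (ENNReal.tendsto_toReal ENNReal.zero_ne_top).comp h
  rw [ENNReal.toReal_zero] at h2
  exact h2

theorem tendsto_integral_mul_left {p q : ℝ≥0∞} [p.HolderConjugate q] {f : Plane → ℝ}
    {g : ℕ → Plane → ℝ} {g' : Plane → ℝ} (hf : MemLp f p volume) (hg : ∀ n, MemLp (g n) q volume)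
    (hg' : MemLp g' q volume)
    (h : Tendsto (fun n => eLpNorm (g n - g') q volume) atTop (𝓝 0)) :
    Tendsto (fun n => ∫ x, f x * g n x) atTop (𝓝 (∫ x, f x * g' x)) := by
  rw [tendsto_iff_norm_sub_tendsto_zero]
  refine squeeze_zero (fun _ => norm_nonneg _) (fun n => ?_)
    (by simpa using (nrm_sub_tendsto_of_eLpNorm h).const_mul (nrm p f))
  have := abs_integral_mul_le hf ((hg n).sub hg')
  simp only [Pi.sub_apply, mul_sub] at this
  rwa [integral_sub (integrable_mul hf (hg n)) (integrable_mul hf hg')] at this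

theorem tendsto_integral_mul {p q : ℝ≥0∞} [p.HolderConjugate q] {f g : ℕ → Plane → ℝ}
    {f' g' : Plane → ℝ} {C : ℝ} (hf : ∀ n, MemLp (f n) p volume) (hf' : MemLp f' p volume)
    (hg : ∀ n, MemLp (g n) q volume) (hg' : MemLp g' q volume) (hC : ∀ n, nrm p (f n) ≤ C)
    (h1 : Tendsto (fun n => eLpNorm (f n - f') p volume) atTop (𝓝 0))
    (h2 : Tendsto (fun n => eLpNorm (g n - g') q volume) atTop (𝓝 0)) :
    Tendsto (fun n => ∫ x, f n x * g n x) atTop (𝓝 (∫ x, f' x * g' x)) := by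
  have h0 := ((nrm_sub_tendsto_of_eLpNorm h2).const_mul C).add
    ((nrm_sub_tendsto_of_eLpNorm h1).mul_const (nrm q g'))
  rw [mul_zero, zero_mul, add_zero] at h0
  rw [tendsto_iff_norm_sub_tendsto_zero]
  refine squeeze_zero (fun _ => norm_nonneg _) (fun n => ?_) h0
  have e1 := abs_integral_mul_le (hf n) ((hg n).sub hg')
  have e2 := abs_integral_mul_le ((hf n).sub hf') hg'
  simp only [Pi.sub_apply, mul_sub, sub_mul] at e1 e2
  rw [integral_sub (integrable_mul (hf n) (hg n)) (integrable_mul (hf n) hg')] at e1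
  rw [integral_sub (integrable_mul (hf n) hg') (integrable_mul hf' hg')] at e2
  rw [Real.norm_eq_abs]
  calc _ ≤ |(∫ x, f n x * g n x) - ∫ x, f n x * g' x| + |(∫ x, f n x * g' x) - ∫ x, f' x * g' x| :=
        abs_sub_le _ _ _
    _ ≤ _ := add_le_add (e1.trans (mul_le_mul_of_nonneg_right (hC n) (nrm_nonneg _ _))) e2

theorem nrm_mol_le (n : ℕ) {f : Plane → ℝ} {p : ℝ} (hp : 1 ≤ p)
    (hf : MemLp f (ENNReal.ofReal p) volume) :
    nrm (ENNReal.ofReal p) (mol n f) ≤ nrm (ENNReal.ofReal p) f :=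
  ENNReal.toReal_mono hf.2.ne (eLpNorm_mol_le n hp hf.1)

theorem holderTriple_two_mul {p' : ℝ} (hp' : 0 < p') :
    (ENNReal.ofReal (2 * p')).HolderTriple (ENNReal.ofReal (2 * p')) (ENNReal.ofReal p') := by
  refine Real.HolderTriple.ennrealOfReal ⟨?_, by positivity, by positivity⟩
  field_simp; norm_num

/-! ### Skew symmetry of the drift -/

/-- `v` is weakly divergence free, for a pair of scalar components. -/
def DivFree (v : Fin 2 → Plane → ℝ) : Prop :=
  ∀ χ : Plane → ℝ, ContDiff ℝ ∞ χ → HasCompactSupport χ →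
    ∫ x, ∑ i, v i x * partialDeriv i χ x = 0

/-- Since `2 F v·∇F = v·∇(F²)`, the divergence condition is tested with `cut m * F²`. The error `F²
v·∇(cut m)` is of size `1 / m` in `L¹`, because `v` and `F` are square integrable and `F` is
bounded. -/
theorem integral_sq_mul_grad_eq_zero {v : Fin 2 → Plane → ℝ} (hv : ∀ i, MemLp (v i) 2 volume)
    (hdiv : DivFree v) {F : Plane → ℝ} (hF : ContDiff ℝ ∞ F) {M : ℝ} (hM : ∀ x, |F x| ≤ M)
    (hF2 : MemLp F 2 volume)
    (hi : ∀ i, Integrable fun x => v i x * F x * partialDeriv i F x) :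
    ∫ x, ∑ i, v i x * F x * partialDeriv i F x = 0 := by
  obtain ⟨D, hD0, hD⟩ := exists_cut_fderiv_bound
  have hFd : Differentiable ℝ F := hF.differentiable (by simp)
  have hcd : ∀ m, Differentiable ℝ (cut m) := fun m => (cut_contDiff m).differentiable (by simp)
  have hcut : ∀ m x i, |partialDeriv i (cut m) x| ≤ D * ((m : ℝ) + 1)⁻¹ := fun m x i => by
    refine (ContinuousLinearMap.le_of_opNorm_le _ (hD m x) _).trans_eq ?_
    simp
  have hvF : ∀ i, Integrable fun x => v i x * F x ^ 2 := fun i => by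
    have h1 : Integrable fun x => v i x * F x := integrable_mul (p := 2) (q := 2) (hv i) hF2
    have h2 := h1.mul_bdd (c := M) hF.continuous.aestronglyMeasurable
      (Eventually.of_forall fun x => by rw [Real.norm_eq_abs]; exact hM x)
    refine h2.congr (Eventually.of_forall fun x => ?_)
    simp only; ring
  have hp : ∀ m i x, partialDeriv i (fun y => cut m y * (F y * F y)) x
      = 2 * (cut m x * (F x * partialDeriv i F x)) + F x ^ 2 * partialDeriv i (cut m) x := by
    intro m i x
    rw [partialDeriv_mul (hcd m x) ((hFd x).fun_mul (hFd x)), partialDeriv_mul (hFd x) (hFd x)]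
    ring
  have i1 : ∀ m i, Integrable fun x => cut m x * (v i x * F x * partialDeriv i F x) := fun m i => by
    refine ((hi i).bdd_mul (c := 1) (cut_contDiff m).continuous.aestronglyMeasurable
      (Eventually.of_forall fun x => ?_))
    rw [Real.norm_of_nonneg (cut_nonneg m x)]
    exact cut_le_one m x
  have i2 : ∀ m i, Integrable fun x => v i x * F x ^ 2 * partialDeriv i (cut m) x := fun m i =>
    (hvF i).mul_bdd (c := D * ((m : ℝ) + 1)⁻¹)
      (continuous_partialDeriv ((cut_contDiff m).of_le (by simp)) i).aestronglyMeasurable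
      (Eventually.of_forall fun x => hcut m x i)
  have key : ∀ m, 2 * ∑ i, ∫ x, cut m x * (v i x * F x * partialDeriv i F x)
      = - ∑ i, ∫ x, v i x * F x ^ 2 * partialDeriv i (cut m) x := by
    intro m
    have h := hdiv (fun y => cut m y * (F y * F y)) ((cut_contDiff m).mul (hF.mul hF))
      (cut_compact m).mul_right
    have e : ∀ x, ∑ i, v i x * partialDeriv i (fun y => cut m y * (F y * F y)) x
        = ∑ i, (2 * (cut m x * (v i x * F x * partialDeriv i F x))
          + v i x * F x ^ 2 * partialDeriv i (cut m) x) := fun x =>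
      Finset.sum_congr rfl fun i _ => by rw [hp]; ring
    simp only [e] at h
    have i3 : ∀ i, Integrable fun x => 2 * (cut m x * (v i x * F x * partialDeriv i F x))
        + v i x * F x ^ 2 * partialDeriv i (cut m) x := fun i =>
      ((i1 m i).const_mul 2).add (i2 m i)
    rw [integral_finsetSum _ fun i _ => i3 i] at h
    have e2 : ∀ i, ∫ x, (2 * (cut m x * (v i x * F x * partialDeriv i F x))
          + v i x * F x ^ 2 * partialDeriv i (cut m) x)
        = 2 * (∫ x, cut m x * (v i x * F x * partialDeriv i F x))
          + ∫ x, v i x * F x ^ 2 * partialDeriv i (cut m) x := fun i => by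
      rw [integral_add ((i1 m i).const_mul 2) (i2 m i), integral_const_mul]
    simp only [e2, Finset.sum_add_distrib, ← Finset.mul_sum] at h
    linarith
  have l1 : Tendsto (fun m => 2 * ∑ i, ∫ x, cut m x * (v i x * F x * partialDeriv i F x)) atTop
      (𝓝 (2 * ∑ i, ∫ x, v i x * F x * partialDeriv i F x)) := by
    refine (tendsto_finsetSum _ fun i _ => ?_).const_mul 2
    refine tendsto_integral_of_dominated_convergence
      (fun x => ‖v i x * F x * partialDeriv i F x‖) (fun m => (i1 m i).1) (hi i).norm
      (fun m => Eventually.of_forall fun x => ?_) (Eventually.of_forall fun x => ?_)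
    · rw [norm_mul, Real.norm_of_nonneg (cut_nonneg m x)]
      exact mul_le_of_le_one_left (norm_nonneg _) (cut_le_one m x)
    · simpa using (cut_tendsto x).mul_const (v i x * F x * partialDeriv i F x)
  have l2 : Tendsto (fun m => - ∑ i, ∫ x, v i x * F x ^ 2 * partialDeriv i (cut m) x) atTop
      (𝓝 0) := by
    rw [← neg_zero, ← Finset.sum_const_zero (s := (Finset.univ : Finset (Fin 2)))]
    refine (tendsto_finsetSum _ fun i _ => ?_).neg
    refine squeeze_zero_norm (fun m => ?_)
      (by simpa using (tendsto_const_mul_inv D).mul_const (∫ x, ‖v i x * F x ^ 2‖))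
    rw [← integral_const_mul]
    refine norm_integral_le_of_norm_le ((hvF i).norm.const_mul _) (Eventually.of_forall fun x => ?_)
    rw [norm_mul, mul_comm]
    exact mul_le_mul_of_nonneg_right (hcut m x i) (norm_nonneg _)
  have h0 : 2 * ∑ i, ∫ x, v i x * F x * partialDeriv i F x = 0 :=
    tendsto_nhds_unique l1 (l2.congr fun m => (key m).symm)
  rw [integral_finsetSum _ fun i _ => hi i]
  linarith

/-- The drift term is skew symmetric: `∫ f v·∇f = 0` for divergence free `v`. -/
theorem integral_mul_grad_eq_zero {p p' : ℝ} (hpp : p'.HolderConjugate p)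
    {v : Fin 2 → Plane → ℝ} (hv : ∀ i, MemLp (v i) 2 volume)
    (hvq : ∀ i, MemLp (v i) (ENNReal.ofReal (2 * p')) volume) (hdiv : DivFree v)
    {f : Plane → ℝ} (hf : MemLp f 2 volume) (hfq : MemLp f (ENNReal.ofReal (2 * p')) volume)
    {g : Fin 2 → Plane → ℝ} (hg : ∀ i, IsWeakPartial i f (g i))
    (hgp : ∀ i, MemLp (g i) (ENNReal.ofReal p) volume) :
    ∑ i, ∫ x, v i x * f x * g i x = 0 := by
  have ht := holderTriple_two_mul hpp.pos
  have hc := hpp.ennrealOfReal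
  have hp1 : 1 ≤ p := hpp.symm.lt.le
  have hp1' : 1 ≤ 2 * p' := by linarith [hpp.lt]
  have hfl := locallyIntegrable_of_memLp_two hf
  have hvm : ∀ n i, MemLp (fun x => v i x * mol n f x) (ENNReal.ofReal p') volume := fun n i =>
    memLp_mul (hvq i) (memLp_mol n hp1' hfq)
  -- Only `f` is mollified; `v` stays untouched and so remains divergence free. In the limit `v f`
  -- converges in `L^{p'}` and the gradient in `L^p`.
  have hn : ∀ n, ∑ i, ∫ x, v i x * mol n f x * mol n (g i) x = 0 := by
    intro n
    have hi : ∀ i, Integrable fun x => v i x * mol n f x * mol n (g i) x := fun i =>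
      integrable_mul (hvm n i) (memLp_mol n hp1 (hgp i))
    have h := integral_sq_mul_grad_eq_zero hv hdiv (contDiff_mol n hfl)
      (conv_bounded (rho_continuous n) (rho_compact n) hf) (memLp_mol_two n hf)
      (fun i => by rw [(hg i).partialDeriv_mol n]; exact hi i)
    simp only [fun i => (hg i).partialDeriv_mol n] at h
    rwa [integral_finsetSum _ fun i _ => hi i] at h
  suffices hl : ∀ i, Tendsto (fun n => ∫ x, v i x * mol n f x * mol n (g i) x) atTop
      (𝓝 (∫ x, v i x * f x * g i x)) from
    tendsto_nhds_unique (tendsto_finsetSum _ fun i _ => hl i)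
      (tendsto_const_nhds.congr fun n => (hn n).symm)
  intro i
  refine tendsto_integral_mul (C := nrm (ENNReal.ofReal (2 * p')) (v i)
    * nrm (ENNReal.ofReal (2 * p')) f) (fun n => hvm n i) (memLp_mul (hvq i) hfq)
    (fun n => memLp_mol n hp1 (hgp i)) (hgp i) (fun n => ?_) ?_
    (eLpNorm_mol_sub_tendsto hp1 (hgp i))
  · refine (nrm_mul_le (hvq i) (memLp_mol n hp1' hfq)).trans ?_
    exact mul_le_mul_of_nonneg_left (nrm_mol_le n hp1' hfq) (nrm_nonneg _ _)
  · have h0 := ENNReal.Tendsto.const_mul (a := eLpNorm (v i) (ENNReal.ofReal (2 * p')) volume)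
      (eLpNorm_mol_sub_tendsto hp1' hfq) (Or.inr (hvq i).2.ne)
    rw [mul_zero] at h0
    refine tendsto_of_tendsto_of_tendsto_of_le_of_le tendsto_const_nhds h0 (fun _ => zero_le)
      fun n => ?_
    have e : ((fun x => v i x * mol n f x) - fun x => v i x * f x) = v i • (mol n f - f) := by
      funext x; simp [mul_sub]
    simp only [e]
    exact eLpNorm_smul_le_mul_eLpNorm ((memLp_mol n hp1' hfq).sub hfq).1 (hvq i).1

/-! ### Density of rotated gradients among divergence-free fields -/

instance : SecondCountableTopology ScalL2 :=
  haveI : Fact ((2 : ℝ≥0∞) ≠ ⊤) := ⟨by norm_num⟩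
  Lp.SecondCountableTopology

/-- Pairs of square integrable functions, as a Hilbert space. -/
abbrev VelL2 := PiLp 2 (fun _ : Fin 2 => ScalL2)

instance : SecondCountableTopology VelL2 :=
  (PiLp.homeomorph 2 (fun _ : Fin 2 => ScalL2)).secondCountableTopology

/-- The element of `VelL2` with given components. -/
def toVel {f : Fin 2 → Plane → ℝ} (hf : ∀ i, MemLp (f i) 2 volume) : VelL2 :=
  WithLp.toLp 2 fun i => (hf i).toLp (f i)

theorem toVel_coe {f : Fin 2 → Plane → ℝ} (hf : ∀ i, MemLp (f i) 2 volume) (i : Fin 2) :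
    toVel hf i =ᵐ[volume] f i := (hf i).coeFn_toLp

theorem inner_velL2 (v w : VelL2) : inner ℝ v w = ∑ i, ∫ x, v i x * w i x := by
  rw [PiLp.inner_apply]
  exact Finset.sum_congr rfl fun i _ => inner_scalL2 _ _

theorem inner_toVel (v : VelL2) {f : Fin 2 → Plane → ℝ} (hf : ∀ i, MemLp (f i) 2 volume) :
    inner ℝ v (toVel hf) = ∑ i, ∫ x, v i x * f i x := by
  rw [inner_velL2]
  refine Finset.sum_congr rfl fun i _ => integral_congr_ae ?_
  filter_upwards [toVel_coe hf i] with x hx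
  rw [hx]

theorem memLp_two_of_compact {f : Plane → ℝ} (hf : Continuous f) (hc : HasCompactSupport f) :
    MemLp f 2 volume := hf.memLp_of_hasCompactSupport hc

theorem memLp_partialDeriv {χ : Plane → ℝ} (hχ : ContDiff ℝ ∞ χ) (hc : HasCompactSupport χ)
    (i : Fin 2) : MemLp (partialDeriv i χ) 2 volume :=
  memLp_two_of_compact (continuous_partialDeriv (hχ.of_le (by simp)) i)
    (hasCompactSupport_partialDeriv hc i)

/-- The rotated gradient `(-∂₂χ, ∂₁χ)`. -/
def perp (χ : Plane → ℝ) : Fin 2 → Plane → ℝ :=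
  ![fun x => - partialDeriv 1 χ x, partialDeriv 0 χ]

theorem memLp_perp {χ : Plane → ℝ} (hχ : ContDiff ℝ ∞ χ) (hc : HasCompactSupport χ)
    (i : Fin 2) : MemLp (perp χ i) 2 volume := by
  fin_cases i
  · exact (memLp_partialDeriv hχ hc 1).neg
  · exact memLp_partialDeriv hχ hc 0

/-- Rotated gradients of test functions. -/
def perpSet : Set VelL2 :=
  {e | ∃ (χ : Plane → ℝ) (hχ : ContDiff ℝ ∞ χ) (hc : HasCompactSupport χ),
    e = toVel (memLp_perp hχ hc)}

theorem partialDeriv_comm {χ : Plane → ℝ} (hχ : ContDiff ℝ ∞ χ) (i j : Fin 2) (x : Plane) :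
    partialDeriv i (partialDeriv j χ) x = partialDeriv j (partialDeriv i χ) x := by
  have h2 : IsSymmSndFDerivAt ℝ χ x :=
    hχ.contDiffAt.isSymmSndFDerivAt (by
      simpa using WithTop.coe_le_coe.2 (le_top : (2 : ℕ∞) ≤ ⊤))
  have hd : DifferentiableAt ℝ (fderiv ℝ χ) x :=
    (hχ.fderiv_right (m := ∞) (by simp)).differentiable (by simp) x
  have e : ∀ a b : Fin 2, partialDeriv a (partialDeriv b χ) x
      = fderiv ℝ (fderiv ℝ χ) x (EuclideanSpace.single a 1) (EuclideanSpace.single b 1) := by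
    intro a b
    have h3 : HasFDerivAt (partialDeriv b χ) _ x :=
      hd.hasFDerivAt.clm_apply (hasFDerivAt_const (EuclideanSpace.single b (1 : ℝ)) x)
    rw [partialDeriv, h3.fderiv]
    simp
  rw [e, e, h2]

theorem divFree_iff_inner (v : VelL2) : DivFree (fun i => v i) ↔
    ∀ (χ : Plane → ℝ) (hχ : ContDiff ℝ ∞ χ) (hc : HasCompactSupport χ),
      inner ℝ v (toVel (memLp_partialDeriv hχ hc)) = 0 := by
  refine forall_congr' fun χ => forall_congr' fun hχ => forall_congr' fun hc => ?_
  rw [inner_toVel, integral_finsetSum _ fun i _ =>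
    integrable_mul (p := 2) (q := 2) (Lp.memLp (v i)) (memLp_partialDeriv hχ hc i)]

theorem divFree_perp {χ : Plane → ℝ} (hχ : ContDiff ℝ ∞ χ) (hc : HasCompactSupport χ) :
    DivFree (perp χ) := by
  intro ξ hξ hξc
  have h : ∀ a b : Fin 2, ∫ x, partialDeriv a χ x * partialDeriv b ξ x
      = - ∫ x, χ x * partialDeriv a (partialDeriv b ξ) x := fun a b => by
    have := (isWeakPartial_of_contDiff (hχ.of_le (by simp)) a).2.2 (partialDeriv b ξ)
      (contDiff_partialDeriv hξ b) (hasCompactSupport_partialDeriv hξc b)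
    linarith
  have hi : ∀ a b : Fin 2, Integrable fun x => partialDeriv a χ x * partialDeriv b ξ x :=
    fun a b => integrable_mul (p := 2) (q := 2) (memLp_partialDeriv hχ hc a)
      (memLp_partialDeriv hξ hξc b)
  simp only [perp, Fin.sum_univ_two, Matrix.cons_val_zero, Matrix.cons_val_one, neg_mul]
  have e := integral_add (hi 1 0).neg (hi 0 1)
  simp only [Pi.neg_apply, integral_neg] at e
  rw [e, h, h]
  simp only [partialDeriv_comm hξ 1 0]
  ring

theorem divFree_of_mem_closure_span {v : VelL2}
    (hv : v ∈ (Submodule.span ℝ perpSet).topologicalClosure) : DivFree (fun i => v i) := by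
  rw [divFree_iff_inner]
  intro χ hχ hc
  rw [real_inner_comm]
  set L : VelL2 →L[ℝ] ℝ := innerSL ℝ (toVel (memLp_partialDeriv hχ hc)) with hL
  have h : (Submodule.span ℝ perpSet).topologicalClosure ≤ LinearMap.ker (L : VelL2 →ₗ[ℝ] ℝ) := by
    refine Submodule.topologicalClosure_minimal _ (Submodule.span_le.2 ?_)
      (ContinuousLinearMap.isClosed_ker L)
    rintro e ⟨ξ, hξ, hξc, rfl⟩
    have h1 := divFree_perp hξ hξc χ hχ hc
    rw [integral_finsetSum _ fun i _ => integrable_mul (p := 2) (q := 2) (memLp_perp hξ hξc i)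
      (memLp_partialDeriv hχ hc i)] at h1
    simp only [SetLike.mem_coe, LinearMap.mem_ker, ContinuousLinearMap.coe_coe, hL,
      innerSL_apply_apply]
    rw [inner_toVel, ← h1]
    refine Finset.sum_congr rfl fun i _ => integral_congr_ae ?_
    filter_upwards [toVel_coe (memLp_partialDeriv hχ hc) i] with x hx
    rw [hx, mul_comm]
  exact h hv

/-- The weak condition is tested with the mollifier centred at `x`, which yields the classical
divergence at that point. -/
theorem conv_eq_zero_of_divFree {v : Fin 2 → Plane → ℝ} (hv : ∀ i, MemLp (v i) 2 volume)
    (hdiv : DivFree v) (n : ℕ) (x : Plane) : ∑ i, partialDeriv i (mol n (v i)) x = 0 := by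
  have hr : ContDiff ℝ 1 (rho n) := (rho_contDiff n).of_le (by simp)
  have hcx : HasCompactSupport (fun z => rho n (x - z)) :=
    (rho_compact n).comp_homeomorph (Homeomorph.subLeft x)
  have hsm : ContDiff ℝ ∞ (fun z => rho n (x - z)) :=
    (rho_contDiff n).comp (contDiff_const.sub contDiff_id)
  have h := hdiv (fun z => rho n (x - z)) hsm hcx
  rw [integral_finsetSum _ fun i _ => integrable_mul (p := 2) (q := 2) (hv i)
    (memLp_partialDeriv hsm hcx i)] at h
  simp only [partialDeriv_comp_const_sub hr, mul_neg, integral_neg, Finset.sum_neg_distrib,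
    neg_eq_zero] at h
  rw [← h]
  refine Finset.sum_congr rfl fun i _ => ?_
  rw [mol, partialDeriv_conv hr (rho_compact n) (locallyIntegrable_of_memLp_two (hv i)),
    conv_apply_swap]
  simp only [mul_comm]

/-- The identification of the complex plane with the real plane. -/
def ofComplex : ℂ →L[ℝ] Plane :=
  Complex.reCLM.smulRight (EuclideanSpace.single 0 1)
    + Complex.imCLM.smulRight (EuclideanSpace.single 1 1)

theorem ofComplex_surjective (x : Plane) : ofComplex ⟨x 0, x 1⟩ = x := by
  ext i
  fin_cases i <;> simp [ofComplex]

/-- Bounded solutions of the Cauchy–Riemann equations on the plane are constant. -/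
theorem eq_of_cauchyRiemann {a b : Plane → ℝ} (ha : Differentiable ℝ a) (hb : Differentiable ℝ b)
    {A B : ℝ} (hA : ∀ x, |a x| ≤ A) (hB : ∀ x, |b x| ≤ B)
    (h1 : ∀ x, partialDeriv 0 a x = partialDeriv 1 b x)
    (h2 : ∀ x, partialDeriv 1 a x = - partialDeriv 0 b x) (x y : Plane) :
    a x = a y ∧ b x = b y := by
  -- The two equations are the Cauchy–Riemann equations for `a + i b`, a bounded entire function, so
  -- Liouville's theorem applies.
  set F : ℂ → ℂ := fun z => (a (ofComplex z) : ℂ) + Complex.I * (b (ofComplex z) : ℂ) with hF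
  have hd : ∀ z, HasFDerivAt F
      (Complex.ofRealCLM.comp ((fderiv ℝ a (ofComplex z)).comp ofComplex)
        + Complex.I • Complex.ofRealCLM.comp ((fderiv ℝ b (ofComplex z)).comp ofComplex)) z := by
    intro z
    have e1 : HasFDerivAt (fun z => (a (ofComplex z) : ℂ)) _ z :=
      Complex.ofRealCLM.hasFDerivAt.comp z ((ha _).hasFDerivAt.comp z ofComplex.hasFDerivAt)
    have e2 : HasFDerivAt (fun z => (b (ofComplex z) : ℂ)) _ z :=
      Complex.ofRealCLM.hasFDerivAt.comp z ((hb _).hasFDerivAt.comp z ofComplex.hasFDerivAt)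
    exact e1.add (e2.const_mul Complex.I)
  have hdiff : Differentiable ℂ F := by
    intro z
    rw [differentiableAt_complex_iff_differentiableAt_real]
    refine ⟨(hd z).differentiableAt, ?_⟩
    rw [(hd z).fderiv]
    have k1 := h1 (ofComplex z)
    have k2 := h2 (ofComplex z)
    simp only [partialDeriv] at k1 k2
    simp only [ofComplex, _root_.add_apply, ContinuousLinearMap.comp_apply,
      _root_.smul_apply, ContinuousLinearMap.smulRight_apply, Complex.reCLM_apply,
      Complex.imCLM_apply, Complex.I_re, Complex.I_im, Complex.one_re, Complex.one_im, zero_smul,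
      one_smul, zero_add, add_zero, Complex.ofRealCLM_apply, smul_eq_mul] at k1 k2 ⊢
    rw [k1, k2, mul_add, ← mul_assoc, Complex.I_mul_I]
    push_cast
    ring
  have hbd : Bornology.IsBounded (range F) := by
    rw [isBounded_iff_forall_norm_le]
    refine ⟨A + B, ?_⟩
    rintro _ ⟨z, rfl⟩
    refine (norm_add_le _ _).trans ?_
    rw [norm_mul, Complex.norm_I, one_mul, Complex.norm_real, Complex.norm_real]
    exact add_le_add (hA _) (hB _)
  have h := hdiff.apply_eq_apply_of_bounded hbd ⟨x 0, x 1⟩ ⟨y 0, y 1⟩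
  simp only [hF, ofComplex_surjective] at h
  constructor
  · simpa using congrArg Complex.re h
  · simpa using congrArg Complex.im h

theorem eq_zero_of_const_memLp {f : Plane → ℝ} (hf : MemLp f 2 volume) (h : ∀ x y, f x = f y) :
    f = 0 := by
  have e : f = fun _ => f 0 := funext fun x => h x 0
  rw [e, memLp_const_iff (by norm_num) (by norm_num)] at hf
  rcases hf with h0 | h0
  · rw [e, h0]; rfl
  · simp at h0

/-- Rotated gradients of test functions are dense in the divergence free fields in `L²`. -/
theorem mem_closure_span_of_divFree {v : VelL2} (hv : DivFree (fun i => v i)) :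
    v ∈ (Submodule.span ℝ perpSet).topologicalClosure := by
  set K := (Submodule.span ℝ perpSet).topologicalClosure with hK
  have : CompleteSpace K := (Submodule.isClosed_topologicalClosure _).completeSpace_coe
  -- The component `z` orthogonal to the rotated gradients has to vanish. It is divergence free
  -- because both the field and its projection are.
  obtain ⟨y, hy, z, hz, rfl⟩ := K.exists_add_mem_mem_orthogonal v
  suffices h0 : z = 0 by rw [h0, add_zero]; exact hy
  have hzdiv : DivFree (fun i => z i) := by
    have hyd := divFree_of_mem_closure_span hy
    rw [divFree_iff_inner] at hv hyd ⊢
    intro χ hχ hc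
    have := hv χ hχ hc
    rw [inner_add_left, hyd χ hχ hc, zero_add] at this
    exact this
  have hzm : ∀ i, MemLp (z i) 2 volume := fun i => Lp.memLp (z i)
  -- Orthogonality to rotated gradients says that the rotated field `(z₁, -z₀)` is divergence free,
  -- that is, `z` has no curl.
  have hzcurl : DivFree (![z 1, -z 0] : Fin 2 → Plane → ℝ) := by
    intro χ hχ hc
    have h1 := hz (toVel (memLp_perp hχ hc)) (Submodule.le_topologicalClosure _
      (Submodule.subset_span ⟨χ, hχ, hc, rfl⟩))
    rw [real_inner_comm, inner_toVel, Fin.sum_univ_two] at h1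
    simp only [perp, Matrix.cons_val_zero, Matrix.cons_val_one, mul_neg, integral_neg] at h1
    have hi : ∀ i j, Integrable fun x => z i x * partialDeriv j χ x := fun i j =>
      integrable_mul (p := 2) (q := 2) (hzm i) (memLp_partialDeriv hχ hc j)
    simp only [Fin.sum_univ_two, Matrix.cons_val_zero, Matrix.cons_val_one, Pi.neg_apply, neg_mul]
    have e := integral_add (hi 1 0) (hi 0 1).neg
    simp only [Pi.neg_apply, integral_neg] at e
    rw [e]
    linarith
  have hcm : ∀ i, MemLp ((![z 1, -z 0] : Fin 2 → Plane → ℝ) i) 2 volume := by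
    intro i
    fin_cases i
    · exact hzm 1
    · exact (hzm 0).neg
  -- Without divergence and curl, the mollified pair `(z₁, z₀)` solves the Cauchy–Riemann equations
  -- and is bounded, hence constant; a square integrable constant on the plane is zero.
  have hmol : ∀ n i, mol n (z i) = 0 := by
    intro n
    have hneg : mol n (-(z 0 : Plane → ℝ)) = - mol n (z 0) := by
      have := conv_const_smul (rho n) (z 0) (-1)
      simpa [mol] using this
    have d1 := conv_eq_zero_of_divFree hzm hzdiv n
    have d2 := conv_eq_zero_of_divFree hcm hzcurl n
    simp only [Fin.sum_univ_two, Matrix.cons_val_zero, Matrix.cons_val_one] at d1 d2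
    rw [hneg] at d2
    have hsm : ∀ i, Differentiable ℝ (mol n (z i)) := fun i =>
      (contDiff_mol n (locallyIntegrable_of_memLp_two (hzm i))).differentiable (by simp)
    have hpn : ∀ i x, partialDeriv i (-mol n (z 0)) x = - partialDeriv i (mol n (z 0)) x := by
      intro i x
      simp [partialDeriv, fderiv_neg]
    have h := eq_of_cauchyRiemann (a := mol n (z 1)) (b := mol n (z 0)) (hsm 1) (hsm 0)
      (conv_bounded (rho_continuous n) (rho_compact n) (hzm 1))
      (conv_bounded (rho_continuous n) (rho_compact n) (hzm 0))
      (fun x => by have := d2 x; rw [hpn] at this; linarith)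
      (fun x => by have := d1 x; linarith)
    intro i
    fin_cases i
    · exact eq_zero_of_const_memLp (memLp_mol_two n (hzm 0)) fun x y => (h x y).2
    · exact eq_zero_of_const_memLp (memLp_mol_two n (hzm 1)) fun x y => (h x y).1
  ext i : 1
  have h1 : ∀ n, molL2 n (z i) = 0 := fun n => by
    refine Lp.ext ?_
    filter_upwards [molL2_coe n (z i), Lp.coeFn_zero ℝ 2 (volume : Measure Plane)] with x h1 h2
    rw [h1, h2, hmol n i]
  have h2 := molL2_tendsto (z i)
  simp only [h1] at h2
  exact (tendsto_nhds_unique tendsto_const_nhds h2).symm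

/-- Fatou below, contractivity above. The function is only locally integrable and both sides may be
infinite, so this can be used before the norm is known to be finite. -/
theorem tendsto_eLpNorm_mol {f : Plane → ℝ} (hf : LocallyIntegrable f) :
    Tendsto (fun n => eLpNorm (mol n f) 2 volume) atTop (𝓝 (eLpNorm f 2 volume)) := by
  have hle : ∀ n, eLpNorm (mol n f) 2 volume ≤ eLpNorm f 2 volume := fun n => by
    simpa using eLpNorm_mol_le n (p := 2) (by norm_num) hf.aestronglyMeasurable
  refine tendsto_of_le_liminf_of_limsup_le ?_ ?_
  · exact Lp.eLpNorm_lim_le_liminf_eLpNorm (fun n => (continuous_mol n hf).aestronglyMeasurable) f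
      (mol_tendsto_ae hf)
  · exact (limsup_le_limsup (Eventually.of_forall hle)).trans_eq tendsto_const_nhds.limsup_eq

/-! ### Measurability in time -/

section Measurability

variable {α : Type*} [MeasurableSpace α] {μ : Measure α}

/-- Convolution with the partial derivative of a mollifier. -/
def dmolL2 (n : ℕ) (k : Fin 2) : ScalL2 →L[ℝ] ScalL2 :=
  convL2 (partialDeriv k (rho n)) (continuous_partialDeriv ((rho_contDiff n).of_le (by simp)) k)
    (hasCompactSupport_partialDeriv (rho_compact n) k)

theorem dmolL2_coe (n : ℕ) (k : Fin 2) (f : ScalL2) :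
    dmolL2 n k f =ᵐ[volume] conv (partialDeriv k (rho n)) f := convL2_coe _ _ f

theorem dmolL2_coe_of_isWeakPartial (n : ℕ) {k : Fin 2} {f : ScalL2} {g : Plane → ℝ}
    (h : IsWeakPartial k f g) : dmolL2 n k f =ᵐ[volume] mol n g := by
  rw [mol, ← h.conv_partialDeriv (rho_contDiff n) (rho_compact n)]
  exact dmolL2_coe n k f

/-- The weak derivative is chosen separately at each time, so nothing is known of its joint
measurability. Its norm is still a limit of norms of continuous operators applied to `a`. -/
theorem aemeasurable_eLpNorm_weakPartial {k : Fin 2} {a : α → ScalL2} {g : α → Plane → ℝ}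
    (ha : AEStronglyMeasurable a μ) (h : ∀ᵐ s ∂μ, IsWeakPartial k (a s) (g s)) :
    AEMeasurable (fun s => eLpNorm (g s) 2 volume) μ := by
  refine aemeasurable_of_tendsto_metrizable_ae' (f := fun n s => ‖dmolL2 n k (a s)‖ₑ)
    (fun n => ((dmolL2 n k).continuous.comp_aestronglyMeasurable ha).enorm) ?_
  filter_upwards [h] with s hs
  refine (tendsto_eLpNorm_mol hs.2.1).congr fun n => ?_
  rw [Lp.enorm_def]
  exact (eLpNorm_congr_ae (dmolL2_coe_of_isWeakPartial n hs)).symm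

theorem aestronglyMeasurable_integral_mul {a : α → ScalL2} (ha : AEStronglyMeasurable a μ)
    {φ : Plane → ℝ} (hφ : MemLp φ 2 volume) :
    AEStronglyMeasurable (fun s => ∫ x, a s x * φ x) μ := by
  refine (ha.inner (𝕜 := ℝ) (aestronglyMeasurable_const (b := hφ.toLp φ))).congr
    (Eventually.of_forall fun s => ?_)
  simp only
  rw [inner_scalL2]
  refine integral_congr_ae ?_
  filter_upwards [hφ.coeFn_toLp] with x hx
  rw [hx]

theorem aestronglyMeasurable_integral_mul_mul {a b : α → ScalL2} (ha : AEStronglyMeasurable a μ)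
    (hb : AEStronglyMeasurable b μ) {φ : Plane → ℝ} (hφ : Continuous φ) {C : ℝ}
    (hC : ∀ x, ‖φ x‖ ≤ C) :
    AEStronglyMeasurable (fun s => ∫ x, a s x * b s x * φ x) μ := by
  obtain ⟨M, hM⟩ := exists_mulL2 hφ hC
  refine (ha.inner (𝕜 := ℝ) (M.continuous.comp_aestronglyMeasurable hb)).congr
    (Eventually.of_forall fun s => ?_)
  simp only
  rw [inner_scalL2]
  refine integral_congr_ae ?_
  filter_upwards [hM (b s)] with x hx
  rw [hx]; ring

/-- The derivative is moved onto the smooth test function, where measurability is inherited from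
`a`. -/
theorem aestronglyMeasurable_integral_weakPartial_mul {k : Fin 2} {a : α → ScalL2}
    {g : α → Plane → ℝ} (ha : AEStronglyMeasurable a μ)
    (h : ∀ᵐ s ∂μ, IsWeakPartial k (a s) (g s)) {φ : Plane → ℝ} (hφ : ContDiff ℝ ∞ φ)
    (hc : HasCompactSupport φ) : AEStronglyMeasurable (fun s => ∫ x, g s x * φ x) μ := by
  refine (aestronglyMeasurable_integral_mul ha (memLp_partialDeriv hφ hc k)).neg.congr ?_
  filter_upwards [h] with s hs
  rw [Pi.neg_apply, hs.2.2 φ hφ hc, neg_neg]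

/-- With a rough factor `b` the derivative cannot simply be moved onto the test function. It is
replaced by its mollification, an operator applied to `a`, and recovered as a limit in `L^p`. -/
theorem aestronglyMeasurable_integral_weakPartial_mul_mul {p p' : ℝ}
    (hpp : p'.HolderConjugate p) {k : Fin 2} {a b : α → ScalL2}
    {g : α → Plane → ℝ} (ha : AEStronglyMeasurable a μ) (hb : AEStronglyMeasurable b μ)
    (h : ∀ᵐ s ∂μ, IsWeakPartial k (a s) (g s))
    (hg : ∀ᵐ s ∂μ, MemLp (g s) (ENNReal.ofReal p) volume)
    (hbq : ∀ᵐ s ∂μ, MemLp (b s) (ENNReal.ofReal (2 * p')) volume)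
    {φ : Plane → ℝ} (hφ : Continuous φ) (hc : HasCompactSupport φ) :
    AEStronglyMeasurable (fun s => ∫ x, g s x * b s x * φ x) μ := by
  have ht := holderTriple_two_mul hpp.pos
  have hconj := hpp.ennrealOfReal
  obtain ⟨C, hC⟩ := hφ.bounded_above_of_compact_support hc
  refine aestronglyMeasurable_of_tendsto_ae atTop
    (f := fun n s => ∫ x, dmolL2 n k (a s) x * b s x * φ x)
    (fun n => aestronglyMeasurable_integral_mul_mul
      ((dmolL2 n k).continuous.comp_aestronglyMeasurable ha) hb hφ hC) ?_
  filter_upwards [h, hg, hbq] with s h1 h2 h3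
  have hp1 : 1 ≤ p := hpp.symm.lt.le
  have h4 : MemLp (fun x => b s x * φ x) (ENNReal.ofReal p') volume :=
    memLp_mul (p := ENNReal.ofReal (2 * p')) (q := ENNReal.ofReal (2 * p')) h3
      (hφ.memLp_of_hasCompactSupport hc)
  have h5 := tendsto_integral_mul_left h4 (fun n => memLp_mol n hp1 h2) h2
    (eLpNorm_mol_sub_tendsto hp1 h2)
  have e : ∫ x, g s x * b s x * φ x = ∫ x, b s x * φ x * g s x := by
    congr 1; funext x; ring
  rw [e]
  refine h5.congr fun n => integral_congr_ae ?_
  filter_upwards [dmolL2_coe_of_isWeakPartial n h1] with x hx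
  rw [hx]; ring

end Measurability

/-! ### Integrability class and bounds at almost every time -/

/-- The integrability class of weak solutions, in components: velocity `U`, velocity gradient `D`,
stress `A` and stress gradient `G`. -/
structure EnergyClass (T p : ℝ) (U : Fin 2 → ℝ → ScalL2) (D : Fin 2 → Fin 2 → ℝ → Plane → ℝ)
    (A : Fin 2 → Fin 2 → ℝ → ScalL2) (G : Fin 2 → Fin 2 → Fin 2 → ℝ → Plane → ℝ) : Prop where
  U_meas : ∀ i, AEStronglyMeasurable (U i) (volume.restrict (Ioc 0 T))
  U_bdd : ∃ C : ℝ≥0, ∀ᵐ s ∂(volume.restrict (Ioc 0 T)), ∀ i, eLpNorm (U i s) 2 volume ≤ C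
  D_weak : ∀ᵐ s ∂(volume.restrict (Ioc 0 T)), ∀ i j, IsWeakPartial j (U i s) (D i j s)
  D_bdd : ∃ C : ℝ≥0, ∀ᵐ s ∂(volume.restrict (Ioc 0 T)), ∀ i j,
    eLpNorm (D i j s) (ENNReal.ofReal p) volume ≤ C
  U_div : ∀ᵐ s ∂(volume.restrict (Ioc 0 T)), DivFree (fun i => U i s)
  A_meas : ∀ i j, AEStronglyMeasurable (A i j) (volume.restrict (Ioc 0 T))
  A_bdd : ∃ C : ℝ≥0, ∀ᵐ s ∂(volume.restrict (Ioc 0 T)), ∀ i j, eLpNorm (A i j s) 2 volume ≤ C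
  G_weak : ∀ᵐ s ∂(volume.restrict (Ioc 0 T)), ∀ i j k, IsWeakPartial k (A i j s) (G i j k s)
  G_sq : ∫⁻ s in Ioc 0 T, ∑ i, ∑ j, ∑ k, eLpNorm (G i j k s) 2 volume ^ 2 < ⊤

/-- The bounds available at almost every time, where `N` bounds the `L²` norm of the stress
gradient. -/
structure GoodSlice (p p' C N : ℝ) (U : Fin 2 → ScalL2) (D : Fin 2 → Fin 2 → Plane → ℝ)
    (A : Fin 2 → Fin 2 → ScalL2) (G : Fin 2 → Fin 2 → Fin 2 → Plane → ℝ) : Prop where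
  D_weak : ∀ i j, IsWeakPartial j (U i) (D i j)
  div : DivFree (fun i => U i)
  G_weak : ∀ i j k, IsWeakPartial k (A i j) (G i j k)
  U_two : ∀ i, nrm 2 (U i) ≤ C
  U_four : ∀ i, MemLp (U i) (ENNReal.ofReal (2 * 2)) volume
  U_four_le : ∀ i, nrm (ENNReal.ofReal (2 * 2)) (U i) ≤ C
  U_q : ∀ i, MemLp (U i) (ENNReal.ofReal (2 * p')) volume
  U_q_le : ∀ i, nrm (ENNReal.ofReal (2 * p')) (U i) ≤ C
  D_p : ∀ i j, MemLp (D i j) (ENNReal.ofReal p) volume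
  D_p_le : ∀ i j, nrm (ENNReal.ofReal p) (D i j) ≤ C
  A_two : ∀ i j, nrm 2 (A i j) ≤ C
  A_four : ∀ i j, MemLp (A i j) (ENNReal.ofReal (2 * 2)) volume
  A_four_le : ∀ i j, nrm (ENNReal.ofReal (2 * 2)) (A i j) ≤ C * (1 + N)
  A_q : ∀ i j, MemLp (A i j) (ENNReal.ofReal (2 * p')) volume
  A_q_le : ∀ i j, nrm (ENNReal.ofReal (2 * p')) (A i j) ≤ C * (1 + N)
  G_two : ∀ i j k, MemLp (G i j k) 2 volume
  G_two_le : ∀ i j k, nrm 2 (G i j k) ≤ N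

/-- The threshold `3/2` in dual form: `2p' < 6`, so the `L^{2p'}` norm of the stress is covered by
the embedding in `L⁶`. -/
theorem conj_lt_three {p p' : ℝ} (hpp : p'.HolderConjugate p) (hp : 3 / 2 < p) : p' < 3 := by
  have h := hpp.inv_add_inv_eq_one
  have h1 := hpp.pos
  have h2 := hpp.symm.pos
  field_simp at h
  nlinarith

/-- The velocity norms are bounded uniformly in time by the `W^{1,p}` embedding. The higher stress
norms are only affine in `N`, the sum of the `L²` norms of all components of the stress gradient,
through the `H¹` embedding. -/
theorem EnergyClass.exists_goodSlice {T p p' : ℝ} (hpp : p'.HolderConjugate p) (hp : 3 / 2 < p)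
    {U : Fin 2 → ℝ → ScalL2} {D : Fin 2 → Fin 2 → ℝ → Plane → ℝ}
    {A : Fin 2 → Fin 2 → ℝ → ScalL2} {G : Fin 2 → Fin 2 → Fin 2 → ℝ → Plane → ℝ}
    (h : EnergyClass T p U D A G) :
    ∃ (C : ℝ) (N : ℝ → ℝ), 0 ≤ C ∧ (∀ s, 0 ≤ N s) ∧ IntegrableOn N (Ioc 0 T) ∧
      IntegrableOn (fun s => N s ^ 2) (Ioc 0 T) ∧
      ∀ᵐ s ∂(volume.restrict (Ioc 0 T)), GoodSlice p p' C (N s) (fun i => U i s)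
        (fun i j => D i j s) (fun i j => A i j s) (fun i j k => G i j k s) := by
  have hp'3 := conj_lt_three hpp hp
  have hp'1 := hpp.lt
  obtain ⟨CU, hCU⟩ := h.U_bdd
  obtain ⟨CD, hCD⟩ := h.D_bdd
  obtain ⟨CA, hCA⟩ := h.A_bdd
  obtain ⟨C4, hC4⟩ := exists_eLpNorm_le_of_W1p hpp hp (q := 2 * 2) (by norm_num)
    ((by norm_num : (2 * 2 : ℝ) ≤ 4).trans (le_max_left _ _)) CU CD
  obtain ⟨Cq, hCq⟩ := exists_eLpNorm_le_of_W1p hpp hp (q := 2 * p') (by linarith)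
    (le_max_right _ _) CU CD
  obtain ⟨H4, hH4⟩ := exists_eLpNorm_le_of_H1 (q := 2 * 2) (by norm_num) (by norm_num)
  obtain ⟨Hq, hHq⟩ := exists_eLpNorm_le_of_H1 (q := 2 * p') (by linarith) (by linarith)
  set N : ℝ → ℝ := fun s => ∑ i, ∑ j, ∑ k, nrm 2 (G i j k s) with hN
  have hN0 : ∀ s, 0 ≤ N s := fun s => Finset.sum_nonneg fun i _ => Finset.sum_nonneg fun j _ =>
    Finset.sum_nonneg fun k _ => nrm_nonneg _ _
  have hGm : ∀ i j k, AEMeasurable (fun s => eLpNorm (G i j k s) 2 volume)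
      (volume.restrict (Ioc 0 T)) := fun i j k =>
    aemeasurable_eLpNorm_weakPartial (h.A_meas i j) (h.G_weak.mono fun s hs => hs i j k)
  have hNm : AEStronglyMeasurable N (volume.restrict (Ioc 0 T)) :=
    (Finset.aemeasurable_fun_sum _ fun i _ => Finset.aemeasurable_fun_sum _ fun j _ =>
      Finset.aemeasurable_fun_sum _ fun k _ => (hGm i j k).ennreal_toReal).aestronglyMeasurable
  have hSm : AEMeasurable (fun s => ∑ i, ∑ j, ∑ k, eLpNorm (G i j k s) 2 volume ^ 2)
      (volume.restrict (Ioc 0 T)) :=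
    Finset.aemeasurable_fun_sum _ fun i _ => Finset.aemeasurable_fun_sum _ fun j _ =>
      Finset.aemeasurable_fun_sum _ fun k _ => (hGm i j k).pow_const 2
  have hSfin := ae_lt_top' hSm h.G_sq.ne
  have hSint := integrable_toReal_of_lintegral_ne_top hSm h.G_sq.ne
  have hGfin : ∀ᵐ s ∂(volume.restrict (Ioc 0 T)), ∀ i j k, eLpNorm (G i j k s) 2 volume ≠ ⊤ := by
    filter_upwards [hSfin] with s hs i j k htop
    simp only [ENNReal.sum_lt_top, Finset.mem_univ, forall_true_left] at hs
    have := hs i j k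
    rw [htop] at this
    simp at this
  -- The factor `8` is Cauchy–Schwarz used on three nested sums of two terms.
  have hN2 : ∀ᵐ s ∂(volume.restrict (Ioc 0 T)),
      N s ^ 2 ≤ 8 * (∑ i, ∑ j, ∑ k, eLpNorm (G i j k s) 2 volume ^ 2).toReal := by
    filter_upwards [hGfin] with s hs
    have e : (∑ i, ∑ j, ∑ k, eLpNorm (G i j k s) 2 volume ^ 2).toReal
        = ∑ i, ∑ j, ∑ k, nrm 2 (G i j k s) ^ 2 := by
      have ht : ∀ i j k, eLpNorm (G i j k s) 2 volume ^ 2 ≠ ⊤ := fun i j k =>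
        ENNReal.pow_ne_top (hs i j k)
      rw [ENNReal.toReal_sum fun i _ => ENNReal.sum_ne_top.2 fun j _ => ENNReal.sum_ne_top.2
        fun k _ => ht i j k]
      refine Finset.sum_congr rfl fun i _ => ?_
      rw [ENNReal.toReal_sum fun j _ => ENNReal.sum_ne_top.2 fun k _ => ht i j k]
      refine Finset.sum_congr rfl fun j _ => ?_
      rw [ENNReal.toReal_sum fun k _ => ht i j k]
      refine Finset.sum_congr rfl fun k _ => ?_
      rw [ENNReal.toReal_pow, nrm]
    rw [e]
    have h1 : ∀ f : Fin 2 → ℝ, (∑ i, f i) ^ 2 ≤ 2 * ∑ i, f i ^ 2 := fun f => by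
      simp only [Fin.sum_univ_two]; nlinarith [sq_nonneg (f 0 - f 1)]
    calc N s ^ 2 ≤ 2 * ∑ i, (∑ j, ∑ k, nrm 2 (G i j k s)) ^ 2 := h1 _
      _ ≤ 2 * ∑ i, 2 * ∑ j, (∑ k, nrm 2 (G i j k s)) ^ 2 := by
          gcongr with i; exact h1 _
      _ ≤ 2 * ∑ i, 2 * ∑ j, 2 * ∑ k, nrm 2 (G i j k s) ^ 2 := by
          gcongr with i _ j; exact h1 _
      _ = _ := by simp only [← Finset.mul_sum]; ring
  have hN2i : IntegrableOn (fun s => N s ^ 2) (Ioc 0 T) :=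
    (hSint.const_mul 8).mono' (hNm.pow 2) (hN2.mono fun s hs => by
      rwa [Real.norm_of_nonneg (sq_nonneg _)])
  have hNi : IntegrableOn N (Ioc 0 T) := by
    -- On a bounded time interval `N ≤ 1 + N²` gives integrability of `N` from that of its square.
    refine ((integrable_const (1 : ℝ)).add hN2i).mono' hNm (Eventually.of_forall fun s => ?_)
    rw [Real.norm_of_nonneg (hN0 s), Pi.add_apply]
    nlinarith [sq_nonneg (N s - 1), hN0 s]
  set C : ℝ := CU + CD + CA + C4 + Cq + (H4 : ℝ) * (CA + 1) + Hq * (CA + 1) with hC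
  have hc0 : (0 : ℝ) ≤ H4 * (CA + 1) := by positivity
  have hc1 : (0 : ℝ) ≤ Hq * (CA + 1) := by positivity
  have nn := fun x : ℝ≥0 => x.coe_nonneg
  have n1 := nn CU
  have n2 := nn CD
  have n3 := nn CA
  have n4 := nn C4
  have n5 := nn Cq
  refine ⟨C, N, by positivity, hN0, hNi, hN2i, ?_⟩
  filter_upwards [hCU, h.D_weak, hCD, h.U_div, hCA, h.G_weak, hGfin]
    with s s1 s2 s3 s4 s5 s6 s7
  have hGN : ∀ i j k, nrm 2 (G i j k s) ≤ N s := fun i j k => by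
    have a1 : nrm 2 (G i j k s) ≤ ∑ k, nrm 2 (G i j k s) :=
      Finset.single_le_sum (f := fun k => nrm 2 (G i j k s)) (fun _ _ => nrm_nonneg _ _)
        (Finset.mem_univ k)
    have a2 : ∑ k, nrm 2 (G i j k s) ≤ ∑ j, ∑ k, nrm 2 (G i j k s) :=
      Finset.single_le_sum (f := fun j => ∑ k, nrm 2 (G i j k s))
        (fun _ _ => Finset.sum_nonneg fun _ _ => nrm_nonneg _ _) (Finset.mem_univ j)
    have a3 : ∑ j, ∑ k, nrm 2 (G i j k s) ≤ N s :=
      Finset.single_le_sum (f := fun i => ∑ j, ∑ k, nrm 2 (G i j k s))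
        (fun _ _ => Finset.sum_nonneg fun _ _ => Finset.sum_nonneg fun _ _ => nrm_nonneg _ _)
        (Finset.mem_univ i)
    linarith
  have hGsum : ∀ i j, ∑ k, nrm 2 (G i j k s) ≤ N s := fun i j => by
    have a2 : ∑ k, nrm 2 (G i j k s) ≤ ∑ j, ∑ k, nrm 2 (G i j k s) :=
      Finset.single_le_sum (f := fun j => ∑ k, nrm 2 (G i j k s))
        (fun _ _ => Finset.sum_nonneg fun _ _ => nrm_nonneg _ _) (Finset.mem_univ j)
    have a3 : ∑ j, ∑ k, nrm 2 (G i j k s) ≤ N s :=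
      Finset.single_le_sum (f := fun i => ∑ j, ∑ k, nrm 2 (G i j k s))
        (fun _ _ => Finset.sum_nonneg fun _ _ => Finset.sum_nonneg fun _ _ => nrm_nonneg _ _)
        (Finset.mem_univ i)
    linarith
  have hH1 : ∀ {q : ℝ≥0∞} {H : ℝ≥0} (i j : Fin 2), eLpNorm (A i j s) q volume
      ≤ H * (eLpNorm (A i j s) 2 volume + ∑ k, eLpNorm (G i j k s) 2 volume) →
      eLpNorm (A i j s) q volume < ⊤ ∧ nrm q (A i j s) ≤ H * (CA + 1) * (1 + N s) := by
    intro q H i j hle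
    have hs1 : ∑ k, eLpNorm (G i j k s) 2 volume ≠ ⊤ := ENNReal.sum_ne_top.2 fun k _ => s7 i j k
    have hs2 : eLpNorm (A i j s) 2 volume ≠ ⊤ := (Lp.memLp (A i j s)).2.ne
    have hfin : (H : ℝ≥0∞) * (eLpNorm (A i j s) 2 volume + ∑ k, eLpNorm (G i j k s) 2 volume)
        ≠ ⊤ := ENNReal.mul_ne_top ENNReal.coe_ne_top (ENNReal.add_ne_top.2 ⟨hs2, hs1⟩)
    refine ⟨hle.trans_lt hfin.lt_top, ?_⟩
    have h1 := ENNReal.toReal_mono hfin hle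
    rw [ENNReal.toReal_mul, ENNReal.toReal_add hs2 hs1,
      ENNReal.toReal_sum fun k _ => s7 i j k] at h1
    have h2 : (eLpNorm (A i j s) 2 volume).toReal ≤ CA := nrm_le_of_eLpNorm_le (s5 i j)
    refine h1.trans ?_
    rw [mul_assoc]
    refine mul_le_mul_of_nonneg_left ?_ H.coe_nonneg
    have h3 := hGsum i j
    simp only [nrm] at h3
    have := mul_nonneg n3 (hN0 s)
    linarith
  have hA4 := fun i j => hH1 i j (hH4 _ _ (Lp.memLp (A i j s)) (s6 i j))
  have hAq := fun i j => hH1 i j (hHq _ _ (Lp.memLp (A i j s)) (s6 i j))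
  have hU4 := fun i => hC4 _ _ (Lp.memLp (U i s)) (s2 i) (s1 i) (s3 i)
  have hUq := fun i => hCq _ _ (Lp.memLp (U i s)) (s2 i) (s1 i) (s3 i)
  have hmono : ∀ {x y : ℝ}, x ≤ y * (1 + N s) → y ≤ C → x ≤ C * (1 + N s) := fun hx hy =>
    hx.trans (mul_le_mul_of_nonneg_right hy (by linarith [hN0 s]))
  exact
    { D_weak := s2
      div := s4
      G_weak := s6
      U_two := fun i => (nrm_le_of_eLpNorm_le (s1 i)).trans (by linarith)
      U_four := fun i => ⟨(Lp.memLp (U i s)).1, (hU4 i).trans_lt ENNReal.coe_lt_top⟩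
      U_four_le := fun i => (nrm_le_of_eLpNorm_le (hU4 i)).trans (by linarith)
      U_q := fun i => ⟨(Lp.memLp (U i s)).1, (hUq i).trans_lt ENNReal.coe_lt_top⟩
      U_q_le := fun i => (nrm_le_of_eLpNorm_le (hUq i)).trans (by linarith)
      D_p := fun i j => ⟨(s2 i j).2.1.aestronglyMeasurable, (s3 i j).trans_lt ENNReal.coe_lt_top⟩
      D_p_le := fun i j => (nrm_le_of_eLpNorm_le (s3 i j)).trans (by linarith)
      A_two := fun i j => (nrm_le_of_eLpNorm_le (s5 i j)).trans (by linarith)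
      A_four := fun i j => ⟨(Lp.memLp (A i j s)).1, (hA4 i j).1⟩
      A_four_le := fun i j => hmono (hA4 i j).2 (by linarith)
      A_q := fun i j => ⟨(Lp.memLp (A i j s)).1, (hAq i j).1⟩
      A_q_le := fun i j => hmono (hAq i j).2 (by linarith)
      G_two := fun i j k => ⟨(s6 i j k).2.1.aestronglyMeasurable, (s7 i j k).lt_top⟩
      G_two_le := hGN }

/-! ### The tested right-hand side and its mollified versions -/

/-- The form `∫ m·φ' + h φ - Q φ`, where `φ'` stands for the gradient of `φ`. -/
def pair (m : Fin 2 → Plane → ℝ) (h Q φ : Plane → ℝ) (φ' : Fin 2 → Plane → ℝ) : ℝ :=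
  (∑ k, ∫ x, m k x * φ' k x) + (∫ x, h x * φ x) - ∫ x, Q x * φ x

theorem abs_pair_le {a b q r : ℝ≥0∞} [a.HolderConjugate b] [r.HolderConjugate q]
    {m : Fin 2 → Plane → ℝ} {h Q φ : Plane → ℝ} {φ' : Fin 2 → Plane → ℝ}
    (hm : ∀ k, MemLp (m k) a volume) (hh : MemLp h 2 volume) (hQ : MemLp Q r volume)
    (hφ : MemLp φ 2 volume) (hφq : MemLp φ q volume) (hφ' : ∀ k, MemLp (φ' k) b volume) :
    |pair m h Q φ φ'| ≤ (∑ k, nrm a (m k) * nrm b (φ' k)) + nrm 2 h * nrm 2 φ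
      + nrm r Q * nrm q φ := by
  refine (abs_sub _ _).trans (add_le_add ((abs_add_le _ _).trans (add_le_add ?_ ?_)) ?_)
  · exact (Finset.abs_sum_le_sum_abs _ _).trans
      (Finset.sum_le_sum fun k _ => abs_integral_mul_le (hm k) (hφ' k))
  · exact abs_integral_mul_le hh hφ
  · exact abs_integral_mul_le hQ hφq

theorem tendsto_pair_mol_mol {a b q : ℝ} {r : ℝ≥0∞}
    [(ENNReal.ofReal a).HolderConjugate (ENNReal.ofReal b)]
    [r.HolderConjugate (ENNReal.ofReal q)] (hb : 1 ≤ b) (hq : 1 ≤ q)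
    {m : Fin 2 → Plane → ℝ} {h Q f : Plane → ℝ} {g : Fin 2 → Plane → ℝ}
    (hm : ∀ k, MemLp (m k) (ENNReal.ofReal a) volume) (hh : MemLp h 2 volume)
    (hQ : MemLp Q r volume) (hf : MemLp f 2 volume) (hfq : MemLp f (ENNReal.ofReal q) volume)
    (hg : ∀ k, MemLp (g k) (ENNReal.ofReal b) volume) :
    Tendsto (fun n => pair m h Q (mol n (mol n f)) (fun k => mol n (mol n (g k)))) atTop
      (𝓝 (pair m h Q f g)) := by
  have h2 : MemLp f (ENNReal.ofReal 2) volume := by simpa using hf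
  refine ((tendsto_finsetSum _ fun k _ => ?_).add ?_).sub ?_
  · exact tendsto_integral_mul_left (hm k) (fun n => memLp_mol n hb (memLp_mol n hb (hg k))) (hg k)
      (eLpNorm_mol_mol_sub_tendsto hb (hg k))
  · have := eLpNorm_mol_mol_sub_tendsto (by norm_num) h2
    exact tendsto_integral_mul_left hh (fun n => memLp_mol_two n (memLp_mol_two n hf)) hf
      (by simpa using this)
  · exact tendsto_integral_mul_left hQ (fun n => memLp_mol n hq (memLp_mol n hq hfq)) hfq
      (eLpNorm_mol_mol_sub_tendsto hq hfq)

theorem abs_pair_mol_mol_le {a b q : ℝ} {r : ℝ≥0∞}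
    [(ENNReal.ofReal a).HolderConjugate (ENNReal.ofReal b)]
    [r.HolderConjugate (ENNReal.ofReal q)] (hb : 1 ≤ b) (hq : 1 ≤ q)
    {m : Fin 2 → Plane → ℝ} {h Q f : Plane → ℝ} {g : Fin 2 → Plane → ℝ}
    (hm : ∀ k, MemLp (m k) (ENNReal.ofReal a) volume) (hh : MemLp h 2 volume)
    (hQ : MemLp Q r volume) (hf : MemLp f 2 volume) (hfq : MemLp f (ENNReal.ofReal q) volume)
    (hg : ∀ k, MemLp (g k) (ENNReal.ofReal b) volume) (n : ℕ) :
    |pair m h Q (mol n (mol n f)) (fun k => mol n (mol n (g k)))| ≤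
      (∑ k, nrm (ENNReal.ofReal a) (m k) * nrm (ENNReal.ofReal b) (g k)) + nrm 2 h * nrm 2 f
        + nrm r Q * nrm (ENNReal.ofReal q) f := by
  have h2 : MemLp f (ENNReal.ofReal 2) volume := by simpa using hf
  have hn2 : nrm 2 (mol n (mol n f)) ≤ nrm 2 f := by
    have := (nrm_mol_le n (by norm_num) (memLp_mol n (by norm_num) h2)).trans
      (nrm_mol_le n (by norm_num) h2)
    simpa using this
  refine (abs_pair_le (a := ENNReal.ofReal a) (b := ENNReal.ofReal b) (q := ENNReal.ofReal q)
    hm hh hQ (memLp_mol_two n (memLp_mol_two n hf)) (memLp_mol n hq (memLp_mol n hq hfq))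
    (fun k => memLp_mol n hb (memLp_mol n hb (hg k)))).trans ?_
  refine add_le_add (add_le_add (Finset.sum_le_sum fun k _ => ?_) ?_) ?_
  · exact mul_le_mul_of_nonneg_left ((nrm_mol_le n hb (memLp_mol n hb (hg k))).trans
      (nrm_mol_le n hb (hg k))) (nrm_nonneg _ _)
  · exact mul_le_mul_of_nonneg_left hn2 (nrm_nonneg _ _)
  · exact mul_le_mul_of_nonneg_left ((nrm_mol_le n hq (memLp_mol n hq hfq)).trans
      (nrm_mol_le n hq hfq)) (nrm_nonneg _ _)

/-- For fixed `n` the derivative of a mollification falls on the kernel, so mollification maps `L²`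
boundedly into `H¹` and hence into `L^q`. The constant may blow up with `n`; it is used only at
fixed `n`. -/
theorem exists_nrm_mol_le {q : ℝ} (h2q : 2 ≤ q) (hq6 : q ≤ 6) (n : ℕ) :
    ∃ K : ℝ, 0 ≤ K ∧ ∀ e : ScalL2, MemLp (mol n e) (ENNReal.ofReal q) volume ∧
      nrm (ENNReal.ofReal q) (mol n e) ≤ K * ‖e‖ := by
  obtain ⟨H, hH⟩ := exists_eLpNorm_le_of_H1 h2q hq6
  refine ⟨H * (‖molL2 n‖ + ∑ k, ‖dmolL2 n k‖), by positivity, fun e => ?_⟩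
  have hr : ContDiff ℝ 1 (rho n) := (rho_contDiff n).of_le (by simp)
  have hw : ∀ k, IsWeakPartial k (mol n e) (conv (partialDeriv k (rho n)) e) := fun k => by
    rw [← partialDeriv_conv hr (rho_compact n) (locallyIntegrable_of_memLp_two (Lp.memLp e))]
    exact isWeakPartial_of_contDiff ((contDiff_mol n
      (locallyIntegrable_of_memLp_two (Lp.memLp e))).of_le (by simp)) k
  have hle := hH _ _ (memLp_mol_two n (Lp.memLp e)) hw
  have e1 : eLpNorm (mol n e) 2 volume = ‖molL2 n e‖ₑ := by
    rw [Lp.enorm_def]; exact eLpNorm_congr_ae (molL2_coe n e).symm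
  have e2 : ∀ k, eLpNorm (conv (partialDeriv k (rho n)) e) 2 volume = ‖dmolL2 n k e‖ₑ := fun k => by
    rw [Lp.enorm_def]; exact eLpNorm_congr_ae (dmolL2_coe n k e).symm
  simp only [e1, e2] at hle
  have hs : ∑ k, ‖dmolL2 n k e‖ₑ ≠ ⊤ := ENNReal.sum_ne_top.2 fun k _ => enorm_ne_top
  have hfin : (H : ℝ≥0∞) * (‖molL2 n e‖ₑ + ∑ k, ‖dmolL2 n k e‖ₑ) ≠ ⊤ :=
    ENNReal.mul_ne_top ENNReal.coe_ne_top (ENNReal.add_ne_top.2 ⟨enorm_ne_top, hs⟩)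
  refine ⟨⟨(memLp_mol_two n (Lp.memLp e)).1, hle.trans_lt hfin.lt_top⟩, ?_⟩
  refine (ENNReal.toReal_mono hfin hle).trans ?_
  rw [ENNReal.toReal_mul, ENNReal.toReal_add enorm_ne_top hs,
    ENNReal.toReal_sum fun k _ => enorm_ne_top, ENNReal.coe_toReal, mul_assoc, add_mul,
    Finset.sum_mul]
  simp only [toReal_enorm]
  gcongr with k
  · exact (molL2 n).le_opNorm e
  · exact (dmolL2 n k).le_opNorm e

/-- Testing with mollified functions gives a bounded functional on `L²`. -/
theorem exists_form_mol {q : ℝ} (h2q : 2 ≤ q) (hq6 : q ≤ 6) {r : ℝ≥0∞}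
    [r.HolderConjugate (ENNReal.ofReal q)] (n : ℕ) :
    ∃ K : ℝ, 0 ≤ K ∧ ∀ (m : Fin 2 → Plane → ℝ) (h Q : Plane → ℝ), (∀ k, MemLp (m k) 2 volume) →
      MemLp h 2 volume → MemLp Q r volume → ∃ L : ScalL2 →L[ℝ] ℝ,
        (∀ e : ScalL2, L e = pair m h Q (mol n e) (fun k => conv (partialDeriv k (rho n)) e)) ∧
        ‖L‖ ≤ K * ((∑ k, nrm 2 (m k)) + nrm 2 h + nrm r Q) := by
  obtain ⟨K, hK0, hK⟩ := exists_nrm_mol_le h2q hq6 n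
  set K' : ℝ := K + ‖molL2 n‖ + ∑ k, ‖dmolL2 n k‖ with hK'
  have hs0 : 0 ≤ ∑ k, ‖dmolL2 n k‖ := Finset.sum_nonneg fun _ _ => norm_nonneg _
  have hK'0 : 0 ≤ K' := by positivity
  have hd0 : ∀ k, Continuous (partialDeriv k (rho n)) := fun k =>
    continuous_partialDeriv ((rho_contDiff n).of_le (by simp)) k
  have hdc : ∀ k, HasCompactSupport (partialDeriv k (rho n)) := fun k =>
    hasCompactSupport_partialDeriv (rho_compact n) k
  refine ⟨K', hK'0, fun m h Q hm hh hQ => ?_⟩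
  have hd2 : ∀ k (e : ScalL2), MemLp (conv (partialDeriv k (rho n)) e) 2 volume := fun k e =>
    memLp_conv_two (hd0 k) (hdc k) (Lp.memLp e)
  have h2 : ∀ e : ScalL2, MemLp (mol n e) 2 volume := fun e => memLp_mol_two n (Lp.memLp e)
  have nm : ∀ e : ScalL2, nrm 2 (mol n e) ≤ K' * ‖e‖ := fun e => by
    have e1 : nrm 2 (mol n e) = ‖molL2 n e‖ := by
      rw [Lp.norm_def, nrm]; congr 1; exact eLpNorm_congr_ae (molL2_coe n e).symm
    rw [e1]
    exact ((molL2 n).le_opNorm e).trans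
      (mul_le_mul_of_nonneg_right (by linarith) (norm_nonneg _))
  have nd : ∀ k (e : ScalL2), nrm 2 (conv (partialDeriv k (rho n)) e) ≤ K' * ‖e‖ := fun k e => by
    have e1 : nrm 2 (conv (partialDeriv k (rho n)) e) = ‖dmolL2 n k e‖ := by
      rw [Lp.norm_def, nrm]; congr 1; exact eLpNorm_congr_ae (dmolL2_coe n k e).symm
    rw [e1]
    have := Finset.single_le_sum (f := fun k => ‖dmolL2 n k‖) (fun _ _ => norm_nonneg _)
      (Finset.mem_univ k)
    exact ((dmolL2 n k).le_opNorm e).trans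
      (mul_le_mul_of_nonneg_right (by linarith [norm_nonneg (molL2 n)])
        (norm_nonneg _))
  have nq : ∀ e : ScalL2, nrm (ENNReal.ofReal q) (mol n e) ≤ K' * ‖e‖ := fun e =>
    (hK e).2.trans (mul_le_mul_of_nonneg_right (by linarith [norm_nonneg (molL2 n)])
      (norm_nonneg _))
  have ca : ∀ {k : Plane → ℝ}, Continuous k → HasCompactSupport k → ∀ e f : ScalL2,
      conv k ((e + f : ScalL2) : Plane → ℝ) = conv k e + conv k f := fun hk hc e f => by
    funext x
    rw [conv_congr (Lp.coeFn_add e f), conv_add hk hc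
      (locallyIntegrable_of_memLp_two (Lp.memLp e)) (locallyIntegrable_of_memLp_two (Lp.memLp f))]
  have cs : ∀ {k : Plane → ℝ} (c : ℝ) (e : ScalL2),
      conv k ((c • e : ScalL2) : Plane → ℝ) = c • conv k e := fun c e => by
    rw [conv_congr (Lp.coeFn_smul c e), conv_const_smul]
  have ia : ∀ {a b : ℝ≥0∞} [a.HolderConjugate b] {f g g' : Plane → ℝ}, MemLp f a volume →
      MemLp g b volume → MemLp g' b volume →
      ∫ x, f x * (g + g') x = (∫ x, f x * g x) + ∫ x, f x * g' x := fun hf hg hg' => by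
    simp only [Pi.add_apply, mul_add]
    exact integral_add (integrable_mul hf hg) (integrable_mul hf hg')
  have is : ∀ {f g : Plane → ℝ} (c : ℝ), ∫ x, f x * (c • g) x = c * ∫ x, f x * g x := fun c => by
    rw [← integral_const_mul]
    congr 1; funext x; simp only [Pi.smul_apply, smul_eq_mul]; ring
  let L₀ : ScalL2 →ₗ[ℝ] ℝ :=
    { toFun := fun e => pair m h Q (mol n e) (fun k => conv (partialDeriv k (rho n)) e)
      map_add' := fun e f => by
        have hma : mol n ((e + f : ScalL2) : Plane → ℝ) = mol n e + mol n f :=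
          ca (rho_continuous n) (rho_compact n) e f
        simp only [pair, hma, ca (hd0 _) (hdc _)]
        rw [ia (b := 2) hh (h2 e) (h2 f), ia hQ (hK e).1 (hK f).1,
          Finset.sum_congr rfl fun k _ => ia (b := 2) (hm k) (hd2 k e) (hd2 k f),
          Finset.sum_add_distrib]
        ring
      map_smul' := fun c e => by
        simp only [pair, mol, cs, is, RingHom.id_apply, smul_eq_mul, ← Finset.mul_sum]
        ring }
  refine ⟨L₀.mkContinuous (K' * ((∑ k, nrm 2 (m k)) + nrm 2 h + nrm r Q)) fun e => ?_,
    fun e => rfl, LinearMap.mkContinuous_norm_le _ (mul_nonneg hK'0 (add_nonneg (add_nonneg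
      (Finset.sum_nonneg fun _ _ => nrm_nonneg _ _) (nrm_nonneg _ _)) (nrm_nonneg _ _))) _⟩
  refine (abs_pair_le (a := 2) (b := 2) (q := ENNReal.ofReal q) (r := r) hm hh hQ (h2 e) (hK e).1
    (fun k => hd2 k e)).trans ?_
  calc _ ≤ (∑ k, nrm 2 (m k) * (K' * ‖e‖)) + nrm 2 h * (K' * ‖e‖) + nrm r Q * (K' * ‖e‖) := by
        refine add_le_add (add_le_add (Finset.sum_le_sum fun k _ => ?_) ?_) ?_
        · exact mul_le_mul_of_nonneg_left (nd k e) (nrm_nonneg _ _)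
        · exact mul_le_mul_of_nonneg_left (nm e) (nrm_nonneg _ _)
        · exact mul_le_mul_of_nonneg_left (nq e) (nrm_nonneg _ _)
    _ = _ := by rw [← Finset.sum_mul]; ring

/-- Passing to the limit in a family of integral identities. -/
theorem limit_integral_identity {t c : ℝ} (ht : 0 ≤ t) {F : ℕ → ℝ → ℝ} {F' g : ℝ → ℝ} {a b : ℕ → ℝ}
    {a' b' : ℝ} (hF : ∀ n, IntervalIntegrable (F n) volume 0 t)
    (he : ∀ n, a n = b n + c * ∫ s in (0 : ℝ)..t, F n s)
    (hg : IntegrableOn g (Ioc 0 t)) (hFg : ∀ n, ∀ᵐ s ∂(volume.restrict (Ioc 0 t)), |F n s| ≤ g s)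
    (hlim : ∀ᵐ s ∂(volume.restrict (Ioc 0 t)), Tendsto (fun n => F n s) atTop (𝓝 (F' s)))
    (ha : Tendsto a atTop (𝓝 a')) (hb : Tendsto b atTop (𝓝 b')) :
    IntervalIntegrable F' volume 0 t ∧ a' = b' + c * ∫ s in (0 : ℝ)..t, F' s := by
  simp only [intervalIntegrable_iff_integrableOn_Ioc_of_le ht] at hF ⊢
  have hm : AEStronglyMeasurable F' (volume.restrict (Ioc 0 t)) :=
    aestronglyMeasurable_of_tendsto_ae atTop (fun n => (hF n).1) hlim
  have hint : Tendsto (fun n => ∫ s in Ioc 0 t, F n s) atTop (𝓝 (∫ s in Ioc 0 t, F' s)) :=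
    tendsto_integral_of_dominated_convergence g (fun n => (hF n).1) hg hFg hlim
  simp only [intervalIntegral.integral_of_le ht] at he ⊢
  refine ⟨hg.mono' hm ?_, ?_⟩
  · filter_upwards [ae_all_iff.2 hFg, hlim] with s h1 h2
    exact le_of_tendsto h2.abs (Eventually.of_forall h1)
  · refine tendsto_nhds_unique ha ?_
    have := hb.add (hint.const_mul c)
    exact this.congr fun n => (he n).symm

theorem memLp_ofReal_two {f : Plane → ℝ} (hf : MemLp f 2 volume) :
    MemLp f (ENNReal.ofReal 2) volume := by simpa using hf

theorem nrm_add_le {p : ℝ≥0∞} (hp : 1 ≤ p) {f g : Plane → ℝ} (hf : MemLp f p volume)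
    (hg : MemLp g p volume) : nrm p (fun x => f x + g x) ≤ nrm p f + nrm p g := by
  rw [nrm, nrm, nrm, ← ENNReal.toReal_add hf.2.ne hg.2.ne]
  exact ENNReal.toReal_mono (ENNReal.add_ne_top.2 ⟨hf.2.ne, hg.2.ne⟩) (eLpNorm_add_le hf.1 hg.1 hp)

theorem nrm_sub_le {p : ℝ≥0∞} (hp : 1 ≤ p) {f g : Plane → ℝ} (hf : MemLp f p volume)
    (hg : MemLp g p volume) : nrm p (fun x => f x - g x) ≤ nrm p f + nrm p g := by
  rw [nrm, nrm, nrm, ← ENNReal.toReal_add hf.2.ne hg.2.ne]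
  exact ENNReal.toReal_mono (ENNReal.add_ne_top.2 ⟨hf.2.ne, hg.2.ne⟩) (eLpNorm_sub_le hf.1 hg.1 hp)

theorem nrm_neg (p : ℝ≥0∞) (f : Plane → ℝ) : nrm p (fun x => - f x) = nrm p f :=
  congrArg ENNReal.toReal (eLpNorm_neg f p volume)

theorem nrm_const_mul (p : ℝ≥0∞) (c : ℝ) (f : Plane → ℝ) :
    nrm p (fun x => c * f x) = |c| * nrm p f := by
  have h := eLpNorm_const_smul c f p (volume : Measure Plane)
  have e : (fun x => c * f x) = c • f := rfl
  rw [nrm, nrm, e, h, ENNReal.toReal_mul, toReal_enorm, Real.norm_eq_abs]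

/-! ### Stress equation at a fixed time -/

/-- The exponent `r` with `1/r = 1/p + 1/(2p')`. -/
def dualExp (p' : ℝ) : ℝ := 2 * p' / (2 * p' - 1)

theorem one_le_dualExp {p' : ℝ} (hp' : 1 < p') : 1 ≤ dualExp p' := by
  rw [dualExp, le_div_iff₀ (by linarith)]; linarith

/-- The co-rotation term is a product of `∇u` in `L^p` and `τ` in `L^{2p'}`. Since `1/p + 1/(2p') +
1/(2p') = 1`, it can be paired with another factor in `L^{2p'}`. -/
theorem holderConjugate_dualExp {p' : ℝ} (hp' : 1 < p') :
    (ENNReal.ofReal (dualExp p')).HolderConjugate (ENNReal.ofReal (2 * p')) := by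
  have h : (dualExp p').HolderConjugate (2 * p') := by
    rw [Real.holderConjugate_iff, dualExp]
    refine ⟨by rw [lt_div_iff₀ (by linarith)]; linarith, ?_⟩
    have : 2 * p' - 1 ≠ 0 := by linarith
    field_simp; ring
  exact h.ennrealOfReal

theorem holderTriple_dualExp {p p' : ℝ} (hpp : p'.HolderConjugate p) :
    (ENNReal.ofReal p).HolderTriple (ENNReal.ofReal (2 * p')) (ENNReal.ofReal (dualExp p')) := by
  have h1 := hpp.pos
  have h2 := hpp.lt
  refine Real.HolderTriple.ennrealOfReal ⟨?_, hpp.symm.pos, by positivity⟩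
  have h : p⁻¹ = 1 - p'⁻¹ := by linarith [hpp.inv_add_inv_eq_one]
  have : 2 * p' - 1 ≠ 0 := by linarith
  rw [h, dualExp]
  field_simp; ring

/-- Flux of the stress equation. -/
def stressFlux (U : Fin 2 → ScalL2) (A : Fin 2 → Fin 2 → ScalL2)
    (G : Fin 2 → Fin 2 → Fin 2 → Plane → ℝ) (i j k : Fin 2) (x : Plane) : ℝ :=
  U k x * A i j x - G i j k x

/-- The co-rotation term `Q(Ω, A)` in components. -/
def stressRot (D : Fin 2 → Fin 2 → Plane → ℝ) (A : Fin 2 → Fin 2 → ScalL2)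
    (i j : Fin 2) (x : Plane) : ℝ :=
  (1 / 2) * ∑ l, ((D l j x * A i l x - D j l x * A i l x)
    - (D i l x * A l j x - D l i x * A l j x))

section Slice

variable {p p' C N : ℝ} {U : Fin 2 → ScalL2} {D : Fin 2 → Fin 2 → Plane → ℝ}
  {A : Fin 2 → Fin 2 → ScalL2} {G : Fin 2 → Fin 2 → Fin 2 → Plane → ℝ}

theorem GoodSlice.memLp_gradU_mul (h : GoodSlice p p' C N U D A G) (hpp : p'.HolderConjugate p)
    (a b c d : Fin 2) :
    MemLp (fun x => D a b x * A c d x) (ENNReal.ofReal (dualExp p')) volume := by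
  have := holderTriple_dualExp hpp
  exact memLp_mul (p := ENNReal.ofReal p) (q := ENNReal.ofReal (2 * p')) (h.D_p a b) (h.A_q c d)

theorem GoodSlice.nrm_gradU_mul_le (h : GoodSlice p p' C N U D A G) (hpp : p'.HolderConjugate p)
    (hC : 0 ≤ C) (a b c d : Fin 2) :
    nrm (ENNReal.ofReal (dualExp p')) (fun x => D a b x * A c d x) ≤ C * (C * (1 + N)) := by
  have := holderTriple_dualExp hpp
  exact (nrm_mul_le (p := ENNReal.ofReal p) (q := ENNReal.ofReal (2 * p')) (h.D_p a b)
    (h.A_q c d)).trans (mul_le_mul (h.D_p_le a b) (h.A_q_le c d) (nrm_nonneg _ _) hC)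

theorem GoodSlice.memLp_stressRot (h : GoodSlice p p' C N U D A G) (hpp : p'.HolderConjugate p)
    (i j : Fin 2) : MemLp (stressRot D A i j) (ENNReal.ofReal (dualExp p')) volume := by
  have hm := h.memLp_gradU_mul hpp
  exact (memLp_finsetSum Finset.univ fun l _ =>
    (((hm l j i l).sub (hm j l i l)).sub ((hm i l l j).sub (hm l i l j)))).const_mul (1 / 2)

theorem GoodSlice.nrm_stressRot_le (h : GoodSlice p p' C N U D A G) (hpp : p'.HolderConjugate p)
    (hC : 0 ≤ C) (i j : Fin 2) :
    nrm (ENNReal.ofReal (dualExp p')) (stressRot D A i j) ≤ 4 * (C * (C * (1 + N))) := by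
  have hr : 1 ≤ ENNReal.ofReal (dualExp p') := by
    simpa using ENNReal.ofReal_le_ofReal (one_le_dualExp hpp.lt)
  have hm := h.memLp_gradU_mul hpp
  have hn := h.nrm_gradU_mul_le hpp hC
  have hterm : ∀ l, nrm (ENNReal.ofReal (dualExp p')) (fun x =>
      (D l j x * A i l x - D j l x * A i l x) - (D i l x * A l j x - D l i x * A l j x))
      ≤ 4 * (C * (C * (1 + N))) := fun l => by
    have h1 := nrm_sub_le hr ((hm l j i l).sub (hm j l i l)) ((hm i l l j).sub (hm l i l j))
    have h2 := nrm_sub_le hr (hm l j i l) (hm j l i l)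
    have h3 := nrm_sub_le hr (hm i l l j) (hm l i l j)
    simp only [Pi.sub_apply] at h1
    linarith [hn l j i l, hn j l i l, hn i l l j, hn l i l j,
      show nrm (ENNReal.ofReal (dualExp p')) (fun x => D l j x * A i l x - D j l x * A i l x)
        = nrm (ENNReal.ofReal (dualExp p'))
          ((fun x => D l j x * A i l x) - fun x => D j l x * A i l x) from rfl,
      show nrm (ENNReal.ofReal (dualExp p')) (fun x => D i l x * A l j x - D l i x * A l j x)
        = nrm (ENNReal.ofReal (dualExp p'))
          ((fun x => D i l x * A l j x) - fun x => D l i x * A l j x) from rfl]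
  have hmt : ∀ l, MemLp (fun x =>
      (D l j x * A i l x - D j l x * A i l x) - (D i l x * A l j x - D l i x * A l j x))
      (ENNReal.ofReal (dualExp p')) volume := fun l =>
    ((hm l j i l).sub (hm j l i l)).sub ((hm i l l j).sub (hm l i l j))
  unfold stressRot
  rw [nrm_const_mul]
  simp only [Fin.sum_univ_two]
  have h4 := nrm_add_le hr (hmt 0) (hmt 1)
  rw [abs_of_pos (by norm_num)]
  linarith [hterm 0, hterm 1]

theorem GoodSlice.memLp_stressFlux (h : GoodSlice p p' C N U D A G) (i j k : Fin 2) :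
    MemLp (stressFlux U A G i j k) 2 volume := by
  have := holderTriple_two_mul (p' := 2) (by norm_num)
  have h1 : MemLp (fun x => U k x * A i j x) (ENNReal.ofReal 2) volume :=
    memLp_mul (p := ENNReal.ofReal (2 * 2)) (q := ENNReal.ofReal (2 * 2)) (h.U_four k)
      (h.A_four i j)
  rw [ofReal_two] at h1
  exact h1.sub (h.G_two i j k)

theorem GoodSlice.nrm_stressFlux_le (h : GoodSlice p p' C N U D A G) (hC : 0 ≤ C)
    (i j k : Fin 2) : nrm 2 (stressFlux U A G i j k) ≤ C * (C * (1 + N)) + N := by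
  have := holderTriple_two_mul (p' := 2) (by norm_num)
  have h1 : MemLp (fun x => U k x * A i j x) (ENNReal.ofReal 2) volume :=
    memLp_mul (p := ENNReal.ofReal (2 * 2)) (q := ENNReal.ofReal (2 * 2)) (h.U_four k)
      (h.A_four i j)
  have h2 : nrm (ENNReal.ofReal 2) (fun x => U k x * A i j x) ≤ C * (C * (1 + N)) :=
    (nrm_mul_le (p := ENNReal.ofReal (2 * 2)) (q := ENNReal.ofReal (2 * 2)) (h.U_four k)
      (h.A_four i j)).trans (mul_le_mul (h.U_four_le k) (h.A_four_le i j) (nrm_nonneg _ _) hC)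
  rw [ofReal_two] at h1 h2
  exact (nrm_sub_le (by norm_num) h1 (h.G_two i j k)).trans (add_le_add h2 (h.G_two_le i j k))

/-- In the constant, `6 C²` collects one `C²` from each of the two fluxes and four from the
rotation; `C` comes from the damping and `2` from the two gradient terms. -/
theorem GoodSlice.stress_sum_le (h : GoodSlice p p' C N U D A G) (hpp : p'.HolderConjugate p)
    (hC : 0 ≤ C) (hN : 0 ≤ N) (i j : Fin 2) :
    (∑ k, nrm 2 (stressFlux U A G i j k)) + nrm 2 (fun x => - A i j x)
      + nrm (ENNReal.ofReal (dualExp p')) (stressRot D A i j)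
      ≤ (6 * C ^ 2 + C + 2) * (1 + N) := by
  have h1 := h.nrm_stressFlux_le hC i j 0
  have h2 := h.nrm_stressFlux_le hC i j 1
  have h3 := h.nrm_stressRot_le hpp hC i j
  have h4 := h.A_two i j
  rw [nrm_neg, Fin.sum_univ_two]
  have := mul_nonneg hC hN
  nlinarith

/-- The majorant for the limit in `n`: it does not depend on `n` and is quadratic in `N`, hence
integrable in time. The factor `(C + 1) (1 + N)` dominates every norm of the stress and of its
gradient that enters. -/
theorem GoodSlice.abs_stress_pair_mol_mol_le (h : GoodSlice p p' C N U D A G)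
    (hpp : p'.HolderConjugate p) (hC : 0 ≤ C) (hN : 0 ≤ N) (i j : Fin 2) (n : ℕ) :
    |pair (stressFlux U A G i j) (fun x => - A i j x) (stressRot D A i j)
        (mol n (mol n (A i j))) (fun k => mol n (mol n (G i j k)))|
      ≤ (6 * C ^ 2 + C + 2) * (1 + N) * ((C + 1) * (1 + N)) := by
  have := holderConjugate_dualExp hpp.lt
  have h2 : (ENNReal.ofReal 2).HolderConjugate (ENNReal.ofReal 2) := by
    rw [ofReal_two]; infer_instance
  have hfl := fun k => memLp_ofReal_two (h.memLp_stressFlux i j k)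
  have hg := fun k => memLp_ofReal_two (h.G_two i j k)
  refine (abs_pair_mol_mol_le (a := 2) (b := 2) (q := 2 * p') (by norm_num) (by linarith [hpp.lt])
    hfl (Lp.memLp (A i j)).neg (h.memLp_stressRot hpp i j) (Lp.memLp (A i j)) (h.A_q i j) hg
    n).trans ?_
  have hX : C ≤ (C + 1) * (1 + N) := by nlinarith
  have hY : N ≤ (C + 1) * (1 + N) := by nlinarith
  have hZ : C * (1 + N) ≤ (C + 1) * (1 + N) := by nlinarith
  rw [ofReal_two]
  calc _ ≤ (∑ k, nrm 2 (stressFlux U A G i j k) * ((C + 1) * (1 + N)))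
        + nrm 2 (fun x => - A i j x) * ((C + 1) * (1 + N))
        + nrm (ENNReal.ofReal (dualExp p')) (stressRot D A i j) * ((C + 1) * (1 + N)) := by
        refine add_le_add (add_le_add (Finset.sum_le_sum fun k _ => ?_) ?_) ?_
        · exact mul_le_mul_of_nonneg_left ((h.G_two_le i j k).trans hY) (nrm_nonneg _ _)
        · exact mul_le_mul_of_nonneg_left ((h.A_two i j).trans hX) (nrm_nonneg _ _)
        · exact mul_le_mul_of_nonneg_left ((h.A_q_le i j).trans hZ) (nrm_nonneg _ _)
    _ = ((∑ k, nrm 2 (stressFlux U A G i j k)) + nrm 2 (fun x => - A i j x)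
      + nrm (ENNReal.ofReal (dualExp p')) (stressRot D A i j)) * ((C + 1) * (1 + N)) := by
        rw [← Finset.sum_mul]; ring
    _ ≤ _ := mul_le_mul_of_nonneg_right (h.stress_sum_le hpp hC hN i j) (by positivity)

theorem GoodSlice.tendsto_stress_pair (h : GoodSlice p p' C N U D A G)
    (hpp : p'.HolderConjugate p) (i j : Fin 2) :
    Tendsto (fun n => pair (stressFlux U A G i j) (fun x => - A i j x) (stressRot D A i j)
        (mol n (mol n (A i j))) (fun k => mol n (mol n (G i j k)))) atTop
      (𝓝 (pair (stressFlux U A G i j) (fun x => - A i j x) (stressRot D A i j) (A i j)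
        (G i j))) := by
  have := holderConjugate_dualExp hpp.lt
  have h2 : (ENNReal.ofReal 2).HolderConjugate (ENNReal.ofReal 2) := by
    rw [ofReal_two]; infer_instance
  have hfl := fun k => memLp_ofReal_two (h.memLp_stressFlux i j k)
  have hg := fun k => memLp_ofReal_two (h.G_two i j k)
  exact tendsto_pair_mol_mol (a := 2) (b := 2) (q := 2 * p') (by norm_num) (by linarith [hpp.lt])
    hfl (Lp.memLp (A i j)).neg (h.memLp_stressRot hpp i j) (Lp.memLp (A i j)) (h.A_q i j) hg

/-- The drift and the co-rotation term do not contribute to the energy balance. -/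
theorem GoodSlice.sum_stress_pair (h : GoodSlice p p' C N U D A G)
    (hpp : p'.HolderConjugate p) :
    ∑ i, ∑ j, pair (stressFlux U A G i j) (fun x => - A i j x) (stressRot D A i j) (A i j) (G i j)
      = - ((∑ i, ∑ j, ‖A i j‖ ^ 2) + ∑ i, ∑ j, ∑ k, ∫ x, G i j k x ^ 2) := by
  have := holderConjugate_dualExp hpp.lt
  have ht := holderTriple_two_mul (p' := 2) (by norm_num)
  have hrot : ∑ i, ∑ j, ∫ x, stressRot D A i j x * A i j x = 0 := by
    have hi : ∀ i j, Integrable fun x => stressRot D A i j x * A i j x := fun i j =>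
      integrable_mul (h.memLp_stressRot hpp i j) (h.A_q i j)
    rw [Finset.sum_congr rfl fun i _ => (integral_finsetSum _ fun j _ => hi i j).symm,
      ← integral_finsetSum _ fun i _ => integrable_finsetSum _ fun j _ => hi i j]
    -- The integrand vanishes identically: the contraction of `AΩ - ΩA` with `A` is the trace of a
    -- symmetric matrix times the skew matrix `Ω`. No symmetry of `A` is required.
    rw [← integral_zero Plane ℝ]
    congr 1; funext x
    simp only [stressRot, Fin.sum_univ_two]
    ring
  -- The drift is skew with conjugate exponents `2` and `2`: velocity and stress lie in `L⁴`, the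
  -- stress gradient in `L²`.
  have hdrift : ∀ i j, ∑ k, ∫ x, U k x * A i j x * G i j k x = 0 := fun i j => by
    have hg := fun k => memLp_ofReal_two (h.G_two i j k)
    exact integral_mul_grad_eq_zero (p := 2) (p' := 2) Real.HolderConjugate.two_two
      (fun k => Lp.memLp (U k)) h.U_four h.div (Lp.memLp (A i j)) (h.A_four i j) (h.G_weak i j) hg
  have hUA : ∀ i j k, MemLp (fun x => U k x * A i j x) 2 volume := fun i j k => by
    have h1 : MemLp (fun x => U k x * A i j x) (ENNReal.ofReal 2) volume :=
      memLp_mul (p := ENNReal.ofReal (2 * 2)) (q := ENNReal.ofReal (2 * 2)) (h.U_four k)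
        (h.A_four i j)
    rwa [ofReal_two] at h1
  have hpair : ∀ i j, pair (stressFlux U A G i j) (fun x => - A i j x) (stressRot D A i j) (A i j)
      (G i j) = - (∑ k, ∫ x, G i j k x ^ 2) - ‖A i j‖ ^ 2
        - ∫ x, stressRot D A i j x * A i j x := fun i j => by
    rw [pair]
    have e1 : ∑ k, ∫ x, stressFlux U A G i j k x * G i j k x = - ∑ k, ∫ x, G i j k x ^ 2 := by
      have : ∀ k, ∫ x, stressFlux U A G i j k x * G i j k x
          = (∫ x, U k x * A i j x * G i j k x) - ∫ x, G i j k x ^ 2 := fun k => by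
        have i1 := integrable_mul (p := 2) (q := 2) (hUA i j k) (h.G_two i j k)
        have i2 := integrable_mul (p := 2) (q := 2) (h.G_two i j k) (h.G_two i j k)
        simp only [sq]
        rw [← integral_sub i1 i2]
        congr 1; funext x; rw [stressFlux]; ring
      rw [Finset.sum_congr rfl fun k _ => this k, Finset.sum_sub_distrib, hdrift, zero_sub]
    have e2 : ∫ x, -A i j x * A i j x = - ‖A i j‖ ^ 2 := by
      rw [← real_inner_self_eq_norm_sq, inner_scalL2, ← integral_neg]
      congr 1; funext x; ring
    rw [e1, e2]; ring
  rw [Finset.sum_congr rfl fun i _ => Finset.sum_congr rfl fun j _ => hpair i j]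
  simp only [Finset.sum_sub_distrib, hrot, Finset.sum_neg_distrib]
  ring

end Slice

/-! ### Energy balance of the stress -/

theorem ae_restrict_Ioc_mono {T t : ℝ} (ht : t ≤ T) {P : ℝ → Prop}
    (h : ∀ᵐ s ∂(volume.restrict (Ioc 0 T)), P s) : ∀ᵐ s ∂(volume.restrict (Ioc 0 t)), P s :=
  ae_restrict_of_ae_restrict_of_subset (Ioc_subset_Ioc_right ht) h

theorem integral_congr_Ioc {T t : ℝ} (ht0 : 0 ≤ t) (ht : t ≤ T) {f f' : ℝ → ℝ}
    (h : ∀ᵐ s ∂(volume.restrict (Ioc 0 T)), f s = f' s) :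
    ∫ s in (0 : ℝ)..t, f s = ∫ s in (0 : ℝ)..t, f' s := by
  rw [intervalIntegral.integral_of_le ht0, intervalIntegral.integral_of_le ht0]
  exact integral_congr_ae (ae_restrict_Ioc_mono ht h)

theorem intervalIntegrable_congr_Ioc {T t : ℝ} (ht0 : 0 ≤ t) (ht : t ≤ T) {f f' : ℝ → ℝ}
    (h : ∀ᵐ s ∂(volume.restrict (Ioc 0 T)), f s = f' s) (hf : IntervalIntegrable f volume 0 t) :
    IntervalIntegrable f' volume 0 t := by
  rw [intervalIntegrable_iff_integrableOn_Ioc_of_le ht0] at hf ⊢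
  exact hf.congr (ae_restrict_Ioc_mono ht h)

/-- Square integrable classes of continuous functions with compact support. -/
def compactSet : Set ScalL2 :=
  {e | ∃ (χ : Plane → ℝ) (hχ : Continuous χ) (hc : HasCompactSupport χ),
    e = (memLp_two_of_compact hχ hc).toLp χ}

/-- Continuous tests suffice here, since they are mollified before they enter the equation and
become smooth at that moment. -/
theorem mem_closure_span_compactSet (v : ScalL2) :
    v ∈ (Submodule.span ℝ compactSet).topologicalClosure := by
  rw [← SetLike.mem_coe, Submodule.topologicalClosure_coe, Metric.mem_closure_iff]
  intro ε hε
  obtain ⟨g, hg1, hg2, hg3, hg4⟩ := (Lp.memLp v).exists_hasCompactSupport_eLpNorm_sub_le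
    (by norm_num) (ε := ENNReal.ofReal (ε / 2)) (by simpa using hε)
  refine ⟨_, Submodule.subset_span ⟨g, hg3, hg1, rfl⟩, ?_⟩
  rw [dist_eq_norm, Lp.norm_def]
  have e : eLpNorm (⇑(v - (memLp_two_of_compact hg3 hg1).toLp g)) 2 volume
      = eLpNorm (⇑v - g) 2 volume := by
    refine eLpNorm_congr_ae ?_
    filter_upwards [Lp.coeFn_sub v ((memLp_two_of_compact hg3 hg1).toLp g),
      (memLp_two_of_compact hg3 hg1).coeFn_toLp] with x h1 h2
    rw [h1, Pi.sub_apply, h2, Pi.sub_apply]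
  rw [e]
  refine (ENNReal.toReal_mono (by simp) hg2).trans_lt ?_
  rw [ENNReal.toReal_ofReal (by positivity)]
  linarith

theorem hasCompactSupport_mol (n : ℕ) {f : Plane → ℝ} (hf : HasCompactSupport f) :
    HasCompactSupport (mol n f) := (rho_compact n).convolution _ hf

section Stress

variable {T p p' C : ℝ} {N : ℝ → ℝ} {U : Fin 2 → ℝ → ScalL2} {D : Fin 2 → Fin 2 → ℝ → Plane → ℝ}
  {A : Fin 2 → Fin 2 → ℝ → ScalL2} {G : Fin 2 → Fin 2 → Fin 2 → ℝ → Plane → ℝ}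
  {A₀ : Fin 2 → Fin 2 → ScalL2}

/-- The right hand side of the stress equation, tested. -/
def stressRHS (U : Fin 2 → ℝ → ScalL2) (D : Fin 2 → Fin 2 → ℝ → Plane → ℝ)
    (A : Fin 2 → Fin 2 → ℝ → ScalL2) (G : Fin 2 → Fin 2 → Fin 2 → ℝ → Plane → ℝ)
    (i j : Fin 2) (s : ℝ) (φ : Plane → ℝ) (φ' : Fin 2 → Plane → ℝ) : ℝ :=
  pair (stressFlux (fun i => U i s) (fun i j => A i j s) (fun i j k => G i j k s) i j)
    (fun x => - A i j s x) (stressRot (fun i j => D i j s) (fun i j => A i j s) i j) φ φ'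

/-- At good times every product is integrable, so the form splits into scalar integrals, each with
at most one weak derivative and each already known to be measurable in time. -/
theorem EnergyClass.aestronglyMeasurable_stressRHS (h : EnergyClass T p U D A G)
    (hpp : p'.HolderConjugate p)
    (hgood : ∀ᵐ s ∂(volume.restrict (Ioc 0 T)), GoodSlice p p' C (N s) (fun i => U i s)
        (fun i j => D i j s) (fun i j => A i j s) (fun i j k => G i j k s))
    {χ : Plane → ℝ} (hχ : ContDiff ℝ ∞ χ) (hc : HasCompactSupport χ) (i j : Fin 2) :
    AEStronglyMeasurable (fun s => stressRHS U D A G i j s χ (fun k => partialDeriv k χ))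
      (volume.restrict (Ioc 0 T)) := by
  have hconj := holderConjugate_dualExp hpp.lt
  have ht := holderTriple_two_mul (p' := 2) (by norm_num)
  have hd : ∀ k, ContDiff ℝ ∞ (partialDeriv k χ) := fun k => contDiff_partialDeriv hχ k
  have hdc : ∀ k, HasCompactSupport (partialDeriv k χ) := fun k =>
    hasCompactSupport_partialDeriv hc k
  have m1 : ∀ k, AEStronglyMeasurable (fun s => ∫ x, U k s x * A i j s x * partialDeriv k χ x)
      (volume.restrict (Ioc 0 T)) := fun k => by
    obtain ⟨M, hM⟩ := (hd k).continuous.bounded_above_of_compact_support (hdc k)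
    exact aestronglyMeasurable_integral_mul_mul (h.U_meas k) (h.A_meas i j) (hd k).continuous hM
  have m2 : ∀ k, AEStronglyMeasurable (fun s => ∫ x, G i j k s x * partialDeriv k χ x)
      (volume.restrict (Ioc 0 T)) := fun k =>
    aestronglyMeasurable_integral_weakPartial_mul (h.A_meas i j)
      (h.G_weak.mono fun s hs => hs i j k) (hd k) (hdc k)
  have m3 := aestronglyMeasurable_integral_mul (h.A_meas i j)
    (memLp_two_of_compact hχ.continuous hc)
  have m4 : ∀ a b c d, AEStronglyMeasurable (fun s => ∫ x, D a b s x * A c d s x * χ x)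
      (volume.restrict (Ioc 0 T)) := fun a b c d =>
    aestronglyMeasurable_integral_weakPartial_mul_mul hpp (h.U_meas a) (h.A_meas c d)
      (h.D_weak.mono fun s hs => hs a b) (hgood.mono fun s hs => hs.D_p a b)
      (hgood.mono fun s hs => hs.A_q c d) hχ.continuous hc
  have m : AEStronglyMeasurable (fun s => (∑ k, ((∫ x, U k s x * A i j s x * partialDeriv k χ x)
      - ∫ x, G i j k s x * partialDeriv k χ x)) + (- ∫ x, A i j s x * χ x)
      - (1 / 2) * ∑ l, (((∫ x, D l j s x * A i l s x * χ x) - ∫ x, D j l s x * A i l s x * χ x)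
        - ((∫ x, D i l s x * A l j s x * χ x) - ∫ x, D l i s x * A l j s x * χ x)))
      (volume.restrict (Ioc 0 T)) :=
    ((Finset.aestronglyMeasurable_fun_sum _ fun k _ => (m1 k).sub (m2 k)).add m3.neg).sub
      ((Finset.aestronglyMeasurable_fun_sum _ fun l _ => ((m4 l j i l).sub (m4 j l i l)).sub
        ((m4 i l l j).sub (m4 l i l j))).const_mul (1 / 2))
  refine m.congr ?_
  filter_upwards [hgood] with s hs
  rw [stressRHS, pair]
  have hχq : MemLp χ (ENNReal.ofReal (2 * p')) volume :=
    hχ.continuous.memLp_of_hasCompactSupport hc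
  have i4 : ∀ a b c d, Integrable fun x => D a b s x * A c d s x * χ x := fun a b c d =>
    integrable_mul (hs.memLp_gradU_mul hpp a b c d) hχq
  have i1 : ∀ k, Integrable fun x => U k s x * A i j s x * partialDeriv k χ x := fun k => by
    have h1 : MemLp (fun x => U k s x * A i j s x) (ENNReal.ofReal 2) volume :=
      memLp_mul (p := ENNReal.ofReal (2 * 2)) (q := ENNReal.ofReal (2 * 2)) (hs.U_four k)
        (hs.A_four i j)
    rw [ofReal_two] at h1
    exact integrable_mul (p := 2) (q := 2) h1 (memLp_partialDeriv hχ hc k)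
  have i2 : ∀ k, Integrable fun x => G i j k s x * partialDeriv k χ x := fun k =>
    integrable_mul (p := 2) (q := 2) (hs.G_two i j k) (memLp_partialDeriv hχ hc k)
  congr 1
  · congr 1
    · refine Finset.sum_congr rfl fun k _ => ?_
      rw [← integral_sub (i1 k) (i2 k)]
      congr 1; funext x; rw [stressFlux]; ring
    · rw [← integral_neg]; congr 1; funext x; ring
  · have e : ∀ l, (((∫ x, D l j s x * A i l s x * χ x) - ∫ x, D j l s x * A i l s x * χ x)
        - ((∫ x, D i l s x * A l j s x * χ x) - ∫ x, D l i s x * A l j s x * χ x))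
        = ∫ x, ((D l j s x * A i l s x * χ x - D j l s x * A i l s x * χ x)
          - (D i l s x * A l j s x * χ x - D l i s x * A l j s x * χ x)) := fun l => by
      rw [← integral_sub (i4 _ _ _ _) (i4 _ _ _ _), ← integral_sub (i4 _ _ _ _) (i4 _ _ _ _)]
      exact (integral_sub ((i4 _ _ _ _).sub (i4 _ _ _ _)) ((i4 _ _ _ _).sub (i4 _ _ _ _))).symm
    rw [Finset.sum_congr rfl fun l _ => e l, ← integral_finsetSum, ← integral_const_mul]
    · congr 1; funext x
      rw [stressRot, mul_assoc, Finset.sum_mul]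
      congr 1
      exact Finset.sum_congr rfl fun l _ => by ring
    · exact fun l _ => ((i4 _ _ _ _).sub (i4 _ _ _ _)).sub ((i4 _ _ _ _).sub (i4 _ _ _ _))

/-- Identifies the functional evaluated at the mollified solution itself: the derivative on the
kernel becomes the double mollification of the weak gradient. -/
theorem conv_partialDeriv_molL2 (n : ℕ) {k : Fin 2} {f : ScalL2} {g : Plane → ℝ}
    (h : IsWeakPartial k f g) :
    conv (partialDeriv k (rho n)) (molL2 n f) = mol n (mol n g) := by
  have h1 : conv (partialDeriv k (rho n)) (molL2 n f) = conv (partialDeriv k (rho n)) (mol n f) :=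
    funext fun x => by rw [conv_congr (molL2_coe n f)]
  rw [h1, (isWeakPartial_mol h n).conv_partialDeriv (rho_contDiff n) (rho_compact n)]
  rfl

theorem mol_molL2 (n : ℕ) (f : ScalL2) : mol n (molL2 n f) = mol n (mol n f) :=
  conv_congr (molL2_coe n f)

/-- The abstract energy identity is applied to `molL2 n` of the stress entry. Mollifiers are
self-adjoint, so testing the mollified entry with `e` is the stress equation tested with `mol n e`,
a functional bounded on `L²` by a constant times `1 + N`. -/
theorem EnergyClass.stress_energy_mol (h : EnergyClass T p U D A G)
    (hT : 0 < T) (hpp : p'.HolderConjugate p) (hp : 3 / 2 < p) (hC : 0 ≤ C) (hN0 : ∀ s, 0 ≤ N s)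
    (hN : IntegrableOn N (Ioc 0 T))
    (hgood : ∀ᵐ s ∂(volume.restrict (Ioc 0 T)), GoodSlice p p' C (N s) (fun i => U i s)
        (fun i j => D i j s) (fun i j => A i j s) (fun i j k => G i j k s))
    (i j : Fin 2)
    (hw : ∀ χ : Plane → ℝ, ContDiff ℝ ∞ χ → HasCompactSupport χ → ∀ t ∈ Ico 0 T,
      ∫ x, A i j t x * χ x = (∫ x, A₀ i j x * χ x)
        + ∫ s in (0 : ℝ)..t, stressRHS U D A G i j s χ (fun k => partialDeriv k χ))
    (n : ℕ) : ∀ t ∈ Ico 0 T,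
      IntervalIntegrable (fun s => stressRHS U D A G i j s (mol n (mol n (A i j s)))
        (fun k => mol n (mol n (G i j k s)))) volume 0 t ∧
      ‖molL2 n (A i j t)‖ ^ 2 = ‖molL2 n (A₀ i j)‖ ^ 2 + 2 * ∫ s in (0 : ℝ)..t,
        stressRHS U D A G i j s (mol n (mol n (A i j s))) (fun k => mol n (mol n (G i j k s))) := by
  have hconj := holderConjugate_dualExp hpp.lt
  obtain ⟨K, hK0, hK⟩ := exists_form_mol (q := 2 * p') (by linarith [hpp.lt])
    (by linarith [conj_lt_three hpp hp]) (r := ENNReal.ofReal (dualExp p')) n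
  -- At the exceptional times the functional is set to zero, so that it is defined for every `s`;
  -- these times form a null set.
  have hex : ∀ s, ∃ L : ScalL2 →L[ℝ] ℝ, GoodSlice p p' C (N s) (fun i => U i s)
        (fun i j => D i j s) (fun i j => A i j s) (fun i j k => G i j k s) →
      (∀ e : ScalL2, L e = stressRHS U D A G i j s (mol n e)
        (fun k => conv (partialDeriv k (rho n)) e)) ∧
      ‖L‖ ≤ K * ((6 * C ^ 2 + C + 2) * (1 + N s)) := fun s => by
    by_cases hs : GoodSlice p p' C (N s) (fun i => U i s)
        (fun i j => D i j s) (fun i j => A i j s) (fun i j k => G i j k s)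
    · obtain ⟨L, h1, h2⟩ := hK _ _ _ (hs.memLp_stressFlux i j) (Lp.memLp (A i j s)).neg
        (hs.memLp_stressRot hpp i j)
      exact ⟨L, fun _ => ⟨h1, h2.trans (mul_le_mul_of_nonneg_left
        (hs.stress_sum_le hpp hC (hN0 s) i j) hK0)⟩⟩
    · exact ⟨0, fun h => absurd h hs⟩
  choose B hB using hex
  have hloc : ∀ {χ : Plane → ℝ}, Continuous χ → LocallyIntegrable χ := fun hχ =>
    hχ.locallyIntegrable
  have hBe : ∀ {χ : Plane → ℝ} (hχ : Continuous χ) (hc : HasCompactSupport χ),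
      ∀ᵐ s ∂(volume.restrict (Ioc 0 T)), stressRHS U D A G i j s (mol n χ)
        (fun k => partialDeriv k (mol n χ)) = B s ((memLp_two_of_compact hχ hc).toLp χ) := by
    intro χ hχ hc
    filter_upwards [hgood] with s hs
    rw [(hB s hs).1]
    have e1 : ∀ k : Plane → ℝ, conv k ((memLp_two_of_compact hχ hc).toLp χ) = conv k χ := fun k =>
      funext fun x => by rw [conv_congr (memLp_two_of_compact hχ hc).coeFn_toLp]
    simp only [mol, e1]
    congr 1; funext k
    exact partialDeriv_conv ((rho_contDiff n).of_le (by simp)) (rho_compact n) (hloc hχ) k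
  have hAi := energy_identity (S := compactSet) (w := fun s => molL2 n (A i j s))
    (w₀ := molL2 n (A₀ i j)) (B := B) (g := fun s => K * ((6 * C ^ 2 + C + 2) * (1 + N s))) hT
    (by
      rw [intervalIntegrable_iff_integrableOn_Ioc_of_le hT.le]
      exact (((integrable_const (1 : ℝ)).add hN).const_mul _).const_mul _)
    (hgood.mono fun s hs => (hB s hs).2)
    (by
      rintro e ⟨χ, hχ, hc, rfl⟩
      exact (h.aestronglyMeasurable_stressRHS hpp hgood (contDiff_mol n (hloc hχ))
        (hasCompactSupport_mol n hc) i j).congr (hBe hχ hc))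
    (by
      rintro t ht e ⟨χ, hχ, hc, rfl⟩
      have h1 := hw _ (contDiff_mol n (hloc hχ)) (hasCompactSupport_mol n hc) t ht
      have h2 : ∀ f : ScalL2, inner ℝ (molL2 n f) ((memLp_two_of_compact hχ hc).toLp χ)
          = ∫ x, f x * mol n χ x := fun f => by
        rw [inner_molL2, inner_scalL2]
        refine integral_congr_ae ?_
        filter_upwards [molL2_coe n ((memLp_two_of_compact hχ hc).toLp χ)] with x hx
        rw [hx, mol, conv_congr (memLp_two_of_compact hχ hc).coeFn_toLp]
        rfl
      rw [h2, h2, h1, integral_congr_Ioc ht.1 ht.2.le (hBe hχ hc)])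
    (fun t _ => mem_closure_span_compactSet _) (mem_closure_span_compactSet _)
  have hcong : ∀ᵐ s ∂(volume.restrict (Ioc 0 T)), B s (molL2 n (A i j s))
      = stressRHS U D A G i j s (mol n (mol n (A i j s)))
        (fun k => mol n (mol n (G i j k s))) := by
    filter_upwards [hgood] with s hs
    rw [(hB s hs).1, mol_molL2]
    congr 1; funext k
    exact conv_partialDeriv_molL2 n (hs.G_weak i j k)
  intro t ht
  obtain ⟨h1, h2⟩ := hAi t ht
  refine ⟨intervalIntegrable_congr_Ioc ht.1 ht.2.le hcong h1, ?_⟩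
  rw [h2, integral_congr_Ioc ht.1 ht.2.le hcong]

/-- Dominated convergence as the mollification parameter grows, with the majorant quadratic in `N`.
The transport and rotation terms still appear: the rotation cancels only after summing over all
entries. -/
theorem EnergyClass.stress_energy_component (h : EnergyClass T p U D A G)
    (hT : 0 < T) (hpp : p'.HolderConjugate p) (hp : 3 / 2 < p) (hC : 0 ≤ C) (hN0 : ∀ s, 0 ≤ N s)
    (hN : IntegrableOn N (Ioc 0 T)) (hN2 : IntegrableOn (fun s => N s ^ 2) (Ioc 0 T))
    (hgood : ∀ᵐ s ∂(volume.restrict (Ioc 0 T)), GoodSlice p p' C (N s) (fun i => U i s)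
        (fun i j => D i j s) (fun i j => A i j s) (fun i j k => G i j k s))
    (i j : Fin 2)
    (hw : ∀ χ : Plane → ℝ, ContDiff ℝ ∞ χ → HasCompactSupport χ → ∀ t ∈ Ico 0 T,
      ∫ x, A i j t x * χ x = (∫ x, A₀ i j x * χ x)
        + ∫ s in (0 : ℝ)..t, stressRHS U D A G i j s χ (fun k => partialDeriv k χ)) :
    ∀ t ∈ Ico 0 T,
      IntervalIntegrable (fun s => stressRHS U D A G i j s (A i j s) (fun k => G i j k s))
        volume 0 t ∧
      ‖A i j t‖ ^ 2 = ‖A₀ i j‖ ^ 2 + 2 * ∫ s in (0 : ℝ)..t,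
        stressRHS U D A G i j s (A i j s) (fun k => G i j k s) := by
  intro t ht
  have hm := fun n => h.stress_energy_mol hT hpp hp hC hN0 hN hgood i j hw n t ht
  have hg : IntegrableOn (fun s => (6 * C ^ 2 + C + 2) * (1 + N s) * ((C + 1) * (1 + N s)))
      (Ioc 0 t) := by
    refine IntegrableOn.mono_set ?_ (Ioc_subset_Ioc_right ht.2.le)
    have := (((integrable_const (1 : ℝ)).add (hN.const_mul 2)).add hN2).const_mul
      ((6 * C ^ 2 + C + 2) * (C + 1))
    refine this.congr (Eventually.of_forall fun s => ?_)
    simp only [Pi.add_apply]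
    ring
  refine limit_integral_identity ht.1 (fun n => (hm n).1) (fun n => (hm n).2) hg
    (fun n => ?_) ?_ ((molL2_tendsto _).norm.pow 2) ((molL2_tendsto _).norm.pow 2)
  · filter_upwards [ae_restrict_Ioc_mono ht.2.le hgood] with s hs
    exact hs.abs_stress_pair_mol_mol_le hpp hC (hN0 s) i j n
  · filter_upwards [ae_restrict_Ioc_mono ht.2.le hgood] with s hs
    exact hs.tendsto_stress_pair hpp i j

/-- Energy balance of the stress, before multiplication by `e^{2t}`. -/
theorem EnergyClass.stress_energy (h : EnergyClass T p U D A G)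
    (hT : 0 < T) (hpp : p'.HolderConjugate p) (hp : 3 / 2 < p) (hC : 0 ≤ C) (hN0 : ∀ s, 0 ≤ N s)
    (hN : IntegrableOn N (Ioc 0 T)) (hN2 : IntegrableOn (fun s => N s ^ 2) (Ioc 0 T))
    (hgood : ∀ᵐ s ∂(volume.restrict (Ioc 0 T)), GoodSlice p p' C (N s) (fun i => U i s)
        (fun i j => D i j s) (fun i j => A i j s) (fun i j k => G i j k s))
    (hw : ∀ i j, ∀ χ : Plane → ℝ, ContDiff ℝ ∞ χ → HasCompactSupport χ → ∀ t ∈ Ico 0 T,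
      ∫ x, A i j t x * χ x = (∫ x, A₀ i j x * χ x)
        + ∫ s in (0 : ℝ)..t, stressRHS U D A G i j s χ (fun k => partialDeriv k χ)) :
    ∀ t ∈ Ico 0 T,
      IntervalIntegrable (fun s => - ((∑ i, ∑ j, ‖A i j s‖ ^ 2)
        + ∑ i, ∑ j, ∑ k, ∫ x, G i j k s x ^ 2)) volume 0 t ∧
      ∑ i, ∑ j, ‖A i j t‖ ^ 2 = (∑ i, ∑ j, ‖A₀ i j‖ ^ 2) + 2 * ∫ s in (0 : ℝ)..t,
        - ((∑ i, ∑ j, ‖A i j s‖ ^ 2) + ∑ i, ∑ j, ∑ k, ∫ x, G i j k s x ^ 2) := by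
  intro t ht
  have hc := fun i j => h.stress_energy_component hT hpp hp hC hN0 hN hN2 hgood i j (hw i j) t ht
  have hsum : ∀ᵐ s ∂(volume.restrict (Ioc 0 T)),
      ∑ i, ∑ j, stressRHS U D A G i j s (A i j s) (fun k => G i j k s)
        = - ((∑ i, ∑ j, ‖A i j s‖ ^ 2) + ∑ i, ∑ j, ∑ k, ∫ x, G i j k s x ^ 2) := by
    filter_upwards [hgood] with s hs
    exact hs.sum_stress_pair hpp
  have hi : ∀ i, IntervalIntegrable (fun s => ∑ j, stressRHS U D A G i j s (A i j s)
      (fun k => G i j k s)) volume 0 t := fun i => by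
    simpa only [Finset.sum_fn] using IntervalIntegrable.sum Finset.univ fun j _ => (hc i j).1
  have hii : IntervalIntegrable (fun s => ∑ i, ∑ j, stressRHS U D A G i j s (A i j s)
      (fun k => G i j k s)) volume 0 t := by
    simpa only [Finset.sum_fn] using IntervalIntegrable.sum Finset.univ fun i _ => hi i
  refine ⟨intervalIntegrable_congr_Ioc ht.1 ht.2.le hsum hii, ?_⟩
  rw [← integral_congr_Ioc ht.1 ht.2.le hsum, intervalIntegral.integral_finsetSum fun i _ => hi i,
    Finset.sum_congr rfl fun i _ => intervalIntegral.integral_finsetSum fun j _ => (hc i j).1,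
    Finset.sum_congr rfl fun i _ => Finset.sum_congr rfl fun j _ => (hc i j).2]
  simp only [Finset.sum_add_distrib, Finset.mul_sum]

end Stress

/-! ### Momentum equation at a fixed time -/

/-- Divergence of the stress, in components. -/
def velForce (G : Fin 2 → Fin 2 → Fin 2 → Plane → ℝ) (i : Fin 2) (x : Plane) : ℝ :=
  ∑ j, G i j j x

/-- Momentum flux, in components. -/
def velFlux (U : Fin 2 → ScalL2) (i k : Fin 2) (x : Plane) : ℝ := U k x * U i x

section Slice

variable {p p' C N : ℝ} {U : Fin 2 → ScalL2} {D : Fin 2 → Fin 2 → Plane → ℝ}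
  {A : Fin 2 → Fin 2 → ScalL2} {G : Fin 2 → Fin 2 → Fin 2 → Plane → ℝ}

theorem GoodSlice.memLp_velForce (h : GoodSlice p p' C N U D A G) (i : Fin 2) :
    MemLp (velForce G i) 2 volume := memLp_finsetSum Finset.univ fun j _ => h.G_two i j j

theorem GoodSlice.nrm_velForce_le (h : GoodSlice p p' C N U D A G) (i : Fin 2) :
    nrm 2 (velForce G i) ≤ 2 * N := by
  have e : velForce G i = fun x => G i 0 0 x + G i 1 1 x := by
    funext x; simp only [velForce, Fin.sum_univ_two]
  rw [e]
  linarith [nrm_add_le (by norm_num) (h.G_two i 0 0) (h.G_two i 1 1), h.G_two_le i 0 0,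
    h.G_two_le i 1 1]

theorem GoodSlice.memLp_velFlux_two (h : GoodSlice p p' C N U D A G) (i k : Fin 2) :
    MemLp (velFlux U i k) 2 volume := by
  have := holderTriple_two_mul (p' := 2) (by norm_num)
  have h1 : MemLp (velFlux U i k) (ENNReal.ofReal 2) volume :=
    memLp_mul (p := ENNReal.ofReal (2 * 2)) (q := ENNReal.ofReal (2 * 2)) (h.U_four k) (h.U_four i)
  rwa [ofReal_two] at h1

theorem GoodSlice.nrm_velFlux_two_le (h : GoodSlice p p' C N U D A G) (hC : 0 ≤ C)
    (i k : Fin 2) : nrm 2 (velFlux U i k) ≤ C * C := by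
  have := holderTriple_two_mul (p' := 2) (by norm_num)
  have h1 : nrm (ENNReal.ofReal 2) (velFlux U i k) ≤ C * C :=
    (nrm_mul_le (p := ENNReal.ofReal (2 * 2)) (q := ENNReal.ofReal (2 * 2)) (h.U_four k)
      (h.U_four i)).trans (mul_le_mul (h.U_four_le k) (h.U_four_le i) (nrm_nonneg _ _) hC)
  rwa [ofReal_two] at h1

theorem GoodSlice.memLp_velFlux (h : GoodSlice p p' C N U D A G) (hpp : p'.HolderConjugate p)
    (i k : Fin 2) : MemLp (velFlux U i k) (ENNReal.ofReal p') volume := by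
  have := holderTriple_two_mul hpp.pos
  exact memLp_mul (p := ENNReal.ofReal (2 * p')) (q := ENNReal.ofReal (2 * p')) (h.U_q k) (h.U_q i)

theorem GoodSlice.nrm_velFlux_le (h : GoodSlice p p' C N U D A G) (hpp : p'.HolderConjugate p)
    (hC : 0 ≤ C) (i k : Fin 2) : nrm (ENNReal.ofReal p') (velFlux U i k) ≤ C * C := by
  have := holderTriple_two_mul hpp.pos
  exact (nrm_mul_le (p := ENNReal.ofReal (2 * p')) (q := ENNReal.ofReal (2 * p')) (h.U_q k)
      (h.U_q i)).trans (mul_le_mul (h.U_q_le k) (h.U_q_le i) (nrm_nonneg _ _) hC)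

theorem nrm_zero (r : ℝ≥0∞) : nrm r (0 : Plane → ℝ) = 0 := by simp [nrm]

theorem GoodSlice.vel_sum_le (h : GoodSlice p p' C N U D A G) (hC : 0 ≤ C) (r : ℝ≥0∞)
    (i : Fin 2) :
    (∑ k, nrm 2 (velFlux U i k)) + nrm 2 (velForce G i) + nrm r (0 : Plane → ℝ)
      ≤ 2 * (C * C) + 2 * N := by
  rw [nrm_zero, Fin.sum_univ_two]
  linarith [h.nrm_velFlux_two_le hC i 0, h.nrm_velFlux_two_le hC i 1, h.nrm_velForce_le i]

/-- The flux is paired with `∇u` in `L^{p'}` and `L^p` rather than in `L²`, because `∇u` is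
controlled only in `L^p`. The bound is affine in `N`. -/
theorem GoodSlice.abs_vel_pair_mol_mol_le (h : GoodSlice p p' C N U D A G)
    (hpp : p'.HolderConjugate p) (hC : 0 ≤ C) (i : Fin 2) (n : ℕ) :
    |pair (velFlux U i) (velForce G i) 0 (mol n (mol n (U i))) (fun k => mol n (mol n (D i k)))|
      ≤ 2 * (C * C * C) + 2 * N * C := by
  have := holderConjugate_dualExp hpp.lt
  have hconj := hpp.ennrealOfReal
  refine (abs_pair_mol_mol_le (a := p') (b := p) (q := 2 * p') (r := ENNReal.ofReal (dualExp p'))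
    hpp.symm.lt.le (by linarith [hpp.lt]) (h.memLp_velFlux hpp i) (h.memLp_velForce i) MemLp.zero
    (Lp.memLp (U i)) (h.U_q i) (h.D_p i) n).trans ?_
  rw [nrm_zero, zero_mul, add_zero, Fin.sum_univ_two]
  have hk : ∀ k, nrm (ENNReal.ofReal p') (velFlux U i k) * nrm (ENNReal.ofReal p) (D i k)
      ≤ C * C * C := fun k =>
    mul_le_mul (h.nrm_velFlux_le hpp hC i k) (h.D_p_le i k) (nrm_nonneg _ _) (by positivity)
  have hN0 : 0 ≤ 2 * N := (nrm_nonneg _ _).trans (h.nrm_velForce_le i)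
  linarith [hk 0, hk 1, mul_le_mul (h.nrm_velForce_le i) (h.U_two i) (nrm_nonneg _ _) hN0]

theorem GoodSlice.tendsto_vel_pair (h : GoodSlice p p' C N U D A G)
    (hpp : p'.HolderConjugate p) (i : Fin 2) :
    Tendsto (fun n => pair (velFlux U i) (velForce G i) 0 (mol n (mol n (U i)))
      (fun k => mol n (mol n (D i k)))) atTop
      (𝓝 (pair (velFlux U i) (velForce G i) 0 (U i) (D i))) := by
  have := holderConjugate_dualExp hpp.lt
  have hconj := hpp.ennrealOfReal
  exact tendsto_pair_mol_mol (a := p') (b := p) (q := 2 * p') (r := ENNReal.ofReal (dualExp p'))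
    hpp.symm.lt.le (by linarith [hpp.lt]) (h.memLp_velFlux hpp i) (h.memLp_velForce i) MemLp.zero
    (Lp.memLp (U i)) (h.U_q i) (h.D_p i)

/-- The transport term `u ⊗ u : ∇u` vanishes by skew symmetry, which uses `u` in `L^{2p'}`; only the
work of the stress is left. -/
theorem GoodSlice.vel_pair (h : GoodSlice p p' C N U D A G) (hpp : p'.HolderConjugate p)
    (i : Fin 2) : pair (velFlux U i) (velForce G i) 0 (U i) (D i)
      = ∫ x, velForce G i x * U i x := by
  have h0 := integral_mul_grad_eq_zero hpp (fun k => Lp.memLp (U k)) h.U_q h.div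
    (Lp.memLp (U i)) (h.U_q i) (h.D_weak i) (h.D_p i)
  simp only [pair, velFlux, h0, Pi.zero_apply, zero_mul, integral_zero, zero_add, sub_zero]

end Slice

theorem divFree_mol {v : Fin 2 → Plane → ℝ} (hv : ∀ i, MemLp (v i) 2 volume) (hdiv : DivFree v)
    (n : ℕ) : DivFree (fun i => mol n (v i)) := by
  intro χ hχ hc
  have hw : ∀ i, ContDiff ℝ 1 (mol n (v i)) := fun i =>
    (contDiff_mol n (locallyIntegrable_of_memLp_two (hv i))).of_le (by simp)
  have hi : ∀ i, Integrable fun x => mol n (v i) x * partialDeriv i χ x := fun i =>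
    integrable_mul (p := 2) (q := 2) (memLp_mol_two n (hv i)) (memLp_partialDeriv hχ hc i)
  have hi' : ∀ i, Integrable fun x => partialDeriv i (mol n (v i)) x * χ x := fun i =>
    ((continuous_partialDeriv (hw i) i).mul hχ.continuous).integrable_of_hasCompactSupport
      hc.mul_left
  rw [integral_finsetSum _ fun i _ => hi i,
    Finset.sum_congr rfl fun i _ => (isWeakPartial_of_contDiff (hw i) i).2.2 χ hχ hc,
    Finset.sum_neg_distrib, ← integral_finsetSum _ fun i _ => hi' i, neg_eq_zero]
  rw [← integral_zero Plane ℝ]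
  congr 1; funext x
  rw [← Finset.sum_mul, conv_eq_zero_of_divFree hv hdiv n x, zero_mul]

/-- A mollified rotated gradient is the rotated gradient of the mollified potential, so mollifying a
test field keeps it admissible. -/
theorem mol_perp (n : ℕ) {χ : Plane → ℝ} (hχ : ContDiff ℝ ∞ χ) (i : Fin 2) :
    mol n (perp χ i) = perp (mol n χ) i := by
  have h : ∀ j, mol n (partialDeriv j χ) = partialDeriv j (mol n χ) := fun j =>
    ((isWeakPartial_of_contDiff (hχ.of_le (by simp)) j).partialDeriv_mol n).symm
  fin_cases i
  · have e : (fun x => - partialDeriv 1 χ x) = (-1 : ℝ) • partialDeriv 1 χ := by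
      funext x; simp
    change mol n (fun x => - partialDeriv 1 χ x) = fun x => - partialDeriv 1 (mol n χ) x
    funext x
    rw [← h 1, e, mol, conv_const_smul]
    simp [mol]
  · exact h 0

theorem contDiff_perp {χ : Plane → ℝ} (hχ : ContDiff ℝ ∞ χ) (i : Fin 2) :
    ContDiff ℝ ∞ (perp χ i) := by
  fin_cases i
  · exact (contDiff_partialDeriv hχ 1).neg
  · exact contDiff_partialDeriv hχ 0

theorem hasCompactSupport_perp {χ : Plane → ℝ} (hc : HasCompactSupport χ) (i : Fin 2) :
    HasCompactSupport (perp χ i) := by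
  fin_cases i
  · exact (hasCompactSupport_partialDeriv hc 1).neg
  · exact hasCompactSupport_partialDeriv hc 0

/-! ### Energy balance of the velocity -/

section Velocity

variable {T p p' C : ℝ} {N : ℝ → ℝ} {U : Fin 2 → ℝ → ScalL2} {D : Fin 2 → Fin 2 → ℝ → Plane → ℝ}
  {A : Fin 2 → Fin 2 → ℝ → ScalL2} {G : Fin 2 → Fin 2 → Fin 2 → ℝ → Plane → ℝ}
  {U₀ : Fin 2 → ScalL2}

/-- The right hand side of the momentum equation, tested. -/
def velRHS (U : Fin 2 → ℝ → ScalL2) (G : Fin 2 → Fin 2 → Fin 2 → ℝ → Plane → ℝ)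
    (i : Fin 2) (s : ℝ) (φ : Plane → ℝ) (φ' : Fin 2 → Plane → ℝ) : ℝ :=
  pair (velFlux (fun i => U i s) i) (velForce (fun i j k => G i j k s) i) 0 φ φ'

theorem EnergyClass.aestronglyMeasurable_velRHS (h : EnergyClass T p U D A G)
    (hgood : ∀ᵐ s ∂(volume.restrict (Ioc 0 T)), GoodSlice p p' C (N s) (fun i => U i s)
        (fun i j => D i j s) (fun i j => A i j s) (fun i j k => G i j k s))
    {χ : Plane → ℝ} (hχ : ContDiff ℝ ∞ χ) (hc : HasCompactSupport χ) (i : Fin 2) :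
    AEStronglyMeasurable (fun s => velRHS U G i s χ (fun k => partialDeriv k χ))
      (volume.restrict (Ioc 0 T)) := by
  have hd : ∀ k, ContDiff ℝ ∞ (partialDeriv k χ) := fun k => contDiff_partialDeriv hχ k
  have hdc : ∀ k, HasCompactSupport (partialDeriv k χ) := fun k =>
    hasCompactSupport_partialDeriv hc k
  have m1 : ∀ k, AEStronglyMeasurable (fun s => ∫ x, U k s x * U i s x * partialDeriv k χ x)
      (volume.restrict (Ioc 0 T)) := fun k => by
    obtain ⟨M, hM⟩ := (hd k).continuous.bounded_above_of_compact_support (hdc k)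
    exact aestronglyMeasurable_integral_mul_mul (h.U_meas k) (h.U_meas i) (hd k).continuous hM
  have m2 : ∀ j, AEStronglyMeasurable (fun s => ∫ x, G i j j s x * χ x)
      (volume.restrict (Ioc 0 T)) := fun j =>
    aestronglyMeasurable_integral_weakPartial_mul (h.A_meas i j)
      (h.G_weak.mono fun s hs => hs i j j) hχ hc
  have m : AEStronglyMeasurable (fun s => (∑ k, ∫ x, U k s x * U i s x * partialDeriv k χ x)
      + ∑ j, ∫ x, G i j j s x * χ x) (volume.restrict (Ioc 0 T)) :=
    (Finset.aestronglyMeasurable_fun_sum _ fun k _ => m1 k).add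
      (Finset.aestronglyMeasurable_fun_sum _ fun j _ => m2 j)
  refine m.congr ?_
  filter_upwards [hgood] with s hs
  have i2 : ∀ j, Integrable fun x => G i j j s x * χ x := fun j =>
    integrable_mul (p := 2) (q := 2) (hs.G_two i j j) (memLp_two_of_compact hχ.continuous hc)
  simp only [velRHS, pair, velFlux, velForce, Pi.zero_apply, zero_mul, integral_zero, sub_zero,
    Finset.sum_mul]
  rw [integral_finsetSum _ fun j _ => i2 j]

/-- The two components are treated together, since the equation is known only for rotated gradients.
It determines the functional only on their closed span, which contains the mollified velocity and
its initial value. -/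
theorem EnergyClass.vel_energy_mol (h : EnergyClass T p U D A G)
    (hT : 0 < T) (hpp : p'.HolderConjugate p) (hp : 3 / 2 < p) (hC : 0 ≤ C)
    (hN : IntegrableOn N (Ioc 0 T))
    (hgood : ∀ᵐ s ∂(volume.restrict (Ioc 0 T)), GoodSlice p p' C (N s) (fun i => U i s)
        (fun i j => D i j s) (fun i j => A i j s) (fun i j k => G i j k s))
    (hdiv : ∀ t ∈ Ico 0 T, DivFree (fun i => U i t)) (hdiv₀ : DivFree (fun i => U₀ i))
    (hw : ∀ χ : Plane → ℝ, ContDiff ℝ ∞ χ → HasCompactSupport χ → ∀ t ∈ Ico 0 T,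
      ∑ i, ∫ x, U i t x * perp χ i x = (∑ i, ∫ x, U₀ i x * perp χ i x)
        + ∫ s in (0 : ℝ)..t, ∑ i, velRHS U G i s (perp χ i) (fun k => partialDeriv k (perp χ i)))
    (n : ℕ) : ∀ t ∈ Ico 0 T,
      IntervalIntegrable (fun s => ∑ i, velRHS U G i s (mol n (mol n (U i s)))
        (fun k => mol n (mol n (D i k s)))) volume 0 t ∧
      ∑ i, ‖molL2 n (U i t)‖ ^ 2 = (∑ i, ‖molL2 n (U₀ i)‖ ^ 2) + 2 * ∫ s in (0 : ℝ)..t,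
        ∑ i, velRHS U G i s (mol n (mol n (U i s))) (fun k => mol n (mol n (D i k s))) := by
  have hconj := holderConjugate_dualExp hpp.lt
  obtain ⟨K, hK0, hK⟩ := exists_form_mol (q := 2 * p') (by linarith [hpp.lt])
    (by linarith [conj_lt_three hpp hp]) (r := ENNReal.ofReal (dualExp p')) n
  have hex : ∀ s, ∃ L : VelL2 →L[ℝ] ℝ, GoodSlice p p' C (N s) (fun i => U i s)
        (fun i j => D i j s) (fun i j => A i j s) (fun i j k => G i j k s) →
      (∀ e : VelL2, L e = ∑ i, velRHS U G i s (mol n (e i))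
        (fun k => conv (partialDeriv k (rho n)) (e i))) ∧
      ‖L‖ ≤ 2 * (K * (2 * (C * C) + 2 * N s)) := fun s => by
    by_cases hs : GoodSlice p p' C (N s) (fun i => U i s)
        (fun i j => D i j s) (fun i j => A i j s) (fun i j k => G i j k s)
    · choose L h1 h2 using fun i => hK _ _ _ (hs.memLp_velFlux_two i) (hs.memLp_velForce i)
        MemLp.zero
      refine ⟨∑ i, (L i).comp (PiLp.proj 2 (fun _ : Fin 2 => ScalL2) i), fun _ => ⟨fun e => ?_, ?_⟩⟩
      · rw [_root_.sum_apply]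
        exact Finset.sum_congr rfl fun i _ => h1 i (e i)
      · have hL : ∀ i, ‖L i‖ ≤ K * (2 * (C * C) + 2 * N s) := fun i =>
          (h2 i).trans (mul_le_mul_of_nonneg_left (hs.vel_sum_le hC _ i) hK0)
        have hb : ∀ i, ‖(L i).comp (PiLp.proj 2 (fun _ : Fin 2 => ScalL2) i)‖ ≤ ‖L i‖ := fun i =>
          ContinuousLinearMap.opNorm_le_bound _ (norm_nonneg _) fun e =>
            ((L i).le_opNorm _).trans
              (mul_le_mul_of_nonneg_left (PiLp.norm_apply_le e i) (norm_nonneg _))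
        refine (norm_sum_le _ _).trans ?_
        rw [Fin.sum_univ_two]
        linarith [hL 0, hL 1, hb 0, hb 1]
    · exact ⟨0, fun h => absurd h hs⟩
  choose B hB using hex
  have hBe : ∀ {χ : Plane → ℝ} (hχ : ContDiff ℝ ∞ χ) (hc : HasCompactSupport χ),
      ∀ᵐ s ∂(volume.restrict (Ioc 0 T)), ∑ i, velRHS U G i s (perp (mol n χ) i)
        (fun k => partialDeriv k (perp (mol n χ) i)) = B s (toVel (memLp_perp hχ hc)) := by
    intro χ hχ hc
    filter_upwards [hgood] with s hs
    rw [(hB s hs).1]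
    have e1 : ∀ (k : Plane → ℝ) i, conv k (toVel (memLp_perp hχ hc) i) = conv k (perp χ i) :=
      fun k i => conv_congr (toVel_coe (memLp_perp hχ hc) i)
    refine Finset.sum_congr rfl fun i _ => ?_
    simp only [← mol_perp n hχ]
    simp only [mol, e1]
    congr 1; funext k
    exact partialDeriv_conv ((rho_contDiff n).of_le (by simp)) (rho_compact n)
      (contDiff_perp hχ i).continuous.locallyIntegrable k
  set w : (Fin 2 → ScalL2) → VelL2 := fun f => WithLp.toLp 2 fun i => molL2 n (f i) with hwdef
  have hwi : ∀ f {χ : Plane → ℝ} (hχ : ContDiff ℝ ∞ χ) (hc : HasCompactSupport χ),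
      inner ℝ (w f) (toVel (memLp_perp hχ hc)) = ∑ i, ∫ x, f i x * perp (mol n χ) i x := by
    intro f χ hχ hc
    rw [PiLp.inner_apply]
    refine Finset.sum_congr rfl fun i _ => ?_
    rw [show (w f) i = molL2 n (f i) from rfl, inner_molL2, inner_scalL2]
    refine integral_congr_ae ?_
    filter_upwards [molL2_coe n (toVel (memLp_perp hχ hc) i)] with x hx
    rw [hx, ← mol_perp n hχ, mol, conv_congr (toVel_coe (memLp_perp hχ hc) i), mol]
  -- Mollification preserves the divergence condition, and density of rotated gradients then places
  -- the mollified field in the closed span required by the abstract identity.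
  have hwS : ∀ f : Fin 2 → ScalL2, DivFree (fun i => f i) →
      w f ∈ (Submodule.span ℝ perpSet).topologicalClosure := fun f hf => by
    refine mem_closure_span_of_divFree fun χ hχ hc => ?_
    rw [← divFree_mol (fun i => Lp.memLp (f i)) hf n χ hχ hc]
    refine integral_congr_ae ?_
    filter_upwards [molL2_coe n (f 0), molL2_coe n (f 1)] with x h0 h1
    simp only [Fin.sum_univ_two, hwdef, h0, h1]
  have hwn : ∀ f, ‖w f‖ ^ 2 = ∑ i, ‖molL2 n (f i)‖ ^ 2 := fun f => PiLp.norm_sq_eq_of_L2 _ _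
  have hAi := energy_identity (S := perpSet) (w := fun s => w fun i => U i s)
    (w₀ := w U₀) (B := B) (g := fun s => 2 * (K * (2 * (C * C) + 2 * N s))) hT
    (by
      rw [intervalIntegrable_iff_integrableOn_Ioc_of_le hT.le]
      exact (((integrable_const (2 * (C * C))).add (hN.const_mul 2)).const_mul _).const_mul _)
    (hgood.mono fun s hs => (hB s hs).2)
    (by
      rintro e ⟨χ, hχ, hc, rfl⟩
      have hm := contDiff_mol n hχ.continuous.locallyIntegrable
      exact (Finset.aestronglyMeasurable_fun_sum _ fun i _ =>
        h.aestronglyMeasurable_velRHS hgood (contDiff_perp hm i)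
        (hasCompactSupport_perp (hasCompactSupport_mol n hc) i) i).congr (hBe hχ hc))
    (by
      rintro t ht e ⟨χ, hχ, hc, rfl⟩
      have h1 := hw _ (contDiff_mol n hχ.continuous.locallyIntegrable)
        (hasCompactSupport_mol n hc) t ht
      rw [hwi _ hχ hc, hwi _ hχ hc, h1, integral_congr_Ioc ht.1 ht.2.le (hBe hχ hc)])
    (fun t ht => hwS _ (hdiv t ht)) (hwS _ hdiv₀)
  have hcong : ∀ᵐ s ∂(volume.restrict (Ioc 0 T)), B s (w fun i => U i s)
      = ∑ i, velRHS U G i s (mol n (mol n (U i s))) (fun k => mol n (mol n (D i k s))) := by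
    filter_upwards [hgood] with s hs
    rw [(hB s hs).1]
    refine Finset.sum_congr rfl fun i _ => ?_
    rw [show (w fun i => U i s) i = molL2 n (U i s) from rfl, mol_molL2]
    congr 1; funext k
    exact conv_partialDeriv_molL2 n (hs.D_weak i k)
  intro t ht
  obtain ⟨h1, h2⟩ := hAi t ht
  refine ⟨intervalIntegrable_congr_Ioc ht.1 ht.2.le hcong h1, ?_⟩
  rw [← hwn, h2, hwn, integral_congr_Ioc ht.1 ht.2.le hcong]

/-- Energy balance of the velocity. -/
theorem EnergyClass.vel_energy (h : EnergyClass T p U D A G)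
    (hT : 0 < T) (hpp : p'.HolderConjugate p) (hp : 3 / 2 < p) (hC : 0 ≤ C)
    (hN : IntegrableOn N (Ioc 0 T))
    (hgood : ∀ᵐ s ∂(volume.restrict (Ioc 0 T)), GoodSlice p p' C (N s) (fun i => U i s)
        (fun i j => D i j s) (fun i j => A i j s) (fun i j k => G i j k s))
    (hdiv : ∀ t ∈ Ico 0 T, DivFree (fun i => U i t)) (hdiv₀ : DivFree (fun i => U₀ i))
    (hw : ∀ χ : Plane → ℝ, ContDiff ℝ ∞ χ → HasCompactSupport χ → ∀ t ∈ Ico 0 T,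
      ∑ i, ∫ x, U i t x * perp χ i x = (∑ i, ∫ x, U₀ i x * perp χ i x)
        + ∫ s in (0 : ℝ)..t, ∑ i, velRHS U G i s (perp χ i)
          (fun k => partialDeriv k (perp χ i))) :
    ∀ t ∈ Ico 0 T,
      IntervalIntegrable (fun s => ∑ i, ∫ x, velForce (fun i j k => G i j k s) i x * U i s x)
        volume 0 t ∧
      ∑ i, ‖U i t‖ ^ 2 = (∑ i, ‖U₀ i‖ ^ 2) + 2 * ∫ s in (0 : ℝ)..t,
        ∑ i, ∫ x, velForce (fun i j k => G i j k s) i x * U i s x := by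
  intro t ht
  have hm := fun n => h.vel_energy_mol hT hpp hp hC hN hgood hdiv hdiv₀ hw n t ht
  have hg : IntegrableOn (fun s => 2 * (2 * (C * C * C) + 2 * N s * C)) (Ioc 0 t) :=
    IntegrableOn.mono_set (((integrable_const (2 * (C * C * C))).add
      ((hN.const_mul 2).mul_const C)).const_mul _) (Ioc_subset_Ioc_right ht.2.le)
  refine limit_integral_identity ht.1 (fun n => (hm n).1) (fun n => (hm n).2) hg
    (fun n => ?_) ?_ (tendsto_finsetSum _ fun i _ => (molL2_tendsto _).norm.pow 2)
    (tendsto_finsetSum _ fun i _ => (molL2_tendsto _).norm.pow 2)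
  · filter_upwards [ae_restrict_Ioc_mono ht.2.le hgood] with s hs
    refine (Finset.abs_sum_le_sum_abs _ _).trans ?_
    have h1 := fun i => hs.abs_vel_pair_mol_mol_le hpp hC i n
    rw [Fin.sum_univ_two]
    exact (add_le_add (h1 0) (h1 1)).trans_eq (by ring)
  · filter_upwards [ae_restrict_Ioc_mono ht.2.le hgood] with s hs
    refine tendsto_finsetSum _ fun i _ => ?_
    rw [← hs.vel_pair hpp i]
    exact hs.tendsto_vel_pair hpp i

end Velocity

/-! ### Components of vector and matrix fields -/

section Components

variable {ι : Type*} [Fintype ι]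

/-- Components of a square integrable vector field. -/
def comp (i : ι) : Lp (EuclideanSpace ℝ ι) 2 (volume : Measure Plane) →L[ℝ] ScalL2 :=
  (EuclideanSpace.proj i : EuclideanSpace ℝ ι →L[ℝ] ℝ).compLpL 2 volume

theorem comp_coe (i : ι) (f : Lp (EuclideanSpace ℝ ι) 2 (volume : Measure Plane)) :
    comp i f =ᵐ[volume] fun x => f x i :=
  ContinuousLinearMap.coeFn_compLpL _ f

theorem norm_sq_eq_sum_comp (f : Lp (EuclideanSpace ℝ ι) 2 (volume : Measure Plane)) :
    ‖f‖ ^ 2 = ∑ i, ‖comp i f‖ ^ 2 := by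
  have hi : ∀ i, Integrable fun x => comp i f x * comp i f x := fun i =>
    integrable_mul (p := 2) (q := 2) (Lp.memLp _) (Lp.memLp _)
  simp only [← real_inner_self_eq_norm_sq, inner_scalL2]
  rw [← integral_finsetSum _ fun i _ => hi i, L2.inner_def]
  refine integral_congr_ae ?_
  filter_upwards [ae_all_iff.2 fun i => comp_coe i f] with x hx
  rw [PiLp.inner_apply]
  exact Finset.sum_congr rfl fun i _ => by rw [hx i]; simp [sq]

theorem norm_comp_le (i : ι) (f : Lp (EuclideanSpace ℝ ι) 2 (volume : Measure Plane)) :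
    ‖comp i f‖ ≤ ‖f‖ := by
  have h := norm_sq_eq_sum_comp f
  have h1 := Finset.single_le_sum (f := fun i => ‖comp i f‖ ^ 2) (fun _ _ => sq_nonneg _)
    (Finset.mem_univ i)
  exact le_of_sq_le_sq (by simpa [h] using h1) (norm_nonneg _)

theorem eLpNorm_comp_le (i : ι) {f : Lp (EuclideanSpace ℝ ι) 2 (volume : Measure Plane)} {C : ℝ}
    (h : ‖f‖ ≤ C) : eLpNorm (comp i f) 2 volume ≤ (C.toNNReal : ℝ≥0∞) := by
  rw [← Lp.enorm_def, ← ofReal_norm]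
  exact ENNReal.ofReal_le_ofReal ((norm_comp_le i f).trans h)

theorem IsWeakPartial.congr {j : Fin 2} {f f' g : Plane → ℝ} (h : IsWeakPartial j f g)
    (he : f =ᵐ[volume] f') : IsWeakPartial j f' g := by
  refine ⟨fun x => ?_, h.2.1, fun χ hχ hc => ?_⟩
  · obtain ⟨s, hs, hi⟩ := h.1 x
    exact ⟨s, hs, hi.congr (ae_restrict_of_ae he)⟩
  · rw [← h.2.2 χ hχ hc]
    refine integral_congr_ae ?_
    filter_upwards [he] with x hx
    rw [hx]

theorem IsDivFree.divFree_comp {v : VecL2} (h : IsDivFree v) : DivFree (fun i => comp i v) := by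
  intro χ hχ hc
  rw [← h χ hχ hc]
  refine integral_congr_ae ?_
  filter_upwards [ae_all_iff.2 fun i => comp_coe i v] with x hx
  exact Finset.sum_congr rfl fun i _ => by rw [hx i]

end Components

instance : SecondCountableTopology MatL2 :=
  haveI : Fact ((2 : ℝ≥0∞) ≠ ⊤) := ⟨by norm_num⟩
  Lp.SecondCountableTopology

/-! ### From weak solutions to integrated scalar equations -/

section Solution

variable {T p : ℝ} {u₀ : VecL2} {τ₀ : MatL2} {u : ℝ → VecL2} {τ : ℝ → MatL2}

theorem restrict_Ioo_eq_Ioc (T : ℝ) :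
    (volume : Measure ℝ).restrict (Ioo 0 T) = volume.restrict (Ioc 0 T) :=
  Measure.restrict_congr_set Ioo_ae_eq_Ioc

/-- The stress is only weakly continuous in time; separability of `L²` upgrades this to strong
measurability. -/
theorem IsWeakSolution.energyClass (h : IsWeakSolution T 1 1 p u₀ τ₀ u τ) :
    EnergyClass T p (fun i s => comp i (u s)) (fun i j s => weakPartial j (fun x => u s x i))
      (fun i j s => comp (i, j) (τ s)) (fun i j k s => weakPartial k (fun x => τ s x (i, j))) := by
  have hτm : AEStronglyMeasurable τ (volume.restrict (Ioc 0 T)) :=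
    aestronglyMeasurable_of_inner fun e =>
      ((h.τ_cont e).mono Ioc_subset_Icc_self).aestronglyMeasurable measurableSet_Ioc
  obtain ⟨Cu, hCu⟩ := isCompact_Icc.exists_bound_of_continuousOn h.u_cont
  obtain ⟨CD, hCD⟩ := h.u_grad
  obtain ⟨Cτ, hCτ⟩ := h.τ_bdd
  have hG := h.τ_grad
  have hGs := h.τ_grad_sq
  rw [restrict_Ioo_eq_Ioc] at hCD hCτ hG hGs
  exact
    { U_meas := fun i => (comp i).continuous.comp_aestronglyMeasurable
        ((h.u_cont.mono Ioc_subset_Icc_self).aestronglyMeasurable measurableSet_Ioc)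
      U_bdd := ⟨Cu.toNNReal, (ae_restrict_iff' measurableSet_Ioc).2 (Eventually.of_forall
        fun s hs i => eLpNorm_comp_le i (hCu s (Ioc_subset_Icc_self hs)))⟩
      D_weak := hCD.mono fun s hs i j => (hs i j).1.isWeakPartial.congr (comp_coe i (u s)).symm
      D_bdd := ⟨CD, hCD.mono fun s hs i j => (hs i j).2⟩
      U_div := (ae_restrict_iff' measurableSet_Ioc).2 (Eventually.of_forall
        fun s hs => (h.u_div s (Ioc_subset_Icc_self hs)).divFree_comp)
      A_meas := fun i j => (comp (i, j)).continuous.comp_aestronglyMeasurable hτm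
      A_bdd := ⟨Cτ.toNNReal, hCτ.mono fun s hs i j => eLpNorm_comp_le (i, j) hs⟩
      G_weak := hG.mono fun s hs i j k =>
        (hs i j k).isWeakPartial.congr (comp_coe (i, j) (τ s)).symm
      G_sq := hGs }

theorem isTestFun_smul {F : Type*} [NormedAddCommGroup F] [NormedSpace ℝ F] {θ : ℝ → ℝ}
    {χ : Plane → F} (hθ : ContDiff ℝ ∞ θ) (hθc : HasCompactSupport θ) (hθT : tsupport θ ⊆ Iio T)
    (hχ : ContDiff ℝ ∞ χ) (hχc : HasCompactSupport χ) : IsTestFun T (fun t x => θ t • χ x) := by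
  have hsub : tsupport (fun z : ℝ × Plane => θ z.1 • χ z.2) ⊆ tsupport θ ×ˢ tsupport χ := by
    refine closure_minimal (fun z hz => ?_)
      ((isClosed_tsupport θ).prod (isClosed_tsupport χ))
    rw [Function.mem_support] at hz
    exact ⟨subset_tsupport θ fun h0 => hz (by rw [h0, zero_smul]),
      subset_tsupport χ fun h0 => hz (by rw [h0, smul_zero])⟩
  exact ⟨(hθ.comp contDiff_fst).smul (hχ.comp contDiff_snd),
    (hθc.isCompact.prod hχc.isCompact).of_isClosed_subset (isClosed_tsupport _) hsub,
    hsub.trans (prod_mono hθT (subset_univ _))⟩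

theorem pair_eq_integral {m : Fin 2 → Plane → ℝ} {h Q φ : Plane → ℝ} {φ' : Fin 2 → Plane → ℝ}
    (hm : ∀ k, Integrable fun x => m k x * φ' k x) (hh : Integrable fun x => h x * φ x)
    (hQ : Integrable fun x => Q x * φ x) :
    pair m h Q φ φ' = ∫ x, ((∑ k, m k x * φ' k x) + h x * φ x - Q x * φ x) := by
  rw [pair, ← integral_finsetSum _ fun k _ => hm k,
    ← integral_add (integrable_finsetSum _ fun k _ => hm k) hh]
  exact (integral_sub ((integrable_finsetSum _ fun k _ => hm k).add hh) hQ).symm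

theorem partialDeriv_const_mul (c : ℝ) {f : Plane → ℝ} (hf : Differentiable ℝ f) (k : Fin 2)
    (x : Plane) : partialDeriv k (fun y => c * f y) x = c * partialDeriv k f x := by
  simp [partialDeriv, fderiv_const_mul (hf x)]

end Solution

variable {T p p' C : ℝ} {N : ℝ → ℝ} {u₀ : VecL2} {τ₀ : MatL2} {u : ℝ → VecL2} {τ : ℝ → MatL2}

theorem abs_pair_le_mul {a b q r : ℝ≥0∞} [a.HolderConjugate b] [r.HolderConjugate q]
    {m : Fin 2 → Plane → ℝ} {h Q φ : Plane → ℝ} {φ' : Fin 2 → Plane → ℝ} {X : ℝ}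
    (hm : ∀ k, MemLp (m k) a volume) (hh : MemLp h 2 volume) (hQ : MemLp Q r volume)
    (hφ : MemLp φ 2 volume) (hφq : MemLp φ q volume) (hφ' : ∀ k, MemLp (φ' k) b volume)
    (h1 : nrm 2 φ ≤ X) (h2 : nrm q φ ≤ X) (h3 : ∀ k, nrm b (φ' k) ≤ X) :
    |pair m h Q φ φ'| ≤ ((∑ k, nrm a (m k)) + nrm 2 h + nrm r Q) * X := by
  refine (abs_pair_le hm hh hQ hφ hφq hφ').trans ?_
  rw [add_mul, add_mul, Finset.sum_mul]
  exact add_le_add (add_le_add (Finset.sum_le_sum fun k _ => mul_le_mul_of_nonneg_left (h3 k)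
    (nrm_nonneg _ _)) (mul_le_mul_of_nonneg_left h1 (nrm_nonneg _ _)))
    (mul_le_mul_of_nonneg_left h2 (nrm_nonneg _ _))

theorem exists_nrm_bound (χ : Plane → ℝ) (q : ℝ≥0∞) : ∃ X : ℝ, 0 ≤ X ∧ nrm 2 χ ≤ X ∧
    nrm q χ ≤ X ∧ ∀ k, nrm 2 (partialDeriv k χ) ≤ X := by
  have h1 : 0 ≤ nrm 2 χ := nrm_nonneg _ _
  have h2 : 0 ≤ nrm q χ := nrm_nonneg _ _
  have h3 : ∀ k, 0 ≤ nrm 2 (partialDeriv k χ) := fun k => nrm_nonneg _ _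
  refine ⟨nrm 2 χ + nrm q χ + nrm 2 (partialDeriv 0 χ) + nrm 2 (partialDeriv 1 χ), ?_, ?_, ?_,
    fun k => ?_⟩
  any_goals linarith [h3 0, h3 1]
  fin_cases k <;> simp only [Fin.zero_eta, Fin.mk_one] <;> linarith [h3 0, h3 1]

/-- The adjoint of the component map turns a scalar test function into an admissible element of the
full `L²` space. -/
theorem continuousOn_inner_comp {ι : Type*} [Fintype ι] {S : Set ℝ}
    {f : ℝ → Lp (EuclideanSpace ℝ ι) 2 (volume : Measure Plane)}
    (hf : ∀ σ, ContinuousOn (fun t => inner ℝ (f t) σ) S) (i : ι) {χ : Plane → ℝ}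
    (hχ : MemLp χ 2 volume) : ContinuousOn (fun t => ∫ x, comp i (f t) x * χ x) S := by
  refine (hf ((comp i).adjoint (hχ.toLp χ))).congr fun t _ => ?_
  simp only
  rw [ContinuousLinearMap.adjoint_inner_right, inner_scalL2]
  refine integral_congr_ae ?_
  filter_upwards [hχ.coeFn_toLp] with x hx
  rw [hx]

theorem intervalIntegrable_of_forall_le {f : ℝ → ℝ} (hT : 0 < T) {K : ℝ}
    (hN : IntegrableOn N (Ioc 0 T)) (hf : AEStronglyMeasurable f (volume.restrict (Ioc 0 T)))
    (hle : ∀ᵐ s ∂(volume.restrict (Ioc 0 T)), |f s| ≤ K * (1 + N s)) :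
    IntervalIntegrable f volume 0 T := by
  rw [intervalIntegrable_iff_integrableOn_Ioc_of_le hT.le]
  exact (((integrable_const (1 : ℝ)).add hN).const_mul K).mono' hf hle

/-- The matrix field whose only nonzero entry is `χ`, in position `(i, j)`. -/
def entryField (i j : Fin 2) (χ : Plane → ℝ) (x : Plane) : Mat :=
  WithLp.toLp 2 fun ab => (if ab = (i, j) then 1 else 0) * χ x

theorem entryField_apply (i j : Fin 2) (χ : Plane → ℝ) (x : Plane) (ab : Fin 2 × Fin 2) :
    entryField i j χ x ab = (if ab = (i, j) then 1 else 0) * χ x := rfl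

theorem isTestFun_entryField {θ : ℝ → ℝ} {χ : Plane → ℝ} (hθ : ContDiff ℝ ∞ θ)
    (hθc : HasCompactSupport θ) (hθT : tsupport θ ⊆ Iio T)
    (hχ : ContDiff ℝ ∞ χ) (hχc : HasCompactSupport χ) (i j : Fin 2) :
    IsTestFun T (fun t x => θ t • entryField i j χ x) := by
  refine isTestFun_smul hθ hθc hθT ?_ ?_
  · rw [contDiff_euclidean]
    exact fun ab => contDiff_const.mul hχ
  · refine hχc.mono' fun x hx => subset_tsupport χ fun h0 => hx ?_
    ext ab
    rw [entryField_apply, h0, mul_zero]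
    rfl

theorem corotQ_vorticity_apply (v : Plane → Plane) (B : Mat) (x : Plane) (i j : Fin 2) :
    corotQ (vorticity v x) B.toMatrix i j
      = (1 / 2) * ∑ l, ((weakPartial j (fun y => v y l) x * B (i, l)
            - weakPartial l (fun y => v y j) x * B (i, l))
          - (weakPartial l (fun y => v y i) x * B (l, j)
            - weakPartial i (fun y => v y l) x * B (l, j))) := by
  simp only [corotQ, vorticity, gradU, Mat.toMatrix, Matrix.sub_apply, Matrix.mul_apply,
    Matrix.smul_apply, Matrix.transpose_apply, Matrix.of_apply, Fin.sum_univ_two, smul_eq_mul]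
  ring

theorem sum_entry (i j : Fin 2) (f : Fin 2 → Fin 2 → ℝ) :
    ∑ a, ∑ b, (if (a, b) = (i, j) then (1 : ℝ) else 0) * f a b = f i j := by
  fin_cases i <;> fin_cases j <;> simp [Fin.sum_univ_two]

/-- The stress equation for one entry, in integrated form. -/
theorem IsWeakSolution.stress_weak (h : IsWeakSolution T 1 1 p u₀ τ₀ u τ) (hT : 0 < T)
    (hpp : p'.HolderConjugate p) (hC : 0 ≤ C) (hN0 : ∀ s, 0 ≤ N s)
    (hN : IntegrableOn N (Ioc 0 T))
    (hgood : ∀ᵐ s ∂(volume.restrict (Ioc 0 T)), GoodSlice p p' C (N s) (fun i => comp i (u s))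
        (fun i j => weakPartial j (fun x => u s x i)) (fun i j => comp (i, j) (τ s))
        (fun i j k => weakPartial k (fun x => τ s x (i, j))))
    (i j : Fin 2) {χ : Plane → ℝ} (hχ : ContDiff ℝ ∞ χ) (hc : HasCompactSupport χ) :
    ∀ t ∈ Icc 0 T, ∫ x, comp (i, j) (τ t) x * χ x = (∫ x, comp (i, j) τ₀ x * χ x)
      + ∫ s in (0 : ℝ)..t, stressRHS (fun i s => comp i (u s))
        (fun i j s => weakPartial j (fun x => u s x i)) (fun i j s => comp (i, j) (τ s))
        (fun i j k s => weakPartial k (fun x => τ s x (i, j))) i j s χ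
        (fun k => partialDeriv k χ) := by
  have hconj := holderConjugate_dualExp hpp.lt
  have hχ2 : MemLp χ 2 volume := memLp_two_of_compact hχ.continuous hc
  have hχd : Differentiable ℝ χ := hχ.differentiable (by simp)
  have hχq : MemLp χ (ENNReal.ofReal (2 * p')) volume :=
    hχ.continuous.memLp_of_hasCompactSupport hc
  obtain ⟨X, hX0, hX1, hX2, hX3⟩ := exists_nrm_bound χ (ENNReal.ofReal (2 * p'))
  refine eq_add_integral_of_weak hT (continuousOn_inner_comp h.τ_cont (i, j) hχ2)
    (intervalIntegrable_of_forall_le (K := (6 * C ^ 2 + C + 2) * X) hT hN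
      (h.energyClass.aestronglyMeasurable_stressRHS hpp hgood hχ hc i j) ?_) fun θ hθ hθc hθT => ?_
  · filter_upwards [hgood] with s hs
    have hle := hs.stress_sum_le hpp hC (hN0 s) i j
    have hh : MemLp (fun x => - comp (i, j) (τ s) x) 2 volume :=
      (Lp.memLp (comp (i, j) (τ s))).neg
    have hab := abs_pair_le_mul (a := 2) (b := 2) (q := ENNReal.ofReal (2 * p'))
      (r := ENNReal.ofReal (dualExp p')) (X := X) (hs.memLp_stressFlux i j)
      hh (hs.memLp_stressRot hpp i j) hχ2 hχq
      (fun k => memLp_partialDeriv hχ hc k) hX1 hX2 hX3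
    rw [mul_right_comm]
    exact hab.trans (mul_le_mul_of_nonneg_right hle hX0)
  · have hθd : Differentiable ℝ θ := hθ.differentiable (by simp)
    have hst := h.stress _ (isTestFun_entryField hθ hθc hθT hχ hc i j)
    have hpd : ∀ (t : ℝ) (ab : Fin 2 × Fin 2) (k : Fin 2) (x : Plane),
        partialDeriv k (fun y => (θ t • entryField i j χ y) ab) x
          = (if ab = (i, j) then 1 else 0) * (θ t * partialDeriv k χ x) := fun t ab k x => by
      have e : (fun y => (θ t • entryField i j χ y) ab)
          = fun y => (θ t * (if ab = (i, j) then 1 else 0)) * χ y := by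
        funext y
        rw [PiLp.smul_apply, entryField_apply, smul_eq_mul, mul_assoc]
      rw [e, partialDeriv_const_mul _ hχd]; ring
    have hdt : ∀ (t : ℝ) (ab : Fin 2 × Fin 2) (x : Plane),
        deriv (fun s => (θ s • entryField i j χ x) ab) t
          = (if ab = (i, j) then 1 else 0) * (deriv θ t * χ x) := fun t ab x => by
      simp only [PiLp.smul_apply, entryField_apply, smul_eq_mul]
      rw [deriv_mul_const (hθd t)]; ring
    have hval : ∀ (t : ℝ) (ab : Fin 2 × Fin 2) (x : Plane), (θ t • entryField i j χ x) ab
        = (if ab = (i, j) then 1 else 0) * (θ t * χ x) := fun t ab x => by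
      rw [PiLp.smul_apply, entryField_apply, smul_eq_mul]; ring
    -- Used to pull the indicator of the entry `(i, j)` in front of each summand, so that the sums
    -- over matrix entries collapse to that entry.
    have hcomm : ∀ a b c : ℝ, a * (b * c) = b * (a * c) := mul_left_comm
    simp only [hpd, hdt] at hst
    simp only [hval, hcomm _ (ite _ _ _) _, ← Finset.mul_sum] at hst
    simp only [sum_entry] at hst
    have hrhs : ∫ x, τ₀ x (i, j) * (θ 0 * χ x) = (∫ x, comp (i, j) τ₀ x * χ x) * θ 0 := by
      rw [← integral_mul_const]
      refine integral_congr_ae ?_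
      filter_upwards [comp_coe (i, j) τ₀] with x hx
      rw [hx]; ring
    rw [hrhs] at hst
    rw [← hst]
    refine integral_congr_Ioc hT.le le_rfl ?_
    filter_upwards [hgood] with s hs
    have i1 : ∀ k, Integrable fun x => stressFlux (fun i => comp i (u s))
        (fun i j => comp (i, j) (τ s)) (fun i j k => weakPartial k (fun x => τ s x (i, j))) i j k x
          * partialDeriv k χ x := fun k =>
      integrable_mul (p := 2) (q := 2) (hs.memLp_stressFlux i j k) (memLp_partialDeriv hχ hc k)
    have i2 : Integrable fun x => - comp (i, j) (τ s) x * χ x :=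
      integrable_mul (p := 2) (q := 2) (Lp.memLp (comp (i, j) (τ s))).neg hχ2
    have i3 := integrable_mul (hs.memLp_stressRot hpp i j) hχq
    have i0 : Integrable fun x => comp (i, j) (τ s) x * χ x :=
      integrable_mul (p := 2) (q := 2) (Lp.memLp (comp (i, j) (τ s))) hχ2
    rw [stressRHS, pair_eq_integral i1 i2 i3, ← integral_const_mul, ← integral_const_mul]
    refine (integral_add (i0.const_mul _)
      ((((integrable_finsetSum _ fun k _ => i1 k).add i2).sub i3).const_mul _)).symm.trans
      (integral_congr_ae ?_)
    filter_upwards [ae_all_iff.2 fun i => comp_coe i (u s),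
      ae_all_iff.2 fun ab => comp_coe ab (τ s)] with x hx1 hx2
    simp only [Pi.add_apply, Pi.sub_apply, stressFlux, stressRot, hx1, hx2,
      corotQ_vorticity_apply, Fin.sum_univ_two]
    ring

variable {T p p' C : ℝ} {N : ℝ → ℝ} {u₀ : VecL2} {τ₀ : MatL2} {u : ℝ → VecL2} {τ : ℝ → MatL2}

/-- The rotated gradient as a vector field. -/
def perpField (χ : Plane → ℝ) (x : Plane) : Plane := WithLp.toLp 2 fun i => perp χ i x

theorem perpField_apply (χ : Plane → ℝ) (x : Plane) (i : Fin 2) :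
    perpField χ x i = perp χ i x := rfl

theorem isTestFun_perpField {θ : ℝ → ℝ} {χ : Plane → ℝ} (hθ : ContDiff ℝ ∞ θ)
    (hθc : HasCompactSupport θ) (hθT : tsupport θ ⊆ Iio T)
    (hχ : ContDiff ℝ ∞ χ) (hχc : HasCompactSupport χ) :
    IsTestFun T (fun t x => θ t • perpField χ x) := by
  refine isTestFun_smul hθ hθc hθT ?_ ?_
  · rw [contDiff_euclidean]
    exact fun i => contDiff_perp hχ i
  · refine hχc.mono' fun x hx => by_contra fun hn => hx ?_
    have h0 : ∀ k, partialDeriv k χ x = 0 := fun k => by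
      rw [partialDeriv, Function.notMem_support.1 fun h => hn (support_fderiv_subset ℝ h),
        _root_.zero_apply]
    ext i
    rw [perpField_apply]
    fin_cases i <;> simp [perp, h0]

theorem sum_partialDeriv_perp {χ : Plane → ℝ} (hχ : ContDiff ℝ ∞ χ) (x : Plane) :
    ∑ i, partialDeriv i (perp χ i) x = 0 := by
  have e : partialDeriv 0 (fun x => - partialDeriv 1 χ x) x
      = - partialDeriv 0 (partialDeriv 1 χ) x := by
    rw [partialDeriv, fderiv_fun_neg, _root_.neg_apply, partialDeriv]
  rw [Fin.sum_univ_two]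
  change partialDeriv 0 (fun x => - partialDeriv 1 χ x) x + partialDeriv 1 (partialDeriv 0 χ) x = 0
  rw [e, partialDeriv_comm hχ 0 1]
  ring

/-- The momentum equation, in integrated form. -/
theorem IsWeakSolution.momentum_weak (h : IsWeakSolution T 1 1 p u₀ τ₀ u τ) (hT : 0 < T)
    (hpp : p'.HolderConjugate p) (hC : 0 ≤ C) (hN : IntegrableOn N (Ioc 0 T))
    (hgood : ∀ᵐ s ∂(volume.restrict (Ioc 0 T)), GoodSlice p p' C (N s) (fun i => comp i (u s))
        (fun i j => weakPartial j (fun x => u s x i)) (fun i j => comp (i, j) (τ s))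
        (fun i j k => weakPartial k (fun x => τ s x (i, j))))
    {χ : Plane → ℝ} (hχ : ContDiff ℝ ∞ χ) (hc : HasCompactSupport χ) :
    ∀ t ∈ Icc 0 T, ∑ i, ∫ x, comp i (u t) x * perp χ i x = (∑ i, ∫ x, comp i u₀ x * perp χ i x)
      + ∫ s in (0 : ℝ)..t, ∑ i, velRHS (fun i s => comp i (u s))
        (fun i j k s => weakPartial k (fun x => τ s x (i, j))) i s (perp χ i)
        (fun k => partialDeriv k (perp χ i)) := by
  have hconj := holderConjugate_dualExp hpp.lt
  have hP : ∀ i, ContDiff ℝ ∞ (perp χ i) := contDiff_perp hχ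
  have hPc : ∀ i, HasCompactSupport (perp χ i) := hasCompactSupport_perp hc
  have hP2 : ∀ i, MemLp (perp χ i) 2 volume := memLp_perp hχ hc
  have hPd : ∀ i, Differentiable ℝ (perp χ i) := fun i => (hP i).differentiable (by simp)
  have hPq : ∀ i, MemLp (perp χ i) (ENNReal.ofReal (2 * p')) volume := fun i =>
    (hP i).continuous.memLp_of_hasCompactSupport (hPc i)
  choose X hX0 hX1 hX2 hX3 using fun i => exists_nrm_bound (perp χ i) (ENNReal.ofReal (2 * p'))
  refine eq_add_integral_of_weak hT (continuousOn_finsetSum _ fun i _ =>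
      continuousOn_inner_comp (fun σ => h.u_cont.inner continuousOn_const) i (hP2 i))
    (intervalIntegrable_of_forall_le (K := (2 * (C * C) + 2) * (X 0 + X 1)) hT hN
      (Finset.aestronglyMeasurable_fun_sum _ fun i _ =>
        h.energyClass.aestronglyMeasurable_velRHS hgood (hP i) (hPc i) i) ?_) fun θ hθ hθc hθT => ?_
  · filter_upwards [hgood] with s hs
    have hN0 : 0 ≤ N s := (nrm_nonneg _ _).trans (hs.G_two_le 0 0 0)
    have hle : ∀ i, |velRHS (fun i s => comp i (u s))
        (fun i j k s => weakPartial k (fun x => τ s x (i, j))) i s (perp χ i)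
        (fun k => partialDeriv k (perp χ i))| ≤ (2 * (C * C) + 2) * (1 + N s) * X i := fun i => by
      have hab := abs_pair_le_mul (a := 2) (b := 2) (q := ENNReal.ofReal (2 * p'))
        (r := ENNReal.ofReal (dualExp p')) (X := X i) (hs.memLp_velFlux_two i)
        (hs.memLp_velForce i) (MemLp.zero (ε := ℝ)) (hP2 i) (hPq i)
        (fun k => memLp_partialDeriv (hP i) (hPc i) k) (hX1 i) (hX2 i) (hX3 i)
      refine hab.trans (mul_le_mul_of_nonneg_right ((hs.vel_sum_le hC _ i).trans ?_) (hX0 i))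
      have := mul_nonneg (mul_nonneg hC hC) hN0
      nlinarith
    refine (Finset.abs_sum_le_sum_abs _ _).trans ?_
    rw [Fin.sum_univ_two]
    exact (add_le_add (hle 0) (hle 1)).trans_eq (by ring)
  · have hθd : Differentiable ℝ θ := hθ.differentiable (by simp)
    have hpd : ∀ (t : ℝ) (i k : Fin 2) (x : Plane),
        partialDeriv k (fun y => (θ t • perpField χ y) i) x
          = θ t * partialDeriv k (perp χ i) x := fun t i k x => by
      have e : (fun y => (θ t • perpField χ y) i) = fun y => θ t * perp χ i y := by
        funext y
        rw [PiLp.smul_apply, perpField_apply, smul_eq_mul]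
      rw [e, partialDeriv_const_mul _ (hPd i)]
    have hdt : ∀ (t : ℝ) (i : Fin 2) (x : Plane),
        deriv (fun s => (θ s • perpField χ x) i) t = deriv θ t * perp χ i x := fun t i x => by
      simp only [PiLp.smul_apply, perpField_apply, smul_eq_mul]
      rw [deriv_mul_const (hθd t)]
    have hval : ∀ (t : ℝ) (i : Fin 2) (x : Plane), (θ t • perpField χ x) i
        = θ t * perp χ i x := fun t i x => by
      rw [PiLp.smul_apply, perpField_apply, smul_eq_mul]
    have hst := h.momentum _ (isTestFun_perpField hθ hθc hθT hχ hc) fun t _ x => by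
      simp only [hpd]
      rw [← Finset.mul_sum, sum_partialDeriv_perp hχ, mul_zero]
    simp only [hpd, hdt] at hst
    simp only [hval] at hst
    have hrhs : ∫ x, ∑ i, u₀ x i * (θ 0 * perp χ i x)
        = (∑ i, ∫ x, comp i u₀ x * perp χ i x) * θ 0 := by
      rw [← integral_finsetSum _ fun i _ => integrable_mul (p := 2) (q := 2)
        (Lp.memLp (comp i u₀)) (hP2 i), ← integral_mul_const]
      refine integral_congr_ae ?_
      filter_upwards [ae_all_iff.2 fun i => comp_coe i u₀] with x hx
      rw [Finset.sum_mul]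
      exact Finset.sum_congr rfl fun i _ => by rw [hx i]; ring
    rw [hrhs] at hst
    rw [← hst]
    refine integral_congr_Ioc hT.le le_rfl ?_
    filter_upwards [hgood] with s hs
    have i0 : ∀ i, Integrable fun x => comp i (u s) x * perp χ i x := fun i =>
      integrable_mul (p := 2) (q := 2) (Lp.memLp (comp i (u s))) (hP2 i)
    have i1 : ∀ i k, Integrable fun x => velFlux (fun i => comp i (u s)) i k x
        * partialDeriv k (perp χ i) x := fun i k =>
      integrable_mul (p := 2) (q := 2) (hs.memLp_velFlux_two i k)
        (memLp_partialDeriv (hP i) (hPc i) k)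
    have i2 : ∀ i j, Integrable fun x => comp (i, j) (τ s) x * partialDeriv j (perp χ i) x :=
      fun i j => integrable_mul (p := 2) (q := 2) (Lp.memLp (comp (i, j) (τ s)))
        (memLp_partialDeriv (hP i) (hPc i) j)
    have i3 : ∀ i j, Integrable fun x => weakPartial j (fun x => τ s x (i, j)) x * perp χ i x :=
      fun i j => integrable_mul (p := 2) (q := 2) (hs.G_two i j j) (hP2 i)
    -- The weak formulation contains `-τ : ∇ψ`, whereas the energy balance uses `div τ · ψ`; the
    -- weak derivative of `τ` converts one into the other.
    have hv : ∀ i, velRHS (fun i s => comp i (u s))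
        (fun i j k s => weakPartial k (fun x => τ s x (i, j))) i s (perp χ i)
        (fun k => partialDeriv k (perp χ i))
        = ∫ x, ((∑ k, velFlux (fun i => comp i (u s)) i k x * partialDeriv k (perp χ i) x)
          - ∑ j, comp (i, j) (τ s) x * partialDeriv j (perp χ i) x) := fun i => by
      rw [integral_sub (integrable_finsetSum _ fun k _ => i1 i k)
        (integrable_finsetSum _ fun j _ => i2 i j), integral_finsetSum _ fun k _ => i1 i k,
        integral_finsetSum _ fun j _ => i2 i j,
        Finset.sum_congr rfl fun j _ => (hs.G_weak i j j).2.2 _ (hP i) (hPc i),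
        Finset.sum_neg_distrib, ← integral_finsetSum _ fun j _ => i3 i j]
      simp only [velRHS, pair, velForce, Pi.zero_apply, zero_mul, integral_zero, sub_zero,
        Finset.sum_mul, sub_neg_eq_add]
    have i4 : ∀ i, Integrable fun x =>
        (∑ k, velFlux (fun i => comp i (u s)) i k x * partialDeriv k (perp χ i) x)
          - ∑ j, comp (i, j) (τ s) x * partialDeriv j (perp χ i) x := fun i =>
      (integrable_finsetSum _ fun k _ => i1 i k).sub (integrable_finsetSum _ fun j _ => i2 i j)
    rw [Finset.sum_congr rfl fun i _ => hv i, ← integral_finsetSum _ fun i _ => i0 i,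
      ← integral_finsetSum _ fun i _ => i4 i, ← integral_const_mul, ← integral_const_mul]
    refine (integral_add ((integrable_finsetSum _ fun i _ => i0 i).const_mul _)
      ((integrable_finsetSum _ fun i _ => i4 i).const_mul _)).symm.trans (integral_congr_ae ?_)
    filter_upwards [ae_all_iff.2 fun i => comp_coe i (u s),
      ae_all_iff.2 fun ab => comp_coe ab (τ s)] with x hx1 hx2
    simp only [velFlux, hx1, hx2, Fin.sum_univ_two]
    ring

/-! ### Energy identities for weak solutions -/

variable {T p : ℝ} {u₀ : VecL2} {τ₀ : MatL2} {u : ℝ → VecL2} {τ : ℝ → MatL2}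

theorem exists_holderConjugate (hp : 3 / 2 < p) : ∃ p' : ℝ, p'.HolderConjugate p :=
  ⟨_, (Real.HolderConjugate.conjExponent (by linarith)).symm⟩

theorem IsWeakSolution.vel_energy (h : IsWeakSolution T 1 1 p u₀ τ₀ u τ) (hT : 0 < T)
    (hp : 3 / 2 < p) (hu₀ : IsDivFree u₀) {t : ℝ} (ht : t ∈ Ico 0 T) :
    IntervalIntegrable (fun s => ∫ x, ∑ i, u s x i * divMat (τ s) x i) volume 0 t ∧
      ‖u t‖ ^ 2 = ‖u₀‖ ^ 2 + 2 * ∫ s in (0 : ℝ)..t, ∫ x, ∑ i, u s x i * divMat (τ s) x i := by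
  obtain ⟨p', hpp⟩ := exists_holderConjugate hp
  obtain ⟨C, N, hC, hN0, hN, hN2, hgood⟩ := h.energyClass.exists_goodSlice hpp hp
  obtain ⟨h1, h2⟩ := h.energyClass.vel_energy (U₀ := fun i => comp i u₀) hT hpp hp hC hN hgood
    (fun t ht => (h.u_div t (Ico_subset_Icc_self ht)).divFree_comp) hu₀.divFree_comp
    (fun χ hχ hc t ht => h.momentum_weak hT hpp hC hN hgood hχ hc t (Ico_subset_Icc_self ht)) t ht
  have hcong : ∀ᵐ s ∂(volume.restrict (Ioc 0 T)),
      ∑ i, ∫ x, velForce (fun i j k => weakPartial k (fun x => τ s x (i, j))) i x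
          * comp i (u s) x
        = ∫ x, ∑ i, u s x i * divMat (τ s) x i := by
    filter_upwards [hgood] with s hs
    rw [← integral_finsetSum _ fun i _ => integrable_mul (p := 2) (q := 2) (hs.memLp_velForce i)
      (Lp.memLp (comp i (u s)))]
    refine integral_congr_ae ?_
    filter_upwards [ae_all_iff.2 fun i => comp_coe i (u s)] with x hx
    exact Finset.sum_congr rfl fun i _ => by rw [hx i, mul_comm]; rfl
  refine ⟨intervalIntegrable_congr_Ioc ht.1 ht.2.le hcong h1, ?_⟩
  rw [norm_sq_eq_sum_comp, norm_sq_eq_sum_comp, h2, integral_congr_Ioc ht.1 ht.2.le hcong]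

theorem IsWeakSolution.stress_energy (h : IsWeakSolution T 1 1 p u₀ τ₀ u τ) (hT : 0 < T)
    (hp : 3 / 2 < p) : ∀ t ∈ Ico 0 T,
      IntervalIntegrable (fun s => - (‖τ s‖ ^ 2 + gradNormSq (τ s))) volume 0 t ∧
        ‖τ t‖ ^ 2 = ‖τ₀‖ ^ 2 + 2 * ∫ s in (0 : ℝ)..t, - (‖τ s‖ ^ 2 + gradNormSq (τ s)) := by
  obtain ⟨p', hpp⟩ := exists_holderConjugate hp
  obtain ⟨C, N, hC, hN0, hN, hN2, hgood⟩ := h.energyClass.exists_goodSlice hpp hp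
  have he := h.energyClass.stress_energy (A₀ := fun i j => comp (i, j) τ₀) hT hpp hp hC hN0 hN hN2
    hgood (fun i j χ hχ hc t ht =>
      h.stress_weak hT hpp hC hN0 hN hgood i j hχ hc t (Ico_subset_Icc_self ht))
  have hn : ∀ f : MatL2, ∑ i, ∑ j, ‖comp (i, j) f‖ ^ 2 = ‖f‖ ^ 2 := fun f => by
    rw [norm_sq_eq_sum_comp, Fintype.sum_prod_type]
  simpa only [hn, gradNormSq] using he

/-- An integrating factor: `E' = -2 (E + g)` gives `(e^{2t} E)' = -2 e^{2t} g`. The function `E` is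
only absolutely continuous, so the product rule is the one for primitives. -/
theorem exp_mul_energy {E g : ℝ → ℝ} {E₀ : ℝ}
    (h : ∀ t ∈ Ico 0 T, IntervalIntegrable (fun s => - (E s + g s)) volume 0 t ∧
      E t = E₀ + 2 * ∫ s in (0 : ℝ)..t, - (E s + g s)) {t : ℝ} (ht : t ∈ Ico 0 T) :
    IntervalIntegrable (fun s => Real.exp (2 * s) * g s) volume 0 t ∧
      Real.exp (2 * t) * E t + 2 * ∫ s in (0 : ℝ)..t, Real.exp (2 * s) * g s = E₀ := by
  -- The exponential is written as `1` plus a primitive, to match the form of the product rule.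
  have hexp : ∀ s, 1 + ∫ r in (0 : ℝ)..s, 2 * Real.exp (2 * r) = Real.exp (2 * s) := fun s => by
    rw [intervalIntegral.integral_eq_sub_of_hasDerivAt (f := fun r => Real.exp (2 * r))]
    · simp
    · intro r _
      have := ((hasDerivAt_id r).const_mul 2).exp
      simpa [mul_comm] using this
    · exact (by fun_prop : Continuous fun r => 2 * Real.exp (2 * r)).intervalIntegrable _ _
  have hE : ∀ s ∈ Ico 0 T, E₀ + ∫ r in (0 : ℝ)..s, 2 * - (E r + g r) = E s := fun s hs => by
    rw [intervalIntegral.integral_const_mul, ← (h s hs).2]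
  obtain ⟨h1, h2⟩ := integral_primitive_mul (f := fun r => 2 * - (E r + g r))
    (g := fun r => 2 * Real.exp (2 * r)) (t := t) (a₀ := E₀) (b₀ := 1) ((h t ht).1.const_mul 2)
    ((by fun_prop : Continuous fun r => 2 * Real.exp (2 * r)).intervalIntegrable _ _)
  have hcong : ∀ s ∈ Icc 0 t, 2 * - (E s + g s) * (1 + ∫ r in (0 : ℝ)..s, 2 * Real.exp (2 * r))
      + (E₀ + ∫ r in (0 : ℝ)..s, 2 * - (E r + g r)) * (2 * Real.exp (2 * s))
      = -2 * (Real.exp (2 * s) * g s) := fun s hs => by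
    rw [hexp, hE s ⟨hs.1, hs.2.trans_lt ht.2⟩]; ring
  have h3 : IntervalIntegrable (fun s => -2 * (Real.exp (2 * s) * g s)) volume 0 t :=
    intervalIntegrable_congr_Ioc ht.1 le_rfl ((ae_restrict_iff' measurableSet_Ioc).2
      (Eventually.of_forall fun s hs => hcong s (Ioc_subset_Icc_self hs))) h1
  refine ⟨?_, ?_⟩
  · refine (h3.const_mul (-1 / 2)).congr fun s _ => ?_
    ring
  · have h4 := integral_congr_Ioc ht.1 le_rfl ((ae_restrict_iff' measurableSet_Ioc).2
      (Eventually.of_forall fun s hs => hcong s (Ioc_subset_Icc_self hs)))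
    rw [h4, hexp, hE t ht, intervalIntegral.integral_const_mul] at h2
    linarith

end

end OldroydB

open OldroydB in
theorem mainTheorem4 (T p : ℝ) (hT : 0 < T) (hp : 3 / 2 < p)
    (u₀ : VecL2) (τ₀ : MatL2) (hu₀ : IsDivFree u₀)
    (u : ℝ → VecL2) (τ : ℝ → MatL2)
    (h : IsWeakSolution T 1 1 p u₀ τ₀ u τ) :
    ∀ t ∈ Set.Ico 0 T,
      (IntervalIntegrable (fun s => ∫ x, ∑ i, u s x i * divMat (τ s) x i)
          MeasureTheory.volume 0 t ∧
        ‖u t‖ ^ 2 = ‖u₀‖ ^ 2 + 2 * ∫ s in (0 : ℝ)..t, ∫ x, ∑ i, u s x i * divMat (τ s) x i) ∧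
      (IntervalIntegrable (fun s => Real.exp (2 * s) * gradNormSq (τ s))
          MeasureTheory.volume 0 t ∧
        Real.exp (2 * t) * ‖τ t‖ ^ 2
          + 2 * ∫ s in (0 : ℝ)..t, Real.exp (2 * s) * gradNormSq (τ s) = ‖τ₀‖ ^ 2) :=
  fun _ ht => ⟨h.vel_energy hT hp hu₀ ht, exp_mul_energy (h.stress_energy hT hp) ht⟩
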